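/- Let $M$ be a compact complex manifold of dimension $n$ and let $g(t)$, $t\in[0,\tau)$, be a smooth family of Hermitian metrics on $M$, with components $g_{i\bar j}=g(\partial/\partial z_i,\partial/\partial\bar z_j)$ in holomorphic coordinates. For a Hermitian metric $g$ let $\nabla$ be its Chern connection (the connection with $\nabla g=0$, $\nabla J=0$ whose torsion has no $(1,1)$-part), $T(X,Y)=\nabla_XY-\nabla_YX-[X,Y]$ its torsion, and $$\Omega(X,Y,Z,W)=g\bigl((\nabla_X\nabla_Y-\nabla_Y\nabla_X-\nabla_{[X,Y]})Z,W\bigr)$$ its curvature, all extended $\mathbb C$-linearly to $TM\otimes\mathbb C$. Suppose that $g(t)$ solves the Hermitian curvature flow $$\frac{d g_{i\bar j}}{dt}=-S_{i\bar j}-Q_{i\bar j},\qquad S_{i\bar j}=g^{m\bar n}\Omega_{m\bar n i\bar j},\qquad Q_{i\bar j}=\tfrac12\, g^{m\bar n}g^{p\bar s}T_{pm\bar j}T_{\bar s\bar n i},$$ on $[0,\tau)$, where $T_{pm\bar j}=g(T(\partial_p,\partial_m),\partial_{\bar j})$ and $T_{\bar s\bar n i}=\overline{T_{sn\bar i}}$,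 and that the Chern curvature of $g(0)$ is Griffiths non-negative, i.e. $\Omega^{g(0)}(\xi,\bar\xi,\eta,\bar\eta)\ge 0$ for all $x\in M$ and $\xi,\eta\in T^{1,0}_xM$. Then for every $t_0\in(0,\tau)$ the set $$Z=\{(\xi,\eta)\ :\ \xi,\eta\in T^{1,0}_xM,\ x\in M,\ \Omega^{g(t_0)}(\xi,\bar\xi,\eta,\bar\eta)=0\}\subset T^{1,0}M\oplus T^{1,0}M$$ is invariant under the torsion-twisted parallel transport of $g(t_0)$. That is, if $\gamma\colon J\to M$ is a smooth curve on an interval $J$, and $\xi,\eta$ are sections of $T^{1,0}M$ along $\gamma$ that satisfy $$\nabla_{\gamma'}\xi=T(\gamma',\xi),\qquad \nabla_{\gamma'}\eta=-g(\eta,T(\gamma',\cdot))^\#,$$ where $\nabla$, $T$, $g$ and the isomorphism $\#\colon T^*M\to TM$ (extended $\mathbb C$-linearly) are those of $g(t_0)$, and if $(\xi(s_0),\eta(s_0))\in Z$ for some $s_0\in J$, then $(\xi(s),\eta(s))\in Z$ for all $s\in J$. -/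

import Mathlib

open scoped ContDiff Manifold ComplexConjugate

noncomputable section

namespace HermitianFlow

/-- The model space `ℂⁿ`. -/
abbrev Cn (n : ℕ) : Type := EuclideanSpace ℂ (Fin n)

/-! ### Hermitian geometry of a matrix of functions on `ℂⁿ`

`G z k l` stands for the component `g_{k l̄}` of a Hermitian metric at the point with holomorphic
coordinates `z`. The inverse components `g^{k l̄}`, with `∑ l, g_{j l̄} g^{k l̄} = δ_j^k`, are
then `(G z)⁻¹ l k`. -/

/-- The Wirtinger derivative `∂f/∂zᵢ = (∂f/∂xᵢ - √-1 ∂f/∂yᵢ) / 2` at `z`. -/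
def dz {n : ℕ} (i : Fin n) (f : Cn n → ℂ) (z : Cn n) : ℂ :=
  (fderiv ℝ f z (EuclideanSpace.single i 1) -
    Complex.I * fderiv ℝ f z (EuclideanSpace.single i Complex.I)) / 2

/-- The Wirtinger derivative `∂f/∂z̄ᵢ = (∂f/∂xᵢ + √-1 ∂f/∂yᵢ) / 2` at `z`. -/
def dzbar {n : ℕ} (i : Fin n) (f : Cn n → ℂ) (z : Cn n) : ℂ :=
  (fderiv ℝ f z (EuclideanSpace.single i 1) +
    Complex.I * fderiv ℝ f z (EuclideanSpace.single i Complex.I)) / 2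

/-- Coefficients `Γ_{ij}^k = g^{k l̄} ∂ᵢ g_{j l̄}` of the Chern connection in holomorphic
coordinates: `∇_i ∂_j = Γ_{ij}^k ∂_k` and `∇_{ī} ∂_j = 0`. The latter says that `∇` preserves the
complex structure and that its torsion has no `(1,1)`-part (equivalently, that the `(0,1)`-part of
`∇` is `∂̄`); the former is then forced by `∇g = 0`, see `chernSymbol_iff`. -/
def chernSymbol {n : ℕ} (G : Cn n → Matrix (Fin n) (Fin n) ℂ) (z : Cn n)
    (i j k : Fin n) : ℂ :=
  ∑ l, dz i (fun w => G w j l) z * (G z)⁻¹ l k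

/-- `Γ_{ij}^k` are the only numbers with `∂ᵢ g(∂_j, ∂_{l̄}) = g(∇_i ∂_j, ∂_{l̄})`, which is the
compatibility of `∇` with the metric, since `∇_i ∂_{l̄} = 0`. -/
theorem chernSymbol_iff {n : ℕ} (G : Cn n → Matrix (Fin n) (Fin n) ℂ) (z : Cn n)
    (hG : IsUnit (G z).det) (i j : Fin n) (c : Fin n → ℂ) :
    (∀ l, ∑ k, c k * G z k l = dz i (fun w => G w j l) z) ↔ c = chernSymbol G z i j := by
  have key : chernSymbol G z i j =
      Matrix.vecMul (fun l => dz i (fun w => G w j l) z) (G z)⁻¹ := by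
    funext k; rfl
  rw [key]
  constructor
  · intro h
    have h' : Matrix.vecMul c (G z) = fun l => dz i (fun w => G w j l) z := funext h
    rw [← h', Matrix.vecMul_vecMul, Matrix.mul_nonsing_inv _ hG, Matrix.vecMul_one]
  · rintro rfl l
    have h' := congrFun (Matrix.vecMul_vecMul (fun l => dz i (fun w => G w j l) z) (G z)⁻¹ (G z)) l
    rw [Matrix.nonsing_inv_mul _ hG, Matrix.vecMul_one] at h'
    exact h'

/-- Torsion `T_{ij}^k` of the Chern connection: `T(∂_i, ∂_j) = ∇_i ∂_j - ∇_j ∂_i = T_{ij}^k ∂_k`. -/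
def torsion {n : ℕ} (G : Cn n → Matrix (Fin n) (Fin n) ℂ) (z : Cn n)
    (i j k : Fin n) : ℂ :=
  chernSymbol G z i j k - chernSymbol G z j i k

/-- `T_{ij l̄} = g(T(∂_i, ∂_j), ∂_{l̄})`. Since `T` and `g` are real,
`T_{ī j̄ l} = g(T(∂_{ī}, ∂_{j̄}), ∂_l)` is the complex conjugate of `T_{ij l̄}`. -/
def torsionLow {n : ℕ} (G : Cn n → Matrix (Fin n) (Fin n) ℂ) (z : Cn n)
    (i j l : Fin n) : ℂ :=
  ∑ k, torsion G z i j k * G z k l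

/-- Chern curvature `Ω_{i j̄ k l̄} = g((∇_i ∇_{j̄} - ∇_{j̄} ∇_i) ∂_k, ∂_{l̄})`. As `∇_{j̄} ∂_k = 0`,
this is `-g(∇_{j̄} (Γ_{ik}^p ∂_p), ∂_{l̄}) = -(∂_{j̄} Γ_{ik}^p) g_{p l̄}`. -/
def chernCurv {n : ℕ} (G : Cn n → Matrix (Fin n) (Fin n) ℂ) (z : Cn n)
    (i j k l : Fin n) : ℂ :=
  -∑ p, dzbar j (fun w => chernSymbol G w i k p) z * G z p l

/-- Second Chern-Ricci curvature `S_{i j̄} = g^{m n̄} Ω_{m n̄ i j̄}`. -/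
def secondRicci {n : ℕ} (G : Cn n → Matrix (Fin n) (Fin n) ℂ) (z : Cn n)
    (i j : Fin n) : ℂ :=
  ∑ m, ∑ r, (G z)⁻¹ r m * chernCurv G z m r i j

/-- Quadratic torsion term `Q_{i j̄} = (1/2) g^{m n̄} g^{p s̄} T_{pm j̄} T_{s̄ n̄ i}`. -/
def torsionQ {n : ℕ} (G : Cn n → Matrix (Fin n) (Fin n) ℂ) (z : Cn n)
    (i j : Fin n) : ℂ :=
  (1 / 2) * ∑ m, ∑ r, ∑ p, ∑ s, (G z)⁻¹ r m * (G z)⁻¹ s p *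
    torsionLow G z p m j * conj (torsionLow G z s r i)

/-! ### Hermitian metrics on a complex manifold

A complex manifold of dimension `n` is a manifold modelled on `ℂⁿ` over the field `ℂ`. Its complex
tangent space at `x` is identified with `T_x^{1,0}M` by `v ↦ (v - √-1 J v) / 2`; under this
identification the holomorphic coordinate fields are `∂/∂z_k`. -/

/-- The holomorphic tangent space `T_x^{1,0}M`. -/
abbrev T10 (n : ℕ) {M : Type*} [TopologicalSpace M] [ChartedSpace (Cn n) M] (x : M) : Type :=
  TangentSpace 𝓘(ℂ, Cn n) x

/-- Holomorphic coordinate charts. -/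
abbrev holCharts (n : ℕ) (M : Type*) [TopologicalSpace M] [ChartedSpace (Cn n) M] :
    Set (OpenPartialHomeomorph M (Cn n)) :=
  IsManifold.maximalAtlas 𝓘(ℂ, Cn n) ω M

/-- The vector `∂/∂z_k` of the chart `e` at the point with coordinates `z`. -/
def coordVec {n : ℕ} {M : Type*} [TopologicalSpace M] [ChartedSpace (Cn n) M]
    (e : OpenPartialHomeomorph M (Cn n)) (z : Cn n) (k : Fin n) :
    T10 n (e.symm z) :=
  mfderiv 𝓘(ℂ, Cn n) 𝓘(ℂ, Cn n) e.symm z (EuclideanSpace.single k 1 : Cn n)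

/-- The components `ξ^k` in the chart `e` of a tangent vector `ξ = ξ^k ∂/∂z_k` at `x`. -/
def coords {n : ℕ} {M : Type*} [TopologicalSpace M] [ChartedSpace (Cn n) M]
    (e : OpenPartialHomeomorph M (Cn n)) (x : M)
    (ξ : T10 n x) : Cn n :=
  mfderiv 𝓘(ℂ, Cn n) 𝓘(ℂ, Cn n) e x ξ

/-- A smooth Hermitian metric; `form x ξ η` is `g(ξ, η̄)` for `ξ, η ∈ T_x^{1,0}M`. -/
structure HermitianMetric (n : ℕ) (M : Type*) [TopologicalSpace M]
    [ChartedSpace (Cn n) M] where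
  form : ∀ x : M, T10 n x →ₗ[ℂ]
    T10 n x →ₗ⋆[ℂ] ℂ
  conj_symm : ∀ (x : M) (ξ η : T10 n x), form x η ξ = conj (form x ξ η)
  pos : ∀ (x : M) (ξ : T10 n x), ξ ≠ 0 → 0 < (form x ξ ξ).re
  smooth : ∀ e ∈ holCharts n M, ∀ k l : Fin n,
    ContDiffOn ℝ ∞ (fun z => form (e.symm z) (coordVec e z k) (coordVec e z l)) e.target

section Metric

variable {n : ℕ} {M : Type*} [TopologicalSpace M] [ChartedSpace (Cn n) M]

/-- The matrix of components `g_{k l̄} = g(∂/∂z_k, ∂/∂z̄_l)` in the chart `e`. -/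
def HermitianMetric.comps (g : HermitianMetric n M) (e : OpenPartialHomeomorph M (Cn n))
    (z : Cn n) : Matrix (Fin n) (Fin n) ℂ :=
  Matrix.of fun k l => g.form (e.symm z) (coordVec e z k) (coordVec e z l)

/-- `Ω(ξ, ζ̄, η, ν̄)` for `ξ, ζ, η, ν ∈ T_x^{1,0}M`, where `Ω` is the Chern curvature of `g`. It is
computed in the preferred chart at `x`; `Ω` is a tensor, so that any chart gives the same value. -/
def HermitianMetric.curvature (g : HermitianMetric n M) (x : M)
    (ξ ζ η ν : T10 n x) : ℂ :=
  let e := chartAt (Cn n) x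
  ∑ i, ∑ j, ∑ k, ∑ l, chernCurv (g.comps e) (e x) i j k l *
    coords e x ξ i * conj (coords e x ζ j) * coords e x η k * conj (coords e x ν l)

/-- Griffiths non-negativity: `Ω(ξ, ξ̄, η, η̄) ≥ 0` for all `ξ, η ∈ T^{1,0}M`. (This number is
always real.) -/
def HermitianMetric.GriffithsNonneg (g : HermitianMetric n M) : Prop :=
  ∀ (x : M) (ξ η : T10 n x), 0 ≤ (g.curvature x ξ ξ η η).re

/-- The zero set `{(ξ, η) | Ω(ξ, ξ̄, η, η̄) = 0}` in `T^{1,0}M ⊕ T^{1,0}M`, as a set of triples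
of a point `x` and two vectors at `x`. -/
def HermitianMetric.zeroSet (g : HermitianMetric n M) :
    Set (Σ x : M, T10 n x × T10 n x) :=
  {p | g.curvature p.1 p.2.1 p.2.1 p.2.2 p.2.2 = 0}

/-- `g(t)`, `t ∈ [0, τ)`, is a smooth solution of the Hermitian curvature flow
`d g_{i j̄} / dt = -S_{i j̄} - Q_{i j̄}`. -/
structure IsHCF (τ : ℝ) (g : ℝ → HermitianMetric n M) : Prop where
  smooth : ∀ e ∈ holCharts n M, ∀ k l : Fin n,
    ContDiffOn ℝ ∞ (fun p : ℝ × Cn n => (g p.1).comps e p.2 k l)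
      (Set.Ico 0 τ ×ˢ e.target)
  evolution : ∀ e ∈ holCharts n M, ∀ z ∈ e.target, ∀ t ∈ Set.Ico 0 τ, ∀ i j : Fin n,
    HasDerivWithinAt (fun s => (g s).comps e z i j)
      (-secondRicci ((g t).comps e) z i j - torsionQ ((g t).comps e) z i j) (Set.Ico 0 τ) t

/-- The pair `(ξ, η)` of sections of `T^{1,0}M` along the curve `γ : J → M` is parallel for the
torsion-twisted transport `∇_{γ'} ξ = T(γ', ξ)`, `∇_{γ'} η = -g(η, T(γ', ·))^#`.

In a holomorphic chart let `w i` be the derivatives of the coordinates of `γ`, so that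
`γ' = w^i ∂_i + w̄^i ∂_{ī}`. Then `∇_{γ'} ξ` has the components `(ξ^k)' + Γ_{ij}^k w^i ξ^j`, `T(γ', ξ)`
has the components `T_{ij}^k w^i ξ^j`, and `g(η, T(γ', ·))^#` has the components
`g^{k s̄} η^j w̄^i T_{ī s̄ j}`. -/
structure IsTwistedParallel (g : HermitianMetric n M) (J : Set ℝ) (γ : ℝ → M)
    (ξ η : ∀ s : ℝ, T10 n (γ s)) : Prop where
  fst : ∀ e ∈ holCharts n M, ∀ s ∈ J, γ s ∈ e.source → ∀ k : Fin n,
    let w : Fin n → ℂ := fun i => derivWithin (fun r => e (γ r) i) J s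
    HasDerivWithinAt (fun r => coords e (γ r) (ξ r) k)
      (-(∑ i, ∑ j, chernSymbol (g.comps e) (e (γ s)) i j k * w i * coords e (γ s) (ξ s) j)
        + ∑ i, ∑ j, torsion (g.comps e) (e (γ s)) i j k * w i * coords e (γ s) (ξ s) j) J s
  snd : ∀ e ∈ holCharts n M, ∀ s ∈ J, γ s ∈ e.source → ∀ k : Fin n,
    let w : Fin n → ℂ := fun i => derivWithin (fun r => e (γ r) i) J s
    HasDerivWithinAt (fun r => coords e (γ r) (η r) k)
      (-(∑ i, ∑ j, chernSymbol (g.comps e) (e (γ s)) i j k * w i * coords e (γ s) (η s) j)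
        - ∑ q, (g.comps e (e (γ s)))⁻¹ q k *
          ∑ i, ∑ j, coords e (γ s) (η s) j * conj (w i) *
            conj (torsionLow (g.comps e) (e (γ s)) i q j)) J s

/-- A subset `Z` of `T^{1,0}M ⊕ T^{1,0}M` is invariant under the torsion-twisted parallel transport
of `g`: along every smooth curve `γ : J → M` on an interval `J`, a parallel pair of sections that
lies in `Z` at one parameter lies in `Z` at all parameters. -/
def IsTwistedInvariant (g : HermitianMetric n M)
    (Z : Set (Σ x : M, T10 n x × T10 n x)) :
    Prop :=
  ∀ (J : Set ℝ), J.OrdConnected → ∀ γ : ℝ → M,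
    ContMDiffOn 𝓘(ℝ, ℝ) 𝓘(ℝ, Cn n) ∞ γ J →
    ∀ ξ η : ∀ s : ℝ, T10 n (γ s), IsTwistedParallel g J γ ξ η →
    ∀ s₀ ∈ J, ∀ s₁ ∈ J, (⟨γ s₀, ξ s₀, η s₀⟩ : Σ x : M, T10 n x ×
      T10 n x) ∈ Z → ⟨γ s₁, ξ s₁, η s₁⟩ ∈ Z

end Metric

end HermitianFlow

end

noncomputable section

set_option linter.unusedSectionVars false

namespace HermitianFlow

open scoped ContDiff Manifold ComplexConjugate

/-! The flow becomes tractable on the holomorphic cotangent bundle. For the inverse matrix H of the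
metric it reads ∂_t H = H ∂∂̄H − ∂H ∂̄H; the torsion term Q is exactly what produces this form
(`inv_mul_flow_mul_inv`). Hence F(x, α) = |α|² solves ∂_t F = ∑ (F_{α_m ᾱ_n} F_{x_m x̄_n} − F_{α_m
x̄_n} F_{x_m ᾱ_n}), an equation with constant coefficients, quadratic in the complex Hessian and
built from the canonical symplectic pairing (`MetricFlow.isPoissonFlow_normFun`). Applying ∂_v ∂̄_v
to it, the Leibniz rule shows that the Levi form L of F, a function of ((x, α), (ξ, A)), solves the
same equation for the doubled pairing, in which A is paired with x and α with ξ
(`IsPoissonFlow.levLift`). Completing the square in A gives L = Ω(ξ, ξ̄, η, η̄) + |A − A_min|²,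
where α is dual to η̄ (`normLevi_eq`, `curvForm_eq_griff`). The curvature u = Ω(ξ, ξ̄, η, η̄) is
thus the minimum over A of a solution.

The positivity is linear algebra. For a Hessian U = ∑ W_r W_r^* ≥ 0 the right-hand side of the
equation is half of ∑ |ω(W_r, W_s)|², ω being the symplectic pairing, so it is nonnegative
(`hessQ_nonneg`). By Cauchy–Schwarz it also controls the Levi form in the direction obtained by
contracting U with a covector θ and rotating by ω (`levi_rot_col_le`). A test function that touches
u from below, pulled back by forgetting A, touches L from below at the minimizer. So u satisfies, in
the sense of test functions and up to errors, ∂_t u ≥ 0 and |θ|² ∂_t u ≥ (1/2) · (Levi form of the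
test function along X_θ); see `MetricFlow.exists_touching_bounds`. With θ placed in the A
directions, X_θ involves only H and its first derivatives: it is the smooth field `twistField`,
horizontal for the torsion-twisted connection.

This is used twice. First, adding ε e^{Ct} |ξ|² |η|² to u and arguing at a first time of vanishing
shows that Griffiths non-negativity is preserved (`IsHCF.griffithsNonneg`). Then, with u ≥ 0 on a
full space-time neighbourhood of a point at time t₀ > 0, the second inequality bounds the Hessian of
a test function along X_θ by its first derivatives, the time derivative being one of them. This is
the setting of Bony's strong maximum principle: a Hopf-type barrier makes the zero set of u tangent
to (0, X_θ) in the sense of exterior balls (`inner_eq_zero_of_exterior_ball`), and a Grönwall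
estimate for the squared distance to the zero set shows that integral curves do not leave it
(`zero_along_curve`).

Finally, in a chart a torsion-twisted parallel pair is an integral curve of X_θ, with time-dependent
control θ dual to the velocity of the curve (`hasDerivWithinAt_twistField`). Vanishing of u is
therefore locally constant along it, and connectedness of the parameter interval concludes. -/

theorem two_le_infty : (2 : WithTop ℕ∞) ≤ ∞ :=
  WithTop.coe_le_coe.2 (le_top : (2 : ℕ∞) ≤ ⊤)

/-! ### Wirtinger derivatives along vectors of a complex normed space -/

section Wirtinger
variable {E : Type*} [NormedAddCommGroup E] [NormedSpace ℝ E] [NormedSpace ℂ E]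

/-- The Wirtinger derivative `∂_X f` in the direction of a vector `X`. -/
def wd (X : E) (f : E → ℂ) (p : E) : ℂ :=
  (fderiv ℝ f p X - Complex.I * fderiv ℝ f p (Complex.I • X)) / 2

/-- The Wirtinger derivative `∂̄_X f` in the direction of a vector `X`. -/
def wb (X : E) (f : E → ℂ) (p : E) : ℂ :=
  (fderiv ℝ f p X + Complex.I * fderiv ℝ f p (Complex.I • X)) / 2

theorem fderiv_eq_wd_add_wb (X : E) (f : E → ℂ) (p : E) :
    fderiv ℝ f p X = wd X f p + wb X f p := by
  simp only [wd, wb]; ring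

theorem wd_congr {f g : E → ℂ} {p : E} (h : f =ᶠ[nhds p] g) (X : E) : wd X f p = wd X g p := by
  simp only [wd, h.fderiv_eq]

theorem wb_congr {f g : E → ℂ} {p : E} (h : f =ᶠ[nhds p] g) (X : E) : wb X f p = wb X g p := by
  simp only [wb, h.fderiv_eq]

theorem wd_const (X : E) (c : ℂ) (p : E) : wd X (fun _ => c) p = 0 := by simp [wd]

theorem wb_const (X : E) (c : ℂ) (p : E) : wb X (fun _ => c) p = 0 := by simp [wb]

theorem wd_add {f g : E → ℂ} {p : E} (hf : DifferentiableAt ℝ f p) (hg : DifferentiableAt ℝ g p)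
    (X : E) : wd X (fun q => f q + g q) p = wd X f p + wd X g p := by
  simp only [wd, fderiv_fun_add hf hg, add_apply]; ring

theorem wd_sub {f g : E → ℂ} {p : E} (hf : DifferentiableAt ℝ f p) (hg : DifferentiableAt ℝ g p)
    (X : E) : wd X (fun q => f q - g q) p = wd X f p - wd X g p := by
  simp only [wd, fderiv_fun_sub hf hg, sub_apply]; ring

theorem wb_sub {f g : E → ℂ} {p : E} (hf : DifferentiableAt ℝ f p) (hg : DifferentiableAt ℝ g p)
    (X : E) : wb X (fun q => f q - g q) p = wb X f p - wb X g p := by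
  simp only [wb, fderiv_fun_sub hf hg, sub_apply]; ring

theorem wd_mul {f g : E → ℂ} {p : E} (hf : DifferentiableAt ℝ f p) (hg : DifferentiableAt ℝ g p)
    (X : E) : wd X (fun q => f q * g q) p = wd X f p * g p + f p * wd X g p := by
  simp only [wd, fderiv_fun_mul hf hg, add_apply,
    smul_apply, smul_eq_mul]; ring

theorem wb_mul {f g : E → ℂ} {p : E} (hf : DifferentiableAt ℝ f p) (hg : DifferentiableAt ℝ g p)
    (X : E) : wb X (fun q => f q * g q) p = wb X f p * g p + f p * wb X g p := by
  simp only [wb, fderiv_fun_mul hf hg, add_apply,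
    smul_apply, smul_eq_mul]; ring

theorem wd_sum {κ : Type*} (s : Finset κ) {f : κ → E → ℂ} {p : E}
    (hf : ∀ i ∈ s, DifferentiableAt ℝ (f i) p) (X : E) :
    wd X (fun q => ∑ i ∈ s, f i q) p = ∑ i ∈ s, wd X (f i) p := by
  simp only [wd, fderiv_fun_sum hf, sum_apply]
  rw [Finset.mul_sum, ← Finset.sum_sub_distrib, Finset.sum_div]

theorem wb_sum {κ : Type*} (s : Finset κ) {f : κ → E → ℂ} {p : E}
    (hf : ∀ i ∈ s, DifferentiableAt ℝ (f i) p) (X : E) :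
    wb X (fun q => ∑ i ∈ s, f i q) p = ∑ i ∈ s, wb X (f i) p := by
  simp only [wb, fderiv_fun_sum hf, sum_apply]
  rw [Finset.mul_sum, ← Finset.sum_add_distrib, Finset.sum_div]

theorem fderiv_conj (f : E → ℂ) (p X : E) :
    fderiv ℝ (fun q => conj (f q)) p X = conj (fderiv ℝ f p X) := by
  have h : (fun q => conj (f q)) = Complex.conjCLE ∘ f := by ext; simp
  rw [h, ContinuousLinearEquiv.comp_fderiv]; simp

theorem conj_wd (X : E) (f : E → ℂ) (p : E) :
    conj (wd X f p) = wb X (fun q => conj (f q)) p := by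
  simp [wd, wb, fderiv_conj, Complex.conj_ofNat]

theorem conj_wb (X : E) (f : E → ℂ) (p : E) :
    conj (wb X f p) = wd X (fun q => conj (f q)) p := by
  simp only [wd, wb, fderiv_conj]
  simp [sub_eq_add_neg, Complex.conj_ofNat]

variable [IsScalarTower ℝ ℂ E]

theorem wd_smul_dir (c : ℂ) (X : E) (f : E → ℂ) (p : E) : wd (c • X) f p = c * wd X f p := by
  have h1 : c • X = c.re • X + c.im • (Complex.I • X) := by
    conv_lhs => rw [← Complex.re_add_im c]
    rw [add_smul, mul_smul, ← Complex.coe_algebraMap, algebraMap_smul, algebraMap_smul]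
  have h2 : Complex.I • c • X = c.re • (Complex.I • X) - c.im • X := by
    rw [h1, smul_add, smul_comm _ c.re, smul_comm _ c.im, smul_smul, Complex.I_mul_I]
    simp [sub_eq_add_neg]
  simp only [wd, h2]
  rw [h1]
  simp only [map_add, map_sub, map_smul, Complex.real_smul]
  conv_rhs => rw [← Complex.re_add_im c]
  linear_combination ((c.im : ℂ) * fderiv ℝ f p (Complex.I • X) / 2) * Complex.I_sq

theorem wb_smul_dir (c : ℂ) (X : E) (f : E → ℂ) (p : E) :
    wb (c • X) f p = conj c * wb X f p := by
  have := congrArg conj (wd_smul_dir c X (fun q => conj (f q)) p)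
  simpa [conj_wd] using this

theorem wd_add_dir (X Y : E) (f : E → ℂ) (p : E) : wd (X + Y) f p = wd X f p + wd Y f p := by
  simp only [wd, smul_add, map_add]; ring

theorem wb_add_dir (X Y : E) (f : E → ℂ) (p : E) : wb (X + Y) f p = wb X f p + wb Y f p := by
  simp only [wb, smul_add, map_add]; ring

theorem wd_sum_dir {κ : Type*} (s : Finset κ) (c : κ → ℂ) (X : κ → E) (f : E → ℂ) (p : E) :
    wd (∑ a ∈ s, c a • X a) f p = ∑ a ∈ s, c a * wd (X a) f p := by
  classical
  induction s using Finset.induction_on with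
  | empty => simp [wd]
  | insert a s ha ih => rw [Finset.sum_insert ha, Finset.sum_insert ha, wd_add_dir, ih, wd_smul_dir]

theorem wb_sum_dir {κ : Type*} (s : Finset κ) (c : κ → ℂ) (X : κ → E) (f : E → ℂ) (p : E) :
    wb (∑ a ∈ s, c a • X a) f p = ∑ a ∈ s, conj (c a) * wb (X a) f p := by
  classical
  induction s using Finset.induction_on with
  | empty => simp [wb]
  | insert a s ha ih => rw [Finset.sum_insert ha, Finset.sum_insert ha, wb_add_dir, ih, wb_smul_dir]

/-- Wirtinger derivatives of a complex linear function. -/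
theorem wd_clm (ε : E →L[ℂ] ℂ) (X p : E) : wd X (fun q => ε q) p = ε X := by
  have h : fderiv ℝ (fun q => ε q) p = (ε.restrictScalars ℝ) :=
    (ε.restrictScalars ℝ).fderiv
  simp only [wd, h, ContinuousLinearMap.coe_restrictScalars', map_smul, smul_eq_mul]
  linear_combination (- ε X / 2) * Complex.I_sq

theorem wb_clm (ε : E →L[ℂ] ℂ) (X p : E) : wb X (fun q => ε q) p = 0 := by
  have h : fderiv ℝ (fun q => ε q) p = (ε.restrictScalars ℝ) :=
    (ε.restrictScalars ℝ).fderiv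
  simp only [wb, h, ContinuousLinearMap.coe_restrictScalars', map_smul, smul_eq_mul]
  linear_combination (ε X / 2) * Complex.I_sq

/-- Wirtinger derivatives of a composition with a complex differentiable map. -/
theorem wd_comp {F : Type*} [NormedAddCommGroup F] [NormedSpace ℝ F] [NormedSpace ℂ F]
    [IsScalarTower ℝ ℂ F] {φ : E → F} {φ' : E →L[ℂ] F} {f : F → ℂ} {p : E}
    (hf : DifferentiableAt ℝ f (φ p)) (hφ : HasFDerivAt φ φ' p) (X : E) :
    wd X (fun q => f (φ q)) p = wd (φ' X) f (φ p) := by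
  have h := (hf.hasFDerivAt.comp p (hφ.restrictScalars ℝ)).fderiv
  have h' : fderiv ℝ (fun q => f (φ q)) p = (fderiv ℝ f (φ p)).comp (φ'.restrictScalars ℝ) := h
  simp [wd, h']

theorem wb_comp {F : Type*} [NormedAddCommGroup F] [NormedSpace ℝ F] [NormedSpace ℂ F]
    [IsScalarTower ℝ ℂ F] {φ : E → F} {φ' : E →L[ℂ] F} {f : F → ℂ} {p : E}
    (hf : DifferentiableAt ℝ f (φ p)) (hφ : HasFDerivAt φ φ' p) (X : E) :
    wb X (fun q => f (φ q)) p = wb (φ' X) f (φ p) := by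
  have h := (hf.hasFDerivAt.comp p (hφ.restrictScalars ℝ)).fderiv
  have h' : fderiv ℝ (fun q => f (φ q)) p = (fderiv ℝ f (φ p)).comp (φ'.restrictScalars ℝ) := h
  simp [wb, h']

theorem wb_eq_zero_of_differentiableAt {f : E → ℂ} {p : E} (hf : DifferentiableAt ℂ f p) (X : E) :
    wb X f p = 0 := by
  have h : fderiv ℝ f p = (fderiv ℂ f p).restrictScalars ℝ :=
    (hf.hasFDerivAt.restrictScalars ℝ).fderiv
  simp only [wb, h, ContinuousLinearMap.coe_restrictScalars', map_smul, smul_eq_mul]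
  linear_combination (fderiv ℂ f p X / 2) * Complex.I_sq

end Wirtinger

/-! ### Smoothness and commutation of Wirtinger derivatives -/

section Smooth
variable {E : Type*} [NormedAddCommGroup E] [NormedSpace ℝ E] [NormedSpace ℂ E] {O : Set E}

theorem differentiableAt_of_smoothOn {F : Type*} [NormedAddCommGroup F] [NormedSpace ℝ F]
    {f : E → F} (hf : ContDiffOn ℝ ∞ f O) (hO : IsOpen O)
    {p : E} (hp : p ∈ O) : DifferentiableAt ℝ f p :=
  (hf.contDiffAt (hO.mem_nhds hp)).differentiableAt (by simp)

theorem smoothOn_fderiv_dir {F : Type*} [NormedAddCommGroup F] [NormedSpace ℝ F] {f : E → F}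
    (hf : ContDiffOn ℝ ∞ f O) (hO : IsOpen O) (X : E) :
    ContDiffOn ℝ ∞ (fun p => fderiv ℝ f p X) O :=
  (hf.fderiv_of_isOpen hO (m := ∞) (by simp)).clm_apply contDiffOn_const

theorem smoothOn_wd {f : E → ℂ} (hf : ContDiffOn ℝ ∞ f O) (hO : IsOpen O) (X : E) :
    ContDiffOn ℝ ∞ (wd X f) O := by
  unfold wd
  exact ((smoothOn_fderiv_dir hf hO X).sub (contDiffOn_const.mul (smoothOn_fderiv_dir hf hO _))).div_const _

theorem smoothOn_wb {f : E → ℂ} (hf : ContDiffOn ℝ ∞ f O) (hO : IsOpen O) (X : E) :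
    ContDiffOn ℝ ∞ (wb X f) O := by
  unfold wb
  exact ((smoothOn_fderiv_dir hf hO X).add (contDiffOn_const.mul (smoothOn_fderiv_dir hf hO _))).div_const _

theorem smoothOn_conj {f : E → ℂ} (hf : ContDiffOn ℝ ∞ f O) :
    ContDiffOn ℝ ∞ (fun p => conj (f p)) O :=
  (Complex.conjCLE.contDiff.comp_contDiffOn hf :)

theorem fderiv_fderiv_apply {F : Type*} [NormedAddCommGroup F] [NormedSpace ℝ F] {f : E → F}
    (hf : ContDiffOn ℝ ∞ f O) (hO : IsOpen O) {p : E} (hp : p ∈ O) (X Y : E) :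
    fderiv ℝ (fun q => fderiv ℝ f q Y) p X = fderiv ℝ (fderiv ℝ f) p X Y := by
  have h : DifferentiableAt ℝ (fderiv ℝ f) p :=
    ((hf.fderiv_of_isOpen hO (m := ∞) (by simp)).contDiffAt (hO.mem_nhds hp)).differentiableAt
      (by simp)
  rw [fderiv_clm_apply h (differentiableAt_const _)]
  simp

theorem fderiv_fderiv_comm {F : Type*} [NormedAddCommGroup F] [NormedSpace ℝ F] {f : E → F}
    (hf : ContDiffOn ℝ ∞ f O) (hO : IsOpen O) {p : E} (hp : p ∈ O) (X Y : E) :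
    fderiv ℝ (fderiv ℝ f) p X Y = fderiv ℝ (fderiv ℝ f) p Y X :=
  ((hf.contDiffAt (hO.mem_nhds hp)).isSymmSndFDerivAt (by simpa using two_le_infty)) X Y

theorem fderiv_wirtinger {f : E → ℂ} (hf : ContDiffOn ℝ ∞ f O) (hO : IsOpen O) {p : E}
    (hp : p ∈ O) (a : ℂ) (X Y Y' : E) :
    fderiv ℝ (fun q => (fderiv ℝ f q Y + a * fderiv ℝ f q Y') / 2) p X =
      (fderiv ℝ (fderiv ℝ f) p X Y + a * fderiv ℝ (fderiv ℝ f) p X Y') / 2 := by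
  have h1 := differentiableAt_of_smoothOn (smoothOn_fderiv_dir hf hO Y) hO hp
  have h2 := differentiableAt_of_smoothOn (smoothOn_fderiv_dir hf hO Y') hO hp
  rw [← fderiv_fderiv_apply hf hO hp, ← fderiv_fderiv_apply hf hO hp]
  have h := ((h1.hasFDerivAt.add (h2.hasFDerivAt.const_mul a)).mul_const (2 : ℂ)⁻¹).fderiv
  have h' : fderiv ℝ (fun q => (fderiv ℝ f q Y + a * fderiv ℝ f q Y') * 2⁻¹) p = _ := h
  simp only [div_eq_mul_inv]
  rw [h']
  simp only [smul_apply, add_apply, smul_eq_mul]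
  ring

theorem wd_eq_add (X : E) (f : E → ℂ) :
    wd X f = fun q => (fderiv ℝ f q X + (-Complex.I) * fderiv ℝ f q (Complex.I • X)) / 2 := by
  ext; simp only [wd]; ring

theorem wd_wd_comm {f : E → ℂ} (hf : ContDiffOn ℝ ∞ f O) (hO : IsOpen O) {p : E} (hp : p ∈ O)
    (X Y : E) : wd X (wd Y f) p = wd Y (wd X f) p := by
  rw [wd_eq_add Y f, wd_eq_add X f]
  simp only [wd, fderiv_wirtinger hf hO hp]
  rw [fderiv_fderiv_comm hf hO hp X Y, fderiv_fderiv_comm hf hO hp (Complex.I • X) Y,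
    fderiv_fderiv_comm hf hO hp X (Complex.I • Y),
    fderiv_fderiv_comm hf hO hp (Complex.I • X) (Complex.I • Y)]
  ring

theorem wd_wb_comm {f : E → ℂ} (hf : ContDiffOn ℝ ∞ f O) (hO : IsOpen O) {p : E} (hp : p ∈ O)
    (X Y : E) : wd X (wb Y f) p = wb Y (wd X f) p := by
  rw [wd_eq_add X f]
  unfold wb
  simp only [wd, fderiv_wirtinger hf hO hp]
  rw [fderiv_fderiv_comm hf hO hp X Y, fderiv_fderiv_comm hf hO hp (Complex.I • X) Y,
    fderiv_fderiv_comm hf hO hp X (Complex.I • Y),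
    fderiv_fderiv_comm hf hO hp (Complex.I • X) (Complex.I • Y)]
  ring

theorem wb_wb_comm {f : E → ℂ} (hf : ContDiffOn ℝ ∞ f O) (hO : IsOpen O) {p : E} (hp : p ∈ O)
    (X Y : E) : wb X (wb Y f) p = wb Y (wb X f) p := by
  unfold wb
  simp only [fderiv_wirtinger hf hO hp]
  rw [fderiv_fderiv_comm hf hO hp X Y, fderiv_fderiv_comm hf hO hp (Complex.I • X) Y,
    fderiv_fderiv_comm hf hO hp X (Complex.I • Y),
    fderiv_fderiv_comm hf hO hp (Complex.I • X) (Complex.I • Y)]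
  ring

/-- The Levi form in terms of the real Hessian. -/
theorem wd_wb_self [IsScalarTower ℝ ℂ E] {f : E → ℂ} (hf : ContDiffOn ℝ ∞ f O) (hO : IsOpen O)
    {p : E} (hp : p ∈ O) (X : E) :
    wd X (wb X f) p = (fderiv ℝ (fderiv ℝ f) p X X +
      fderiv ℝ (fderiv ℝ f) p (Complex.I • X) (Complex.I • X)) / 4 := by
  unfold wb
  simp only [wd, fderiv_wirtinger hf hO hp]
  rw [fderiv_fderiv_comm hf hO hp (Complex.I • X) X]
  linear_combination (- fderiv ℝ (fderiv ℝ f) p (Complex.I • X) (Complex.I • X) / 4) * Complex.I_sq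

end Smooth

/-! ### Functions depending smoothly on time -/

section Family
variable {E : Type*} [NormedAddCommGroup E] [NormedSpace ℝ E] [NormedSpace ℂ E] {I : Set ℝ}
  {O : Set E}

/-- A family of functions on `O` depending smoothly on a parameter in `I`. -/
def SmoothFamily (I : Set ℝ) (O : Set E) (F : ℝ → E → ℂ) : Prop :=
  ContDiffOn ℝ ∞ (fun q : ℝ × E => F q.1 q.2) (I ×ˢ O)

namespace SmoothFamily
variable {F G : ℝ → E → ℂ}

theorem mono {I' : Set ℝ} {O' : Set E} (hF : SmoothFamily I O F) (hI : I' ⊆ I) (hO : O' ⊆ O) :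
    SmoothFamily I' O' F := ContDiffOn.mono hF (Set.prod_mono hI hO)

theorem add (hF : SmoothFamily I O F) (hG : SmoothFamily I O G) :
    SmoothFamily I O fun t p => F t p + G t p := ContDiffOn.add hF hG

theorem sub (hF : SmoothFamily I O F) (hG : SmoothFamily I O G) :
    SmoothFamily I O fun t p => F t p - G t p := ContDiffOn.sub hF hG

theorem mul (hF : SmoothFamily I O F) (hG : SmoothFamily I O G) :
    SmoothFamily I O fun t p => F t p * G t p := ContDiffOn.mul hF hG

theorem star (hF : SmoothFamily I O F) :
    SmoothFamily I O fun t p => starRingEnd ℂ (F t p) :=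
  Complex.conjCLE.contDiff.comp_contDiffOn hF

theorem const (c : ℂ) : SmoothFamily I O fun _ _ => c := contDiffOn_const

theorem sum {κ : Type*} {s : Finset κ} {F : κ → ℝ → E → ℂ}
    (h : ∀ i ∈ s, SmoothFamily I O (F i)) : SmoothFamily I O fun t p => ∑ i ∈ s, F i t p :=
  ContDiffOn.sum h

theorem of_contDiff {f : E → ℂ} (hf : ContDiff ℝ ∞ f) : SmoothFamily I O fun _ p => f p :=
  (hf.comp contDiff_snd).contDiffOn

theorem comp {E' : Type*} [NormedAddCommGroup E'] [NormedSpace ℝ E'] [NormedSpace ℂ E']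
    {O' : Set E'} {φ : E' → E} (hF : SmoothFamily I O F) (hφ : ContDiff ℝ ∞ φ)
    (h : Set.MapsTo φ O' O) : SmoothFamily I O' fun t p => F t (φ p) :=
  ContDiffOn.comp hF (contDiff_fst.prodMk (hφ.comp contDiff_snd)).contDiffOn
    fun _ hq => ⟨hq.1, h hq.2⟩

theorem slice (hF : SmoothFamily I O F) {t : ℝ} (ht : t ∈ I) : ContDiffOn ℝ ∞ (F t) O :=
  ContDiffOn.comp (g := fun q : ℝ × E => F q.1 q.2) (f := fun p => (t, p)) hF
    (contDiff_const.prodMk contDiff_id).contDiffOn fun _ hp => ⟨ht, hp⟩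

theorem continuousOn (hF : SmoothFamily I O F) :
    ContinuousOn (fun q : ℝ × E => F q.1 q.2) (I ×ˢ O) := ContDiffOn.continuousOn hF

/-- The time set need not be open: the spatial derivative is the restriction to the second factor of
the derivative within `I ×ˢ O`. This lets the half-open interval `[0, τ)`, with its initial time, be
treated like the rest. -/
theorem hasFDerivAt (hF : SmoothFamily I O F) (hO : IsOpen O) {t : ℝ} (ht : t ∈ I)
    {p : E} (hp : p ∈ O) :
    HasFDerivAt (F t) ((fderivWithin ℝ (fun q : ℝ × E => F q.1 q.2) (I ×ˢ O) (t, p)).comp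
      (ContinuousLinearMap.inr ℝ ℝ E)) p := by
  have h1 : HasFDerivWithinAt (fun q : ℝ × E => F q.1 q.2)
      (fderivWithin ℝ (fun q : ℝ × E => F q.1 q.2) (I ×ˢ O) (t, p)) (I ×ˢ O) (t, p) :=
    (ContDiffOn.differentiableOn hF (by simp) (t, p) ⟨ht, hp⟩).hasFDerivWithinAt
  have h2 : HasFDerivWithinAt (fun q : E => (t, q)) (ContinuousLinearMap.inr ℝ ℝ E) O p :=
    (hasFDerivAt_prodMk_right t p).hasFDerivWithinAt
  exact (h1.comp p h2 fun q hq => ⟨ht, hq⟩).hasFDerivAt (hO.mem_nhds hp)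

theorem fderiv_dir (hF : SmoothFamily I O F) (hI : UniqueDiffOn ℝ I) (hO : IsOpen O) (X : E) :
    SmoothFamily I O fun t p => fderiv ℝ (F t) p X := by
  have h := (hF.fderivWithin (m := ∞) (hI.prod hO.uniqueDiffOn) (by simp)).clm_apply
    (contDiffOn_const (c := ((0 : ℝ), X)))
  refine h.congr fun q hq => ?_
  have := (hF.hasFDerivAt hO hq.1 hq.2).fderiv
  simp [this]

theorem wd (hF : SmoothFamily I O F) (hI : UniqueDiffOn ℝ I) (hO : IsOpen O) (X : E) :
    SmoothFamily I O fun t => wd X (F t) := by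
  unfold HermitianFlow.wd
  exact ((hF.fderiv_dir hI hO X).sub ((const _).mul (hF.fderiv_dir hI hO _))).div_const _

theorem wb (hF : SmoothFamily I O F) (hI : UniqueDiffOn ℝ I) (hO : IsOpen O) (X : E) :
    SmoothFamily I O fun t => wb X (F t) := by
  unfold HermitianFlow.wb
  exact ((hF.fderiv_dir hI hO X).add ((const _).mul (hF.fderiv_dir hI hO _))).div_const _

/-- Time derivatives commute with spatial derivatives. -/
theorem hasDerivAt_fderiv (hF : SmoothFamily I O F) (hI : IsOpen I) (hO : IsOpen O)
    (hG : ∀ t ∈ I, ∀ p ∈ O, HasDerivAt (fun s => F s p) (G t p) t) {t : ℝ} (ht : t ∈ I) {p : E}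
    (hp : p ∈ O) (X : E) :
    HasDerivAt (fun s => fderiv ℝ (F s) p X) (fderiv ℝ (G t) p X) t := by
  set F' : ℝ × E → ℂ := fun q => F q.1 q.2 with hF'
  have hdom_open : IsOpen (I ×ˢ O) := hI.prod hO
  have hd : ∀ q ∈ I ×ˢ O, DifferentiableAt ℝ F' q := fun q hq =>
    (ContDiffOn.contDiffAt hF (hdom_open.mem_nhds hq)).differentiableAt (by simp)
  have hsp : ∀ q ∈ I ×ˢ O, fderiv ℝ (F q.1) q.2 X = fderiv ℝ F' q (0, X) := by
    intro q hq
    have := ((hd q hq).hasFDerivAt.comp q.2 (hasFDerivAt_prodMk_right (𝕜 := ℝ) q.1 q.2)).fderiv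
    have h2 : fderiv ℝ (F q.1) q.2 =
      (fderiv ℝ F' q).comp (ContinuousLinearMap.inr ℝ ℝ E) := this
    simp [h2]
  have htm : ∀ q ∈ I ×ˢ O, G q.1 q.2 = fderiv ℝ F' q (1, 0) := by
    intro q hq
    have h1 := ((hd q hq).hasFDerivAt.comp q.1 (hasFDerivAt_prodMk_left q.1 q.2)).hasDerivAt
    have h2 : HasDerivAt (fun s => F s q.2) _ q.1 := h1
    rw [(hG q.1 hq.1 q.2 hq.2).unique h2]
    simp
  have hq : (t, p) ∈ I ×ˢ O := ⟨ht, hp⟩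
  have hs1 : ContDiffOn ℝ ∞ (fun q => fderiv ℝ F' q (0, X)) (I ×ˢ O) :=
    (ContDiffOn.fderiv_of_isOpen hF hdom_open (m := ∞) (by simp)).clm_apply contDiffOn_const
  have hs2 : ContDiffOn ℝ ∞ (fun q => fderiv ℝ F' q (1, 0)) (I ×ˢ O) :=
    (ContDiffOn.fderiv_of_isOpen hF hdom_open (m := ∞) (by simp)).clm_apply contDiffOn_const
  have hd1 : DifferentiableAt ℝ (fun q => fderiv ℝ F' q (0, X)) (t, p) :=
    (hs1.contDiffAt (hdom_open.mem_nhds hq)).differentiableAt (by simp)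
  have hd2 : DifferentiableAt ℝ (fun q => fderiv ℝ F' q (1, 0)) (t, p) :=
    (hs2.contDiffAt (hdom_open.mem_nhds hq)).differentiableAt (by simp)
  have hdd : DifferentiableAt ℝ (fderiv ℝ F') (t, p) :=
    ((ContDiffOn.fderiv_of_isOpen hF hdom_open (m := ∞) (by simp)).contDiffAt
      (hdom_open.mem_nhds hq)).differentiableAt (by simp)
  have e1 : fderiv ℝ (G t) p X = fderiv ℝ (fderiv ℝ F') (t, p) (0, X) (1, 0) := by
    have h1 : G t =ᶠ[nhds p] fun p' => fderiv ℝ F' (t, p') (1, 0) := by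
      filter_upwards [hO.mem_nhds hp] with p' hp' using htm (t, p') ⟨ht, hp'⟩
    rw [h1.fderiv_eq]
    have h2 := (hd2.hasFDerivAt.comp p (hasFDerivAt_prodMk_right t p)).fderiv
    have h3 : fderiv ℝ (fun p' => fderiv ℝ F' (t, p') (1, 0)) p = _ := h2
    rw [h3, fderiv_clm_apply hdd (differentiableAt_const _)]
    simp
  have e2 : fderiv ℝ (fun q => fderiv ℝ F' q (0, X)) (t, p) (1, 0) =
      fderiv ℝ (fderiv ℝ F') (t, p) (1, 0) (0, X) := by
    rw [fderiv_clm_apply hdd (differentiableAt_const _)]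
    simp
  have hsym : fderiv ℝ (fderiv ℝ F') (t, p) (0, X) (1, 0) =
      fderiv ℝ (fderiv ℝ F') (t, p) (1, 0) (0, X) :=
    ((ContDiffOn.contDiffAt hF (hdom_open.mem_nhds hq)).isSymmSndFDerivAt
      (by simpa using two_le_infty)) _ _
  rw [e1, hsym, ← e2]
  have h1 := (hd1.hasFDerivAt.comp t (hasFDerivAt_prodMk_left t p)).hasDerivAt
  have h2 : HasDerivAt (fun s => fderiv ℝ F' (s, p) (0, X)) _ t := h1
  refine (h2.congr_of_eventuallyEq ?_).congr_deriv (by simp)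
  filter_upwards [hI.mem_nhds ht] with s hs using hsp (s, p) ⟨hs, hp⟩

theorem hasDerivAt_wd (hF : SmoothFamily I O F) (hI : IsOpen I) (hO : IsOpen O)
    (hG : ∀ t ∈ I, ∀ p ∈ O, HasDerivAt (fun s => F s p) (G t p) t) {t : ℝ} (ht : t ∈ I) {p : E}
    (hp : p ∈ O) (X : E) :
    HasDerivAt (fun s => HermitianFlow.wd X (F s) p) (HermitianFlow.wd X (G t) p) t :=
  ((hF.hasDerivAt_fderiv hI hO hG ht hp X).sub
    ((hF.hasDerivAt_fderiv hI hO hG ht hp _).const_mul _)).div_const _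

theorem hasDerivAt_wb (hF : SmoothFamily I O F) (hI : IsOpen I) (hO : IsOpen O)
    (hG : ∀ t ∈ I, ∀ p ∈ O, HasDerivAt (fun s => F s p) (G t p) t) {t : ℝ} (ht : t ∈ I) {p : E}
    (hp : p ∈ O) (X : E) :
    HasDerivAt (fun s => HermitianFlow.wb X (F s) p) (HermitianFlow.wb X (G t) p) t :=
  ((hF.hasDerivAt_fderiv hI hO hG ht hp X).add
    ((hF.hasDerivAt_fderiv hI hO hG ht hp _).const_mul _)).div_const _

end SmoothFamily
end Family

/-! ### Linear algebra of the quadratic right-hand side -/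

section HessianAlgebra
variable {ι : Type*} [Fintype ι]

/-- The quadratic expression `∑ U_{P_a P̄_b} U_{X_a X̄_b} - U_{P_a X̄_b} U_{X_a P̄_b}` in a matrix `U` whose
rows and columns are indexed by two families `P_a` and `X_a`. -/
def hessQ (U : Matrix (ι ⊕ ι) (ι ⊕ ι) ℂ) : ℂ :=
  ∑ a, ∑ b, (U (.inl a) (.inl b) * U (.inr a) (.inr b) - U (.inl a) (.inr b) * U (.inr a) (.inl b))

/-- The Hermitian form of the matrix `U`. -/
def levi {κ : Type*} [Fintype κ] (U : Matrix κ κ ℂ) (X : κ → ℂ) : ℂ :=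
  ∑ c, ∑ d, U c d * X c * conj (X d)

/-- The vector dual to `w` under the symplectic pairing of the families `P_a` and `X_a`. -/
def rot (w : ι ⊕ ι → ℂ) : ι ⊕ ι → ℂ := Sum.elim (fun a => -w (.inr a)) (fun a => w (.inl a))

/-- The contraction `∑ U_{c d̄} θ̄_d`. -/
def col {κ : Type*} [Fintype κ] (U : Matrix κ κ ℂ) (θ : κ → ℂ) : κ → ℂ :=
  fun c => ∑ d, U c d * conj (θ d)

/-- The symplectic pairing. -/
def symp (v w : ι ⊕ ι → ℂ) : ℂ := ∑ a, (v (.inl a) * w (.inr a) - v (.inr a) * w (.inl a))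

theorem levi_sum_rankOne {κ : Type*} [Fintype κ] {m : ℕ} (W : Fin m → κ → ℂ) (X : κ → ℂ) :
    levi (fun c d => ∑ r, W r c * conj (W r d)) X =
      ∑ r, ((Complex.normSq (∑ c, X c * W r c) : ℝ) : ℂ) := by
  simp only [levi, Complex.normSq_eq_conj_mul_self, Finset.sum_mul, map_sum, Finset.mul_sum]
  rw [Finset.sum_congr rfl fun c _ => Finset.sum_comm, Finset.sum_comm]
  refine Finset.sum_congr rfl fun r _ => ?_
  refine Finset.sum_congr rfl fun c _ => Finset.sum_congr rfl fun d _ => ?_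
  simp only [map_mul]; ring

/-- Through this identity the Levi form of ∑ W_s W_s^* at a rotated vector `rot v` becomes ∑ |symp v
W_s|². -/
theorem symp_rot (v w : ι ⊕ ι → ℂ) : ∑ c, rot v c * w c = symp v w := by
  simp only [Fintype.sum_sum_type, rot, symp, Sum.elim_inl, Sum.elim_inr]
  rw [← Finset.sum_add_distrib]
  exact Finset.sum_congr rfl fun a _ => by ring

/-- With A_rs = ∑_a W_r(P_a) W_s(X_a), the left side is 2 ∑ (|A_rs|² − A_rs conj A_sr), and the
symplectic product is the antisymmetrization A_rs − A_sr. The factor 2 pays for a second copy of the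
sum with r and s exchanged, which completes the squares. -/
theorem hessQ_sum_rankOne {m : ℕ} (W : Fin m → ι ⊕ ι → ℂ) :
    2 * hessQ (fun c d => ∑ r, W r c * conj (W r d)) =
      ∑ r, ∑ s, ((Complex.normSq (symp (W r) (W s)) : ℝ) : ℂ) := by
  set A : Fin m → Fin m → ℂ := fun r s => ∑ a, W r (.inl a) * W s (.inr a) with hA
  have h1 : hessQ (fun c d => ∑ r, W r c * conj (W r d)) =
      ∑ r, ∑ s, (A r s * conj (A r s) - A r s * conj (A s r)) := by
    simp only [hessQ, hA, map_sum, Finset.sum_mul_sum, map_mul]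
    simp only [← Finset.sum_sub_distrib]
    have e : ∀ F : ι → ι → Fin m → Fin m → ℂ, ∑ a, ∑ b, ∑ r, ∑ s, F a b r s =
        ∑ r, ∑ s, ∑ a, ∑ b, F a b r s := by
      intro F
      rw [Finset.sum_congr rfl fun a _ => Finset.sum_comm, Finset.sum_comm]
      refine Finset.sum_congr rfl fun r _ => ?_
      rw [Finset.sum_congr rfl fun a _ => Finset.sum_comm, Finset.sum_comm]
    rw [e]
    refine Finset.sum_congr rfl fun r _ => Finset.sum_congr rfl fun s _ =>
      Finset.sum_congr rfl fun a _ => Finset.sum_congr rfl fun b _ => by ring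
  have h2 : ∀ r s, symp (W r) (W s) = A r s - A s r := by
    intro r s
    simp only [symp, hA, Finset.sum_sub_distrib]
    congr 1
    exact Finset.sum_congr rfl fun a _ => by ring
  rw [h1]
  simp only [h2, Complex.normSq_eq_conj_mul_self, map_sub]
  have h3 : ∑ r, ∑ s, (A r s * conj (A r s) - A r s * conj (A s r)) =
      ∑ r, ∑ s, (A s r * conj (A s r) - A s r * conj (A r s)) := Finset.sum_comm
  rw [two_mul]
  nth_rw 2 [h3]
  simp only [← Finset.sum_add_distrib]
  exact Finset.sum_congr rfl fun r _ => Finset.sum_congr rfl fun s _ => by ring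

theorem normSq_sum_mul_le {m : ℕ} (c β : Fin m → ℂ) :
    Complex.normSq (∑ r, c r * β r) ≤
      (∑ r, Complex.normSq (c r)) * ∑ r, Complex.normSq (β r) := by
  have h1 : ‖∑ r, c r * β r‖ ≤ ∑ r, ‖c r‖ * ‖β r‖ :=
    (norm_sum_le _ _).trans_eq (Finset.sum_congr rfl fun r _ => norm_mul _ _)
  have h2 := Finset.sum_mul_sq_le_sq_mul_sq Finset.univ (fun r => ‖c r‖) (fun r => ‖β r‖)
  simp only [Complex.normSq_eq_norm_sq]
  exact (pow_le_pow_left₀ (norm_nonneg _) h1 2).trans h2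

open scoped ComplexOrder in
-- The spectral decomposition of a positive semidefinite matrix. `levi` conjugates its second slot
-- and the usual quadratic form the first, so the two are matched at `star x`.
theorem exists_rankOne_decomposition {κ : Type*} [Fintype κ] {U : Matrix κ κ ℂ}
    (hU : U.IsHermitian) (h : ∀ X, 0 ≤ (levi U X).re) :
    ∃ (m : ℕ) (W : Fin m → κ → ℂ), U = fun c d => ∑ r, W r c * conj (W r d) := by
  have hp : U.PosSemidef := by
    refine Matrix.posSemidef_iff_dotProduct_mulVec.2 ⟨hU, fun x => ?_⟩
    have h1 : star x ⬝ᵥ U.mulVec x = levi U (star x) := by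
      simp only [dotProduct, Matrix.mulVec, levi, Finset.mul_sum]
      refine Finset.sum_congr rfl fun c _ => Finset.sum_congr rfl fun d _ => ?_
      simp only [Pi.star_apply, RCLike.star_def, Complex.conj_conj]; ring
    have h2 : conj (levi U (star x)) = levi U (star x) := by
      simp only [levi, map_sum, map_mul, Complex.conj_conj]
      rw [Finset.sum_comm]
      refine Finset.sum_congr rfl fun c _ => Finset.sum_congr rfl fun d _ => ?_
      rw [← hU.apply c d]
      simp only [RCLike.star_def]; ring
    rw [h1, Complex.le_def]
    exact ⟨h _, (Complex.conj_eq_iff_im.1 h2).symm⟩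
  obtain ⟨m, W, hW⟩ := Matrix.posSemidef_iff_eq_sum_vecMulVec.1 hp
  refine ⟨m, W, ?_⟩
  rw [hW]
  ext c d
  simp [Matrix.sum_apply, Matrix.vecMulVec_apply]

theorem hessQ_nonneg {U : Matrix (ι ⊕ ι) (ι ⊕ ι) ℂ} (hU : U.IsHermitian)
    (h : ∀ X, 0 ≤ (levi U X).re) : 0 ≤ (hessQ U).re := by
  obtain ⟨m, W, rfl⟩ := exists_rankOne_decomposition hU h
  have h2 := congrArg Complex.re (hessQ_sum_rankOne W)
  simp only [Complex.re_sum, Complex.ofReal_re, Complex.mul_re, Complex.re_ofNat,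
    Complex.im_ofNat, zero_mul, sub_zero] at h2
  have h3 : 0 ≤ ∑ r, ∑ s, Complex.normSq (symp (W r) (W s)) :=
    Finset.sum_nonneg fun _ _ => Finset.sum_nonneg fun _ _ => Complex.normSq_nonneg _
  linarith

/-- Write U = ∑ W_r W_r^*. Then `col U θ` is ∑_r conj(θ·W_r) W_r, so the left side is ∑_s |∑_r
conj(θ·W_r) symp(W_r, W_s)|². Cauchy–Schwarz in r separates ∑ |θ·W_r|², which is the Levi form at θ,
from ∑ |symp(W_r, W_s)|², which is twice `hessQ U`. This is the source of the strong maximum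
principle: the right-hand side of the evolution equation dominates the Hessian in a distinguished
direction. -/
theorem levi_rot_col_le {U : Matrix (ι ⊕ ι) (ι ⊕ ι) ℂ} (hU : U.IsHermitian)
    (h : ∀ X, 0 ≤ (levi U X).re) (θ : ι ⊕ ι → ℂ) :
    (levi U (rot (col U θ))).re ≤ (levi U θ).re * (2 * (hessQ U).re) := by
  obtain ⟨m, W, rfl⟩ := exists_rankOne_decomposition hU h
  have h2 := congrArg Complex.re (hessQ_sum_rankOne W)
  simp only [Complex.re_sum, Complex.ofReal_re, Complex.mul_re, Complex.re_ofNat,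
    Complex.im_ofNat, zero_mul, sub_zero] at h2
  rw [h2, levi_sum_rankOne, levi_sum_rankOne]
  simp only [Complex.re_sum, Complex.ofReal_re, symp_rot]
  have hcol : ∀ s, symp (col (fun c d => ∑ r, W r c * conj (W r d)) θ) (W s) =
      ∑ r, conj (∑ c, θ c * W r c) * symp (W r) (W s) := by
    intro s
    have e1 : ∀ c, col (fun c d => ∑ r, W r c * conj (W r d)) θ c =
        ∑ r, conj (∑ d, θ d * W r d) * W r c := by
      intro c
      simp only [col, Finset.sum_mul, map_sum, map_mul]
      rw [Finset.sum_comm]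
      exact Finset.sum_congr rfl fun r _ => Finset.sum_congr rfl fun d _ => by ring
    simp only [symp, e1, Finset.mul_sum, Finset.sum_mul _ _ (W s _)]
    simp only [← Finset.sum_sub_distrib]
    rw [Finset.sum_comm]
    exact Finset.sum_congr rfl fun r _ => Finset.sum_congr rfl fun a _ => by ring
  simp only [hcol]
  rw [Finset.sum_comm (f := fun r s => Complex.normSq (symp (W r) (W s))), Finset.mul_sum]
  refine Finset.sum_le_sum fun s _ => (normSq_sum_mul_le _ _).trans_eq ?_
  simp only [Complex.normSq_conj]

theorem levi_add_smul_one {κ : Type*} [Fintype κ] [DecidableEq κ] (U : Matrix κ κ ℂ) (c : ℂ)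
    (X : κ → ℂ) : levi (U + c • (1 : Matrix κ κ ℂ)) X =
      levi U X + c * ((∑ a, Complex.normSq (X a) : ℝ) : ℂ) := by
  simp only [levi, Matrix.add_apply, Matrix.smul_apply, smul_eq_mul, add_mul,
    Finset.sum_add_distrib, Complex.ofReal_sum, Complex.normSq_eq_conj_mul_self, Finset.mul_sum]
  congr 1
  refine Finset.sum_congr rfl fun a _ => ?_
  rw [Finset.sum_eq_single a]
  · simp; ring
  · intro b _ hb; simp [Matrix.one_apply_ne' hb]
  · simp

/-- Quantitative form of `hessQ_nonneg` and `levi_rot_col_le` for matrices that are almost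
positive semidefinite. -/
theorem exists_hessQ_bounds [DecidableEq ι] (U₀ : ι ⊕ ι → ι ⊕ ι → ℂ) (θ : ι ⊕ ι → ℂ) :
    ∃ K : ℝ, 0 ≤ K ∧ ∃ r > 0, ∀ᶠ U : ι ⊕ ι → ι ⊕ ι → ℂ in nhds U₀,
      Matrix.IsHermitian (Matrix.of U) → ∀ lam ∈ Set.Ico 0 r,
      (∀ X, -lam * ∑ a, Complex.normSq (X a) ≤ (levi U X).re) →
      0 ≤ (hessQ U).re + K * lam ∧
      (levi U (rot (col U θ))).re ≤ (levi U θ).re * (2 * (hessQ U).re) + K * lam := by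
  -- The shifted matrix U + lam · 1 is positive semidefinite, so the exact inequalities apply to it.
  -- All expressions are C¹ in (U, lam), so undoing the shift costs a local Lipschitz constant times
  -- `lam`.
  let Ψ : (ι ⊕ ι → ι ⊕ ι → ℂ) × ℝ → ι ⊕ ι → ι ⊕ ι → ℂ := fun q c d =>
    q.1 c d + (q.2 : ℂ) * (1 : Matrix (ι ⊕ ι) (ι ⊕ ι) ℂ) c d
  have hΨ : ∀ q : (ι ⊕ ι → ι ⊕ ι → ℂ) × ℝ,
      (Ψ q : Matrix _ _ ℂ) = Matrix.of q.1 + (q.2 : ℂ) • (1 : Matrix (ι ⊕ ι) (ι ⊕ ι) ℂ) := by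
    intro q; ext c d; simp [Ψ]
  have hc : ∀ c d, ContDiff ℝ 1 fun q => Ψ q c d := by
    intro c d
    refine ContDiff.add (by fun_prop) (ContDiff.mul ?_ contDiff_const)
    exact Complex.ofRealCLM.contDiff.comp contDiff_snd
  have hconj : ∀ {f : (ι ⊕ ι → ι ⊕ ι → ℂ) × ℝ → ℂ}, ContDiff ℝ 1 f →
      ContDiff ℝ 1 fun q => conj (f q) := fun hf => Complex.conjCLE.contDiff.comp hf
  have hre : ∀ {f : (ι ⊕ ι → ι ⊕ ι → ℂ) × ℝ → ℂ}, ContDiff ℝ 1 f →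
      ContDiff ℝ 1 fun q => (f q).re := fun hf => Complex.reCLM.contDiff.comp hf
  have hQ : ContDiff ℝ 1 fun q => (hessQ (Ψ q)).re := by
    refine hre ?_
    unfold hessQ
    exact ContDiff.sum fun a _ => ContDiff.sum fun b _ =>
      ((hc _ _).mul (hc _ _)).sub ((hc _ _).mul (hc _ _))
  have hcol : ∀ c, ContDiff ℝ 1 fun q => col (Ψ q) θ c := fun c =>
    ContDiff.sum fun d _ => (hc _ _).mul contDiff_const
  have hrot : ∀ c, ContDiff ℝ 1 fun q => rot (col (Ψ q) θ) c := by
    rintro (a | a)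
    · exact (hcol (.inr a)).neg
    · exact hcol (.inl a)
  have hR : ContDiff ℝ 1 fun q => (levi (Ψ q) θ).re * (2 * (hessQ (Ψ q)).re) -
      (levi (Ψ q) (rot (col (Ψ q) θ))).re := by
    refine ContDiff.sub (ContDiff.mul (hre ?_) (contDiff_const.mul hQ)) (hre ?_)
    · exact ContDiff.sum fun a _ => ContDiff.sum fun b _ =>
        ((hc _ _).mul contDiff_const).mul contDiff_const
    · exact ContDiff.sum fun a _ => ContDiff.sum fun b _ =>
        ((hc _ _).mul (hrot _)).mul (hconj (hrot _))
  obtain ⟨K₁, s₁, hs₁, hL₁⟩ := (hQ.contDiffAt (x := (U₀, (0 : ℝ)))).exists_lipschitzOnWith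
  obtain ⟨K₂, s₂, hs₂, hL₂⟩ := (hR.contDiffAt (x := (U₀, (0 : ℝ)))).exists_lipschitzOnWith
  obtain ⟨u, hu, v, hv, huv⟩ := mem_nhds_prod_iff.1 (Filter.inter_mem hs₁ hs₂)
  obtain ⟨r, hr, hrv⟩ := Metric.mem_nhds_iff.1 hv
  refine ⟨K₁ + K₂, by positivity, r, hr, ?_⟩
  filter_upwards [hu] with U hUu hU lam hlam hX
  have hm0 : (U, (0 : ℝ)) ∈ s₁ ∩ s₂ := huv ⟨hUu, hrv (Metric.mem_ball_self hr)⟩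
  have hm1 : (U, lam) ∈ s₁ ∩ s₂ := by
    refine huv ⟨hUu, hrv ?_⟩
    rw [Metric.mem_ball, Real.dist_eq, sub_zero, abs_of_nonneg hlam.1]
    exact hlam.2
  have hd : dist (U, lam) (U, (0 : ℝ)) = lam := by
    rw [dist_prod_same_left, Real.dist_eq, sub_zero, abs_of_nonneg hlam.1]
  have h0 : Ψ (U, 0) = U := by ext c d; simp [Ψ]
  have hH : (Matrix.of (Ψ (U, lam))).IsHermitian := by
    have : Matrix.of (Ψ (U, lam)) = Matrix.of U + (lam : ℂ) • (1 : Matrix (ι ⊕ ι) (ι ⊕ ι) ℂ) :=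
      hΨ (U, lam)
    rw [this]
    refine hU.add ?_
    rw [Matrix.IsHermitian, Matrix.conjTranspose_smul, Matrix.conjTranspose_one]
    simp
  have hpos : ∀ X, 0 ≤ (levi (Ψ (U, lam)) X).re := by
    intro X
    rw [hΨ (U, lam), levi_add_smul_one, Complex.add_re, Complex.re_ofReal_mul, Complex.ofReal_re]
    have := hX X
    have e : levi (Matrix.of U) X = levi U X := rfl
    rw [e]
    dsimp only
    linarith
  have b1 := hessQ_nonneg hH hpos
  have b2 := levi_rot_col_le hH hpos θ
  have l1 := hL₁.dist_le_mul _ hm1.1 _ hm0.1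
  have l2 := hL₂.dist_le_mul _ hm1.2 _ hm0.2
  rw [hd, Real.dist_eq, h0] at l1 l2
  have l1' := (abs_le.1 l1).2
  have l2' := (abs_le.1 l2).2
  have hK1 : 0 ≤ (K₁ : ℝ) * lam := mul_nonneg K₁.2 hlam.1
  have hK2 : 0 ≤ (K₂ : ℝ) * lam := mul_nonneg K₂.2 hlam.1
  have c1 : 0 ≤ (hessQ (Ψ (U, lam))).re := b1
  have c2 : (levi (Ψ (U, lam)) (rot (col (Ψ (U, lam)) θ))).re ≤
    (levi (Ψ (U, lam)) θ).re * (2 * (hessQ (Ψ (U, lam))).re) := b2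
  constructor <;> linarith

end HessianAlgebra

/-! ### Poisson flows and their Levi forms -/

section Flow
variable {V : Type*} [NormedAddCommGroup V] [NormedSpace ℝ V] [NormedSpace ℂ V]
  [IsScalarTower ℝ ℂ V]
variable {μ : Type*} [Fintype μ] {ι : Type*} [Fintype ι]

theorem wd_zero_dir (f : V → ℂ) : wd 0 f = fun _ => 0 := by ext; simp [wd]

theorem wb_zero_dir (f : V → ℂ) : wb 0 f = fun _ => 0 := by ext; simp [wb]

theorem wd_fun_zero (X : V) : wd X (fun _ : V => (0 : ℂ)) = fun _ => 0 := by ext; simp [wd]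

theorem wb_fun_zero (X : V) : wb X (fun _ : V => (0 : ℂ)) = fun _ => 0 := by ext; simp [wb]

/-- The complex Hessian of `f` in the directions of the vectors `P m` and `X m`. -/
def hessMat {κ : Type*} (Z : κ → V) (f : V → ℂ) (p : V) : Matrix κ κ ℂ :=
  fun c d => wd (Z c) (wb (Z d) f) p

/-- The family `F` evolves by `∂F/∂t = ∑ F_{P_m P̄_n} F_{X_m X̄_n} - F_{P_m X̄_n} F_{X_m P̄_n}`. -/
def IsPoissonFlow (I : Set ℝ) (O : Set V) (P X : μ → V) (F : ℝ → V → ℂ) : Prop :=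
  ∀ t ∈ I, ∀ p ∈ O, HasDerivAt (fun s => F s p) (hessQ (hessMat (Sum.elim P X) (F t) p)) t

theorem hessMat_isHermitian {κ : Type*} {O : Set V} {f : V → ℂ} (hf : ContDiffOn ℝ ∞ f O)
    (hO : IsOpen O) (hr : ∀ p ∈ O, conj (f p) = f p) (Z : κ → V) {p : V} (hp : p ∈ O) :
    (hessMat Z f p).IsHermitian := by
  ext c d
  have e : (fun q => conj (f q)) =ᶠ[nhds p] f := by
    filter_upwards [hO.mem_nhds hp] with q hq using hr q hq
  have e' : wd (Z c) (fun q => conj (f q)) =ᶠ[nhds p] wd (Z c) f := by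
    filter_upwards [e.eventuallyEq_nhds] with q hq using wd_congr hq _
  have h1 : conj (wd (Z d) (wb (Z c) f) p) = wb (Z d) (fun q => conj (wb (Z c) f q)) p :=
    conj_wd _ _ _
  simp only [conj_wb] at h1
  rw [Matrix.conjTranspose_apply, RCLike.star_def]
  simp only [hessMat]
  rw [h1, wd_wb_comm hf hO hp]
  exact wb_congr e' _

theorem wd_wb_sum_dir {κ : Type*} [Fintype κ] {O : Set V} {f : V → ℂ} (hf : ContDiffOn ℝ ∞ f O)
    (hO : IsOpen O) {p : V} (hp : p ∈ O) (Z : κ → V) (a b : κ → ℂ) :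
    wd (∑ c, a c • Z c) (wb (∑ d, b d • Z d) f) p =
      ∑ c, ∑ d, a c * conj (b d) * hessMat Z f p c d := by
  have e : wb (∑ d, b d • Z d) f = fun q => ∑ d, conj (b d) * wb (Z d) f q := by
    ext q; exact wb_sum_dir _ _ _ _ _
  have hd : ∀ d, DifferentiableAt ℝ (wb (Z d) f) p := fun d =>
    differentiableAt_of_smoothOn (smoothOn_wb hf hO _) hO hp
  rw [e, wd_sum_dir, Finset.sum_congr rfl fun c _ => by
    rw [wd_sum _ (fun d _ => (hd d).const_mul _)]]
  refine Finset.sum_congr rfl fun c _ => ?_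
  rw [Finset.mul_sum]
  refine Finset.sum_congr rfl fun d _ => ?_
  rw [wd_mul (differentiableAt_const _) (hd d), wd_const]
  simp only [hessMat]; ring

theorem levi_hessMat {κ : Type*} [Fintype κ] {O : Set V} {f : V → ℂ} (hf : ContDiffOn ℝ ∞ f O)
    (hO : IsOpen O) {p : V} (hp : p ∈ O) (Z : κ → V) (X : κ → ℂ) :
    levi (hessMat Z f p) X = wd (∑ c, X c • Z c) (wb (∑ c, X c • Z c) f) p := by
  rw [wd_wb_sum_dir hf hO hp]
  simp only [levi]
  exact Finset.sum_congr rfl fun c _ => Finset.sum_congr rfl fun d _ => by ring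

section Sesquilinear
variable {V₁ V₂ : Type*} [NormedAddCommGroup V₁] [NormedSpace ℝ V₁] [NormedSpace ℂ V₁]
  [IsScalarTower ℝ ℂ V₁] [NormedAddCommGroup V₂] [NormedSpace ℝ V₂] [NormedSpace ℂ V₂]
  [IsScalarTower ℝ ℂ V₂]

/-- The function `(p, v) ↦ ∑ Φ_{a b}(p) v_a v̄_b`. -/
def sesq (ε : ι → V₂ →L[ℂ] ℂ) (Φ : ι → ι → V₁ → ℂ) (q : V₁ × V₂) : ℂ :=
  ∑ a, ∑ b, ε a q.2 * conj (ε b q.2) * Φ a b q.1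

variable {ε : ι → V₂ →L[ℂ] ℂ}

theorem smoothFamily_sesq {I : Set ℝ} {O : Set V₁} {Φ : ℝ → ι → ι → V₁ → ℂ}
    (hΦ : ∀ a b, SmoothFamily I O fun t => Φ t a b) :
    SmoothFamily I (O ×ˢ (Set.univ : Set V₂)) fun t => sesq ε (Φ t) := by
  have hε : ∀ a, ContDiff ℝ ∞ fun q : V₁ × V₂ => ε a q.2 := fun a =>
    ((ε a).restrictScalars ℝ).contDiff.comp contDiff_snd
  refine SmoothFamily.sum fun a _ => SmoothFamily.sum fun b _ => ?_
  exact ((SmoothFamily.of_contDiff (hε a)).mul (SmoothFamily.of_contDiff (hε b)).star).mul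
    ((hΦ a b).comp (O' := O ×ˢ (Set.univ : Set V₂)) contDiff_fst fun q hq => hq.1)

theorem differentiableAt_comp_snd (a : ι) (q : V₁ × V₂) :
    DifferentiableAt ℝ (fun q : V₁ × V₂ => ε a q.2) q :=
  (((ε a).restrictScalars ℝ).contDiff.comp contDiff_snd).differentiable
    (by simp : (∞ : WithTop ℕ∞) ≠ 0) _

theorem differentiableAt_conj_comp_snd (a : ι) (q : V₁ × V₂) :
    DifferentiableAt ℝ (fun q : V₁ × V₂ => conj (ε a q.2)) q :=
  Complex.conjCLE.differentiableAt.comp _ (differentiableAt_comp_snd a q)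

variable {O : Set V₁} {Φ : ι → ι → V₁ → ℂ}

theorem wb_sesq (hΦ : ∀ a b, ContDiffOn ℝ ∞ (Φ a b) O) (hO : IsOpen O) {p : V₁} (hp : p ∈ O)
    (v Y : V₂) (X : V₁) :
    wb (X, Y) (sesq ε Φ) (p, v) = ∑ a, ∑ b, (ε a v * conj (ε b Y) * Φ a b p +
        ε a v * conj (ε b v) * wb X (Φ a b) p) := by
  have hε := fun a => differentiableAt_comp_snd (ε := ε) a (p, v)
  have hεc := fun a => differentiableAt_conj_comp_snd (ε := ε) a (p, v)
  have hab : ∀ a b, DifferentiableAt ℝ (Φ a b) p := fun a b =>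
    differentiableAt_of_smoothOn (hΦ a b) hO hp
  have hab' : ∀ a b, DifferentiableAt ℝ (fun q : V₁ × V₂ => Φ a b q.1) (p, v) :=
    fun a b => DifferentiableAt.comp (g := Φ a b) (f := Prod.fst) (p, v) (hab a b)
      differentiableAt_fst
  have h3 : ∀ a b, DifferentiableAt ℝ (fun q : V₁ × V₂ => ε a q.2 * conj (ε b q.2)) (p, v) :=
    fun a b => (hε a).mul (hεc b)
  have h1 : ∀ a, wb (X, Y) (fun q : V₁ × V₂ => ε a q.2) (p, v) = 0 := fun a =>
    wb_clm ((ε a).comp (ContinuousLinearMap.snd ℂ V₁ V₂)) _ _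
  have h2 : ∀ b, wb (X, Y) (fun q : V₁ × V₂ => conj (ε b q.2)) (p, v) = conj (ε b Y) := fun b => by
    rw [← conj_wd]
    exact congrArg conj (wd_clm ((ε b).comp (ContinuousLinearMap.snd ℂ V₁ V₂)) (X, Y) (p, v))
  have h4 : ∀ a b, wb (X, Y) (fun q : V₁ × V₂ => Φ a b q.1) (p, v) = wb X (Φ a b) p := fun a b =>
    wb_comp (φ := Prod.fst) (p := (p, v)) (hab a b)
      (ContinuousLinearMap.fst ℂ V₁ V₂).hasFDerivAt (X, Y)
  unfold sesq
  rw [wb_sum _ fun a _ => DifferentiableAt.fun_sum fun b _ => (h3 a b).fun_mul (hab' a b)]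
  refine Finset.sum_congr rfl fun a _ => ?_
  rw [wb_sum _ fun b _ => (h3 a b).fun_mul (hab' a b)]
  refine Finset.sum_congr rfl fun b _ => ?_
  rw [wb_mul (h3 a b) (hab' a b), wb_mul (hε a) (hεc b), h1, h2, h4]
  ring

theorem wd_wb_sesq (hΦ : ∀ a b, ContDiffOn ℝ ∞ (Φ a b) O) (hO : IsOpen O) {p : V₁} (hp : p ∈ O)
    (v Y Y' : V₂) (X X' : V₁) :
    wd (X', Y') (wb (X, Y) (sesq ε Φ)) (p, v) =
      ∑ a, ∑ b, (ε a Y' * conj (ε b Y) * Φ a b p + ε a v * conj (ε b Y) * wd X' (Φ a b) p +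
        ε a Y' * conj (ε b v) * wb X (Φ a b) p +
        ε a v * conj (ε b v) * wd X' (wb X (Φ a b)) p) := by
  have hε := fun a => differentiableAt_comp_snd (ε := ε) a (p, v)
  have hεc := fun a => differentiableAt_conj_comp_snd (ε := ε) a (p, v)
  have hab : ∀ a b, DifferentiableAt ℝ (Φ a b) p := fun a b =>
    differentiableAt_of_smoothOn (hΦ a b) hO hp
  have hxab : ∀ a b, DifferentiableAt ℝ (wb X (Φ a b)) p := fun a b =>
    differentiableAt_of_smoothOn (smoothOn_wb (hΦ a b) hO _) hO hp
  have hab' : ∀ a b, DifferentiableAt ℝ (fun q : V₁ × V₂ => Φ a b q.1) (p, v) :=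
    fun a b => DifferentiableAt.comp (g := Φ a b) (f := Prod.fst) (p, v) (hab a b)
      differentiableAt_fst
  have hxab' : ∀ a b, DifferentiableAt ℝ (fun q : V₁ × V₂ => wb X (Φ a b) q.1) (p, v) :=
    fun a b => DifferentiableAt.comp (g := wb X (Φ a b)) (f := Prod.fst) (p, v) (hxab a b)
      differentiableAt_fst
  have h1 : ∀ a, wd (X', Y') (fun q : V₁ × V₂ => ε a q.2) (p, v) = ε a Y' := fun a =>
    wd_clm ((ε a).comp (ContinuousLinearMap.snd ℂ V₁ V₂)) _ _
  have h2 : ∀ b, wd (X', Y') (fun q : V₁ × V₂ => conj (ε b q.2)) (p, v) = 0 := fun b => by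
    rw [← conj_wb]
    have := congrArg conj (wb_clm ((ε b).comp (ContinuousLinearMap.snd ℂ V₁ V₂)) (X', Y') (p, v))
    simpa using this
  have h4 : ∀ a b, wd (X', Y') (fun q : V₁ × V₂ => Φ a b q.1) (p, v) = wd X' (Φ a b) p :=
    fun a b => wd_comp (φ := Prod.fst) (p := (p, v)) (hab a b)
      (ContinuousLinearMap.fst ℂ V₁ V₂).hasFDerivAt (X', Y')
  have h5 : ∀ a b, wd (X', Y') (fun q : V₁ × V₂ => wb X (Φ a b) q.1) (p, v) =
      wd X' (wb X (Φ a b)) p := fun a b =>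
    wd_comp (φ := Prod.fst) (p := (p, v)) (hxab a b)
      (ContinuousLinearMap.fst ℂ V₁ V₂).hasFDerivAt (X', Y')
  have e0 : wb (X, Y) (sesq ε Φ) =ᶠ[nhds (p, v)] fun q =>
      ∑ a, ∑ b, (ε a q.2 * conj (ε b Y) * Φ a b q.1 +
        ε a q.2 * conj (ε b q.2) * wb X (Φ a b) q.1) := by
    filter_upwards [(hO.prod isOpen_univ).mem_nhds (⟨hp, trivial⟩ : (p, v) ∈ O ×ˢ Set.univ)]
      with q hq using wb_sesq hΦ hO hq.1 q.2 Y X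
  have hd1 : ∀ a b, DifferentiableAt ℝ
      (fun q : V₁ × V₂ => ε a q.2 * conj (ε b Y) * Φ a b q.1) (p, v) :=
    fun a b => ((hε a).mul_const _).mul (hab' a b)
  have hd2 : ∀ a b, DifferentiableAt ℝ
      (fun q : V₁ × V₂ => ε a q.2 * conj (ε b q.2) * wb X (Φ a b) q.1) (p, v) :=
    fun a b => ((hε a).mul (hεc b)).mul (hxab' a b)
  rw [wd_congr e0,
    wd_sum _ fun a _ => DifferentiableAt.fun_sum fun b _ => (hd1 a b).fun_add (hd2 a b)]
  refine Finset.sum_congr rfl fun a _ => ?_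
  rw [wd_sum _ fun b _ => (hd1 a b).fun_add (hd2 a b)]
  refine Finset.sum_congr rfl fun b _ => ?_
  rw [wd_add (hd1 a b) (hd2 a b), wd_mul ((hε a).mul_const _) (hab' a b),
    wd_mul (hε a) (differentiableAt_const _), wd_const,
    wd_mul ((hε a).fun_mul (hεc b)) (hxab' a b), wd_mul (hε a) (hεc b), h1, h2, h4, h5]
  ring

end Sesquilinear

variable (ε : ι → V →L[ℂ] ℂ) (E : ι → V)

/-- The function `(p, v) ↦ ∂_v ∂̄_v f (p)`, in terms of a basis `E` with dual basis `ε`. -/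
def levLift (f : V → ℂ) : V × V → ℂ := sesq ε fun a b => wd (E a) (wb (E b) f)

variable {ε E}

theorem wd_wb_basis (hE : ∀ v, v = ∑ a, ε a v • E a) {O : Set V} {f : V → ℂ}
    (hf : ContDiffOn ℝ ∞ f O) (hO : IsOpen O) {p : V} (hp : p ∈ O) (v w : V) :
    wd v (wb w f) p = ∑ a, ∑ b, ε a v * conj (ε b w) * wd (E a) (wb (E b) f) p := by
  conv_lhs => rw [hE v, hE w]
  exact wd_wb_sum_dir hf hO hp E _ _

theorem levLift_eq (hE : ∀ v, v = ∑ a, ε a v • E a) {O : Set V} {f : V → ℂ}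
    (hf : ContDiffOn ℝ ∞ f O) (hO : IsOpen O) {p : V} (hp : p ∈ O) (v : V) :
    levLift ε E f (p, v) = wd v (wb v f) p := (wd_wb_basis hE hf hO hp v v).symm

theorem smoothFamily_levLift {I : Set ℝ} {O : Set V} {F : ℝ → V → ℂ} (hF : SmoothFamily I O F)
    (hI : UniqueDiffOn ℝ I) (hO : IsOpen O) :
    SmoothFamily I (O ×ˢ (Set.univ : Set V)) fun t => levLift ε E (F t) :=
  smoothFamily_sesq fun a b => (hF.wb hI hO (E b)).wd hI hO (E a)

section
variable {O : Set V} {f : V → ℂ}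

/-- The complex Hessian of `(p, v) ↦ ∂_v ∂̄_v f (p)`. -/
theorem wd_wb_levLift (hE : ∀ v, v = ∑ a, ε a v • E a) (hf : ContDiffOn ℝ ∞ f O) (hO : IsOpen O)
    {p : V} (hp : p ∈ O) (v X Y X' Y' : V) :
    wd (X', Y') (wb (X, Y) (levLift ε E f)) (p, v) =
      wd Y' (wb Y f) p + wd v (wb Y (wd X' f)) p + wd Y' (wb v (wb X f)) p +
        wd v (wb v (wd X' (wb X f))) p := by
  have hsm : ∀ a b, ContDiffOn ℝ ∞ (wd (E a) (wb (E b) f)) O := fun a b =>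
    smoothOn_wd (smoothOn_wb hf hO _) hO _
  have c1 : ∀ g : V → ℂ, ContDiffOn ℝ ∞ g O → ∀ a b,
      wd X' (wd (E a) (wb (E b) g)) p = wd (E a) (wb (E b) (wd X' g)) p := by
    intro g hg a b
    rw [wd_wd_comm (smoothOn_wb hg hO _) hO hp]
    refine wd_congr ?_ _
    filter_upwards [hO.mem_nhds hp] with r hr using wd_wb_comm hg hO hr _ _
  have c2 : ∀ a b, ∀ q ∈ O, wb X (wd (E a) (wb (E b) f)) q = wd (E a) (wb (E b) (wb X f)) q := by
    intro a b q hq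
    rw [← wd_wb_comm (smoothOn_wb hf hO _) hO hq]
    refine wd_congr ?_ _
    filter_upwards [hO.mem_nhds hq] with r hr using wb_wb_comm hf hO hr _ _
  have c3 : ∀ a b, wb X (wd (E a) (wb (E b) f)) =ᶠ[nhds p] wd (E a) (wb (E b) (wb X f)) := by
    intro a b
    filter_upwards [hO.mem_nhds hp] with q hq using c2 a b q hq
  unfold levLift
  rw [wd_wb_sesq hsm hO hp, wd_wb_basis hE hf hO hp Y' Y,
    wd_wb_basis hE (smoothOn_wd hf hO X') hO hp v Y,
    wd_wb_basis hE (smoothOn_wb hf hO X) hO hp Y' v,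
    wd_wb_basis hE (smoothOn_wd (smoothOn_wb hf hO X) hO X') hO hp v v]
  simp only [← Finset.sum_add_distrib]
  refine Finset.sum_congr rfl fun a _ => Finset.sum_congr rfl fun b _ => ?_
  rw [wd_congr (c3 a b), c1 f hf, c1 _ (smoothOn_wb hf hO _), c2 a b p hp]

theorem wd_wb_mul {g h : V → ℂ} (hg : ContDiffOn ℝ ∞ g O) (hh : ContDiffOn ℝ ∞ h O)
    (hO : IsOpen O) {p : V} (hp : p ∈ O) (v w : V) :
    wd v (wb w (fun q => g q * h q)) p = wd v (wb w g) p * h p + wb w g p * wd v h p +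
      wd v g p * wb w h p + g p * wd v (wb w h) p := by
  have e : wb w (fun q => g q * h q) =ᶠ[nhds p] fun q => wb w g q * h q + g q * wb w h q := by
    filter_upwards [hO.mem_nhds hp] with q hq
    exact wb_mul (differentiableAt_of_smoothOn hg hO hq) (differentiableAt_of_smoothOn hh hO hq) w
  have d1 := differentiableAt_of_smoothOn hg hO hp
  have d2 := differentiableAt_of_smoothOn hh hO hp
  have d3 := differentiableAt_of_smoothOn (smoothOn_wb hg hO w) hO hp
  have d4 := differentiableAt_of_smoothOn (smoothOn_wb hh hO w) hO hp
  rw [wd_congr e, wd_add (d3.fun_mul d2) (d1.fun_mul d4), wd_mul d3 d2, wd_mul d1 d4]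
  ring

theorem wd_wb_sum {κ : Type*} (s : Finset κ) {g : κ → V → ℂ}
    (hg : ∀ i ∈ s, ContDiffOn ℝ ∞ (g i) O) (hO : IsOpen O) {p : V} (hp : p ∈ O) (v w : V) :
    wd v (wb w (fun q => ∑ i ∈ s, g i q)) p = ∑ i ∈ s, wd v (wb w (g i)) p := by
  have e : wb w (fun q => ∑ i ∈ s, g i q) =ᶠ[nhds p] fun q => ∑ i ∈ s, wb w (g i) q := by
    filter_upwards [hO.mem_nhds hp] with q hq
    exact wb_sum s (fun i hi => differentiableAt_of_smoothOn (hg i hi) hO hq) w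
  rw [wd_congr e, wd_sum s fun i hi =>
    differentiableAt_of_smoothOn (smoothOn_wb (hg i hi) hO w) hO hp]

theorem wd_wb_sub {g h : V → ℂ} (hg : ContDiffOn ℝ ∞ g O) (hh : ContDiffOn ℝ ∞ h O)
    (hO : IsOpen O) {p : V} (hp : p ∈ O) (v w : V) :
    wd v (wb w (fun q => g q - h q)) p = wd v (wb w g) p - wd v (wb w h) p := by
  have e : wb w (fun q => g q - h q) =ᶠ[nhds p] fun q => wb w g q - wb w h q := by
    filter_upwards [hO.mem_nhds hp] with q hq
    exact wb_sub (differentiableAt_of_smoothOn hg hO hq) (differentiableAt_of_smoothOn hh hO hq) w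
  rw [wd_congr e, wd_sub (differentiableAt_of_smoothOn (smoothOn_wb hg hO w) hO hp)
    (differentiableAt_of_smoothOn (smoothOn_wb hh hO w) hO hp)]

end

/-- The Levi form of a Poisson flow is a Poisson flow on the tangent bundle. -/
theorem IsPoissonFlow.levLift (hE : ∀ v, v = ∑ a, ε a v • E a) {I : Set ℝ} {O : Set V}
    {F : ℝ → V → ℂ} (hF : SmoothFamily I O F) (hI : IsOpen I) (hO : IsOpen O) {P X : μ → V}
    (h : IsPoissonFlow I O P X F) :
    IsPoissonFlow I (O ×ˢ (Set.univ : Set V))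
      (Sum.elim (fun m => ((0 : V), P m)) fun m => (P m, (0 : V)))
      (Sum.elim (fun m => (X m, (0 : V))) fun m => ((0 : V), X m))
      fun t => levLift ε E (F t) := by
  rintro t ht ⟨p, v⟩ ⟨hp, -⟩
  have hf := hF.slice ht
  have hF' := hF.wb hI.uniqueDiffOn hO v
  have hder := hF'.hasDerivAt_wd hI hO (fun s hs q hq => hF.hasDerivAt_wb hI hO h hs hq v) ht hp v
  have e1 : (fun s => HermitianFlow.levLift ε E (F s) (p, v)) =ᶠ[nhds t]
      fun s => wd v (wb v (F s)) p := by
    filter_upwards [hI.mem_nhds ht] with s hs using levLift_eq hE (hF.slice hs) hO hp v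
  refine (hder.congr_of_eventuallyEq e1).congr_deriv ?_
  have hs2 : ∀ Y Z : V, ContDiffOn ℝ ∞ (wd Y (wb Z (F t))) O := fun Y Z =>
    smoothOn_wd (smoothOn_wb hf hO _) hO _
  have hcomm1 : ∀ Y Z : V, wb v (wd Y (wb Z (F t))) p = wd Y (wb v (wb Z (F t))) p := fun Y Z =>
    (wd_wb_comm (smoothOn_wb hf hO _) hO hp _ _).symm
  have hcomm2 : ∀ Y Z : V, wd v (wd Y (wb Z (F t))) p = wd v (wb Z (wd Y (F t))) p := by
    intro Y Z
    refine wd_congr ?_ _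
    filter_upwards [hO.mem_nhds hp] with r hr using wd_wb_comm hf hO hr _ _
  have hL : ∀ Y Z Y' Z' : V, wd (Y', Z') (wb (Y, Z) (HermitianFlow.levLift ε E (F t))) (p, v) = _ :=
    fun Y Z Y' Z' => wd_wb_levLift hE hf hO hp v Y Z Y' Z'
  -- For fixed m and n, each of the two products in the equation has four Leibniz terms under ∂_v
  -- ∂̄_v. These eight terms are the ones contributed by the four index blocks of the doubled
  -- expression, two from each.
  simp only [hessQ, hessMat, Fintype.sum_sum_type, Sum.elim_inl, Sum.elim_inr]
  rw [wd_wb_sum _ (fun m _ => ContDiffOn.sum fun n _ =>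
    ((hs2 _ _).mul (hs2 _ _)).sub ((hs2 _ _).mul (hs2 _ _))) hO hp]
  have hcross : ∀ m n, wd v (wb v fun q => wd (P m) (wb (P n) (F t)) q * wd (X m) (wb (X n) (F t)) q -
      wd (P m) (wb (X n) (F t)) q * wd (X m) (wb (P n) (F t)) q) p = _ := fun m n =>
    (wd_wb_sub ((hs2 _ _).mul (hs2 _ _)) ((hs2 _ _).mul (hs2 _ _)) hO hp v v).trans
      (congrArg₂ (· - ·) (wd_wb_mul (hs2 _ _) (hs2 _ _) hO hp v v)
        (wd_wb_mul (hs2 _ _) (hs2 _ _) hO hp v v))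
  rw [Finset.sum_congr rfl fun m _ => (wd_wb_sum _ (fun n _ =>
    ((hs2 _ _).mul (hs2 _ _)).sub ((hs2 _ _).mul (hs2 _ _))) hO hp v v).trans
      (Finset.sum_congr rfl fun n _ => hcross m n)]
  simp only [hL, wd_zero_dir, wb_zero_dir, wd_fun_zero, wb_fun_zero, hcomm1, hcomm2]
  simp only [← Finset.sum_add_distrib]
  refine Finset.sum_congr rfl fun m _ => Finset.sum_congr rfl fun n _ => ?_
  ring

end Flow

/-! ### Second derivative tests and touching functions -/

/-- The second derivative test: the second derivative at a local minimum is nonnegative. -/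
theorem deriv_deriv_nonneg_of_isLocalMin {φ : ℝ → ℝ} {a : ℝ} (h : IsLocalMin φ a)
    (hc : ContinuousAt φ a) : 0 ≤ deriv (deriv φ) a := by
  by_contra! hneg
  -- A negative second derivative would make the point a local maximum as well, so the function
  -- would be locally constant.
  have hmax := isLocalMax_of_deriv_deriv_neg hneg h.deriv_eq_zero hc
  have hconst : φ =ᶠ[nhds a] fun _ => φ a := by
    filter_upwards [h, hmax] with s h1 h2 using le_antisymm h2 h1
  have h1 : deriv φ =ᶠ[nhds a] deriv fun _ => φ a := hconst.deriv
  rw [h1.deriv_eq] at hneg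
  simp at hneg

section
variable {W : Type*} [NormedAddCommGroup W] [NormedSpace ℝ W]

theorem hasDerivAt_line (p Y : W) (s : ℝ) : HasDerivAt (fun s : ℝ => p + s • Y) Y s := by
  have h := ((hasDerivAt_id s).smul_const Y).const_add p
  rw [one_smul] at h
  exact h

theorem deriv_deriv_line {g : W → ℝ} {p : W} (hg : ContDiffAt ℝ 2 g p) (Y : W) :
    deriv (deriv fun s : ℝ => g (p + s • Y)) 0 = fderiv ℝ (fderiv ℝ g) p Y Y := by
  have hev : ∀ᶠ q in nhds p, DifferentiableAt ℝ g q := by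
    filter_upwards [hg.eventually (by simp)] with q hq using hq.differentiableAt (by simp)
  have h0 : p + (0 : ℝ) • Y = p := by rw [zero_smul, add_zero]
  have hcont : Filter.Tendsto (fun s : ℝ => p + s • Y) (nhds 0) (nhds p) := by
    have := (hasDerivAt_line p Y 0).continuousAt.tendsto
    rwa [h0] at this
  have h1 : deriv (fun s : ℝ => g (p + s • Y)) =ᶠ[nhds 0]
      fun s : ℝ => fderiv ℝ g (p + s • Y) Y := by
    filter_upwards [hcont.eventually hev] with s hs
    exact (HasFDerivAt.comp_hasDerivAt (l := g) s hs.hasFDerivAt (hasDerivAt_line p Y s)).deriv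
  rw [h1.deriv_eq]
  have hd : DifferentiableAt ℝ (fderiv ℝ g) p :=
    (hg.fderiv_right (m := 1) (by norm_num)).differentiableAt (by simp)
  have hd' : HasFDerivAt (fun q => fderiv ℝ g q Y)
      ((fderiv ℝ (fderiv ℝ g) p).flip Y) (p + (0 : ℝ) • Y) := by
    rw [h0]
    have := hd.hasFDerivAt.clm_apply (hasFDerivAt_const Y p)
    refine this.congr_fderiv ?_
    ext; simp
  have h3 := HasFDerivAt.comp_hasDerivAt (l := fun q => fderiv ℝ g q Y) (0 : ℝ) hd'
    (hasDerivAt_line p Y 0)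
  exact h3.deriv.trans (ContinuousLinearMap.flip_apply _ _ _)

theorem fderiv_fderiv_nonneg_of_isLocalMin {g : W → ℝ} {p : W} (h : IsLocalMin g p)
    (hg : ContDiffAt ℝ 2 g p) (Y : W) : 0 ≤ fderiv ℝ (fderiv ℝ g) p Y Y := by
  rw [← deriv_deriv_line hg Y]
  have h0 : p + (0 : ℝ) • Y = p := by rw [zero_smul, add_zero]
  have hcl : ContinuousAt (fun s : ℝ => p + s • Y) 0 := (hasDerivAt_line p Y 0).continuousAt
  refine deriv_deriv_nonneg_of_isLocalMin ?_ ?_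
  · refine IsLocalMin.comp_continuous (f := g) (g := fun s : ℝ => p + s • Y) (b := 0) ?_ hcl
    rw [h0]; exact h
  · refine ContinuousAt.comp (g := g) (f := fun s : ℝ => p + s • Y) ?_ hcl
    rw [h0]; exact hg.continuousAt

theorem fderiv_fderiv_sub {f g : W → ℝ} {p : W} (hf : ContDiffAt ℝ 2 f p)
    (hg : ContDiffAt ℝ 2 g p) (Y : W) :
    fderiv ℝ (fderiv ℝ fun q => f q - g q) p Y Y =
      fderiv ℝ (fderiv ℝ f) p Y Y - fderiv ℝ (fderiv ℝ g) p Y Y := by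
  have h1 : ∀ᶠ q in nhds p, fderiv ℝ (fun q => f q - g q) q = fderiv ℝ f q - fderiv ℝ g q := by
    filter_upwards [hf.eventually (by simp), hg.eventually (by simp)] with q h1 h2
    exact fderiv_fun_sub (h1.differentiableAt (by simp)) (h2.differentiableAt (by simp))
  have hd : ∀ {k : W → ℝ}, ContDiffAt ℝ 2 k p → DifferentiableAt ℝ (fderiv ℝ k) p := fun hk =>
    (hk.fderiv_right (m := 1) (by norm_num)).differentiableAt (by simp)
  rw [Filter.EventuallyEq.fderiv_eq h1, fderiv_fun_sub (hd hf) (hd hg)]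
  simp

theorem fderiv_fderiv_comp_clm {W' : Type*} [NormedAddCommGroup W'] [NormedSpace ℝ W']
    {f : W' → ℝ} (π : W →L[ℝ] W') {p : W} (hf : ContDiffAt ℝ 2 f (π p)) (Y : W) :
    fderiv ℝ (fderiv ℝ fun q => f (π q)) p Y Y = fderiv ℝ (fderiv ℝ f) (π p) (π Y) (π Y) := by
  rw [← deriv_deriv_line (g := fun q => f (π q)) (hf.comp p π.contDiff.contDiffAt) Y,
    ← deriv_deriv_line hf (π Y)]
  simp
end

section Touch
variable {V : Type*} [NormedAddCommGroup V] [NormedSpace ℝ V] [NormedSpace ℂ V]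
  [IsScalarTower ℝ ℂ V] {O : Set V}

/-- The real part of the Levi form in terms of the real Hessian. -/
theorem re_wd_wb_self {f : V → ℂ} (hf : ContDiffOn ℝ ∞ f O) (hO : IsOpen O) {p : V} (hp : p ∈ O)
    (Y : V) : (wd Y (wb Y f) p).re = (fderiv ℝ (fderiv ℝ fun q => (f q).re) p Y Y +
      fderiv ℝ (fderiv ℝ fun q => (f q).re) p (Complex.I • Y) (Complex.I • Y)) / 4 := by
  have h1 : ∀ Z, fderiv ℝ (fderiv ℝ fun q => (f q).re) p Z Z =
      (fderiv ℝ (fderiv ℝ f) p Z Z).re := by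
    intro Z
    have hre : ContDiffOn ℝ ∞ (fun q => (f q).re) O := Complex.reCLM.contDiff.comp_contDiffOn hf
    rw [← fderiv_fderiv_apply hre hO hp, ← fderiv_fderiv_apply hf hO hp]
    have e : (fun q => fderiv ℝ (fun q => (f q).re) q Z) =ᶠ[nhds p]
        fun q => (fderiv ℝ f q Z).re := by
      filter_upwards [hO.mem_nhds hp] with q hq
      have := (Complex.reCLM.hasFDerivAt.comp q
        (differentiableAt_of_smoothOn hf hO hq).hasFDerivAt).fderiv
      have h' : fderiv ℝ (fun q => (f q).re) q = _ := this
      rw [h']; simp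
    rw [e.fderiv_eq]
    have := (Complex.reCLM.hasFDerivAt.comp p (differentiableAt_of_smoothOn
      (smoothOn_fderiv_dir hf hO Z) hO hp).hasFDerivAt).fderiv
    have h' : fderiv ℝ (fun q => (fderiv ℝ f q Z).re) p = _ := this
    rw [h']; simp
  rw [h1, h1, wd_wb_self hf hO hp]
  have : (4 : ℂ) = ((4 : ℝ) : ℂ) := by norm_num
  rw [this, Complex.div_ofReal_re, Complex.add_re]

/-- At a point where a test function touches `f` from below, the Levi form of `f` dominates the
one of the test function. -/
theorem le_re_wd_wb_of_touching {f : V → ℂ} (hf : ContDiffOn ℝ ∞ f O) (hO : IsOpen O) {p : V}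
    (hp : p ∈ O) {ψ : V → ℝ} (hψ : ContDiffAt ℝ 2 ψ p)
    (h : IsLocalMin (fun q => (f q).re - ψ q) p) (Y : V) :
    (fderiv ℝ (fderiv ℝ ψ) p Y Y +
      fderiv ℝ (fderiv ℝ ψ) p (Complex.I • Y) (Complex.I • Y)) / 4 ≤ (wd Y (wb Y f) p).re := by
  have hre : ContDiffAt ℝ 2 (fun q => (f q).re) p :=
    ((Complex.reCLM.contDiff.comp_contDiffOn hf).contDiffAt (hO.mem_nhds hp)).of_le two_le_infty
  rw [re_wd_wb_self hf hO hp]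
  have h1 := fderiv_fderiv_nonneg_of_isLocalMin h (hre.sub hψ) Y
  have h2 := fderiv_fderiv_nonneg_of_isLocalMin h (hre.sub hψ) (Complex.I • Y)
  rw [fderiv_fderiv_sub hre hψ] at h1 h2
  linarith

/-- Difference quotients of k − v from the left are nonpositive. Only the past enters, as a
parabolic maximum principle at a first time of vanishing requires. -/
theorem deriv_le_of_touching {k v : ℝ → ℝ} {k' v' t : ℝ} (hk : HasDerivAt k k' t)
    (hv : HasDerivAt v v' t) (h : ∀ᶠ s in nhdsWithin t (Set.Iio t), k t - v t ≤ k s - v s) :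
    k' ≤ v' := by
  have h1 : HasDerivWithinAt (fun s => k s - v s) (k' - v') (Set.Iio t) t :=
    (hk.sub hv).hasDerivWithinAt
  have h2 := hasDerivWithinAt_iff_tendsto_slope' (by simp : t ∉ Set.Iio t) |>.1 h1
  have : k' - v' ≤ 0 := by
    refine le_of_tendsto h2 ?_
    filter_upwards [h, self_mem_nhdsWithin] with s hs hst
    rw [slope_def_field]
    exact div_nonpos_of_nonneg_of_nonpos (by linarith) (by simpa using (le_of_lt hst))
  linarith
end Touch

/-! ### The squared norm of covectors, its Levi form, and the curvature as a minimum -/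

section Chart
variable {n : ℕ}

/-- The standard basis vectors of `ℂⁿ`. -/
abbrev stdE {n : ℕ} (i : Fin n) : Cn n := EuclideanSpace.single i 1

theorem dz_eq_wd (i : Fin n) (f : Cn n → ℂ) : dz i f = wd (stdE i) f := by
  have h : (Complex.I • stdE i : Cn n) = EuclideanSpace.single i Complex.I := by
    ext j; simp
  ext z; rw [dz, wd, h]

theorem dzbar_eq_wb (i : Fin n) (f : Cn n → ℂ) : dzbar i f = wb (stdE i) f := by
  have h : (Complex.I • stdE i : Cn n) = EuclideanSpace.single i Complex.I := by
    ext j; simp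
  ext z; rw [dzbar, wb, h]

/-- The coordinate functionals of `ℂⁿ`. -/
def coordL {n : ℕ} (i : Fin n) : Cn n →L[ℂ] ℂ := EuclideanSpace.proj i

theorem coordL_apply (i : Fin n) (v : Cn n) : coordL i v = v i := rfl

theorem stdE_apply (i j : Fin n) : (stdE i : Cn n) j = if j = i then 1 else 0 := by
  simp

theorem sum_stdE_apply (v : Fin n → ℂ) (j : Fin n) : (∑ a, v a • stdE a : Cn n) j = v j := by
  rw [← coordL_apply, map_sum]
  simp only [map_smul, coordL_apply, stdE_apply, smul_eq_mul, mul_ite, mul_one, mul_zero,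
    Finset.sum_ite_eq, Finset.mem_univ, if_true]

theorem eq_sum_stdE (v : Cn n) : v = ∑ a, v a • stdE a := by
  ext j
  rw [sum_stdE_apply]

/-- A smooth family of inverse metrics `H = G⁻¹` solving the Hermitian curvature flow in the form
`∂H/∂t = H ∂∂̄H - ∂H ∂̄H`. -/
structure MetricFlow (τ : ℝ) (O : Set (Cn n)) (G H : ℝ → Cn n → Matrix (Fin n) (Fin n) ℂ) :
    Prop where
  isOpen : IsOpen O
  smoothG : ∀ k l, SmoothFamily (Set.Ico 0 τ) O fun t z => G t z k l
  smooth : ∀ k l, SmoothFamily (Set.Ico 0 τ) O fun t z => H t z k l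
  mul_eq_one : ∀ t ∈ Set.Ico 0 τ, ∀ z ∈ O, H t z * G t z = 1
  hermG : ∀ t ∈ Set.Ico 0 τ, ∀ z ∈ O, (G t z).IsHermitian
  herm : ∀ t ∈ Set.Ico 0 τ, ∀ z ∈ O, (H t z).IsHermitian
  pos : ∀ t ∈ Set.Ico 0 τ, ∀ z ∈ O, ∀ v : Fin n → ℂ, v ≠ 0 →
    0 < (∑ a, ∑ b, v a * conj (v b) * H t z b a).re
  evolution : ∀ t ∈ Set.Ioo 0 τ, ∀ z ∈ O, ∀ a b, HasDerivAt (fun s => H s z a b)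
    (∑ m, ∑ r, (H t z r m * wd (stdE m) (wb (stdE r) fun w => H t w a b) z -
      wb (stdE r) (fun w => H t w a m) z * wd (stdE m) (fun w => H t w r b) z)) t

/-- The squared norm of a covector `α` at the point `x`, as a function of `(x, α)`. -/
def normFun (H : Cn n → Matrix (Fin n) (Fin n) ℂ) : Cn n × Cn n → ℂ :=
  sesq coordL fun a b z => H z b a

/-- Dual basis of the standard basis of `ℂⁿ × ℂⁿ`. -/
def prodCoord (n : ℕ) : Fin n ⊕ Fin n → Cn n × Cn n →L[ℂ] ℂ :=
  Sum.elim (fun i => (coordL i).comp (ContinuousLinearMap.fst ℂ (Cn n) (Cn n)))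
    fun i => (coordL i).comp (ContinuousLinearMap.snd ℂ (Cn n) (Cn n))

/-- The standard basis of `ℂⁿ × ℂⁿ`. -/
def prodBasis (n : ℕ) : Fin n ⊕ Fin n → Cn n × Cn n :=
  Sum.elim (fun i => (stdE i, 0)) fun i => (0, stdE i)

theorem prodBasis_expand (v : Cn n × Cn n) : v = ∑ a, prodCoord n a v • prodBasis n a := by
  have h1 : ∑ i, v.1 i • ((stdE i, 0) : Cn n × Cn n) = (v.1, 0) := by
    conv_rhs => rw [eq_sum_stdE v.1]
    ext <;> simp [Prod.fst_sum, Prod.snd_sum]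
  have h2 : ∑ i, v.2 i • ((0, stdE i) : Cn n × Cn n) = (0, v.2) := by
    conv_rhs => rw [eq_sum_stdE v.2]
    ext <;> simp [Prod.fst_sum, Prod.snd_sum]
  rw [Fintype.sum_sum_type]
  simp only [prodCoord, prodBasis, Sum.elim_inl, Sum.elim_inr, ContinuousLinearMap.comp_apply,
    ContinuousLinearMap.coe_fst', ContinuousLinearMap.coe_snd', coordL_apply]
  rw [h1, h2]
  simp

/-- The Levi form of `normFun`, on the bundle with coordinates `((x, α), (ξ, A))`. -/
def normLevi (H : Cn n → Matrix (Fin n) (Fin n) ℂ) : (Cn n × Cn n) × (Cn n × Cn n) → ℂ :=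
  levLift (prodCoord n) (prodBasis n) (normFun H)

/-- The vector `∂_ξ H α`. -/
def dHvec (H : Cn n → Matrix (Fin n) (Fin n) ℂ) (y : (Cn n × Cn n) × Cn n) : Fin n → ℂ :=
  fun b => ∑ a, y.1.2 a * wd y.2 (fun w => H w b a) y.1.1

/-- The curvature term `Ω(ξ, ξ̄, η, η̄)` in terms of the covector `α` dual to `η̄`, as a function of
`((x, α), ξ)`. -/
def griff (G H : Cn n → Matrix (Fin n) (Fin n) ℂ) (y : (Cn n × Cn n) × Cn n) : ℂ :=
  ∑ a, ∑ b, y.1.2 a * starRingEnd ℂ (y.1.2 b) * wd y.2 (wb y.2 fun w => H w b a) y.1.1 -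
    ∑ a, ∑ b, conj (dHvec H y a) * G y.1.1 a b * dHvec H y b

/-- The minimizer of `A ↦ normLevi H ((x, α), (ξ, A))`. -/
def minVec (G H : Cn n → Matrix (Fin n) (Fin n) ℂ) (y : (Cn n × Cn n) × Cn n) : Cn n :=
  WithLp.toLp 2 fun a => -∑ b, G y.1.1 a b * dHvec H y b

/-- The horizontal lift, for the torsion-twisted connection, of the vector dual to `θ̄`. -/
def twistField (H : Cn n → Matrix (Fin n) (Fin n) ℂ) (θ : Fin n → ℂ) (y : (Cn n × Cn n) × Cn n) :
    (Cn n × Cn n) × Cn n :=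
  ((WithLp.toLp 2 fun m => ∑ r, conj (θ r) * H y.1.1 r m,
    WithLp.toLp 2 fun m =>
      -∑ r, conj (θ r) * ∑ a, y.1.2 a * wd (stdE m) (fun w => H w r a) y.1.1),
    WithLp.toLp 2 fun m => ∑ r, conj (θ r) * wd y.2 (fun w => H w r m) y.1.1)

section Fixed
variable {O : Set (Cn n)} {G H : Cn n → Matrix (Fin n) (Fin n) ℂ}

theorem wd_wb_normFun (hO : IsOpen O) (hH : ∀ k l, ContDiffOn ℝ ∞ (fun z => H z k l) O)
    {x : Cn n} (hx : x ∈ O) (α X Y X' Y' : Cn n) :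
    wd (X', Y') (wb (X, Y) (normFun H)) (x, α) =
      ∑ a, ∑ b, (Y' a * starRingEnd ℂ (Y b) * H x b a + α a * starRingEnd ℂ (Y b) * wd X' (fun z => H z b a) x +
        Y' a * starRingEnd ℂ (α b) * wb X (fun z => H z b a) x +
        α a * starRingEnd ℂ (α b) * wd X' (wb X fun z => H z b a) x) :=
  wd_wb_sesq (ε := coordL) (Φ := fun a b z => H z b a) (fun a b => hH b a) hO hx α Y Y' X X'

theorem sum_ite_mul_left (F : Fin n → ℂ) (m : Fin n) :
    ∑ a, (if a = m then (1 : ℂ) else 0) * F a = F m := by simp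

theorem normFun_hess_PP (hO : IsOpen O) (hH : ∀ k l, ContDiffOn ℝ ∞ (fun z => H z k l) O)
    {x : Cn n} (hx : x ∈ O) (α : Cn n) (m r : Fin n) :
    wd (0, stdE m) (wb (0, stdE r) (normFun H)) (x, α) = H x r m := by
  rw [wd_wb_normFun hO hH hx]
  simp only [wd_zero_dir, wb_zero_dir, wd_fun_zero, mul_zero, add_zero, stdE_apply]
  rw [Finset.sum_congr rfl fun a _ => by
    rw [Finset.sum_congr rfl fun b _ => mul_assoc _ _ _, ← Finset.mul_sum], sum_ite_mul_left]
  rw [Finset.sum_eq_single r (fun b _ hb => by simp [hb]) (by simp)]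
  simp

theorem normFun_hess_XX (hO : IsOpen O) (hH : ∀ k l, ContDiffOn ℝ ∞ (fun z => H z k l) O)
    {x : Cn n} (hx : x ∈ O) (α : Cn n) (X X' : Cn n) :
    wd (X', 0) (wb (X, 0) (normFun H)) (x, α) =
      ∑ a, ∑ b, α a * starRingEnd ℂ (α b) * wd X' (wb X fun z => H z b a) x := by
  rw [wd_wb_normFun hO hH hx]
  simp

theorem normFun_hess_PX (hO : IsOpen O) (hH : ∀ k l, ContDiffOn ℝ ∞ (fun z => H z k l) O)
    {x : Cn n} (hx : x ∈ O) (α : Cn n) (m : Fin n) (X : Cn n) :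
    wd (0, stdE m) (wb (X, 0) (normFun H)) (x, α) =
      ∑ b, starRingEnd ℂ (α b) * wb X (fun z => H z b m) x := by
  rw [wd_wb_normFun hO hH hx]
  simp only [wd_zero_dir, PiLp.zero_apply, map_zero, mul_zero, zero_mul, add_zero, zero_add,
    stdE_apply]
  rw [Finset.sum_congr rfl fun a _ => by
    rw [Finset.sum_congr rfl fun b _ => mul_assoc _ _ _, ← Finset.mul_sum], sum_ite_mul_left]

theorem normFun_hess_XP (hO : IsOpen O) (hH : ∀ k l, ContDiffOn ℝ ∞ (fun z => H z k l) O)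
    {x : Cn n} (hx : x ∈ O) (α : Cn n) (r : Fin n) (X : Cn n) :
    wd (X, 0) (wb (0, stdE r) (normFun H)) (x, α) =
      ∑ a, α a * wd X (fun z => H z r a) x := by
  rw [wd_wb_normFun hO hH hx]
  simp only [wb_zero_dir, wd_fun_zero, PiLp.zero_apply, mul_zero, zero_mul, add_zero, zero_add,
    stdE_apply]
  refine Finset.sum_congr rfl fun a _ => ?_
  rw [Finset.sum_eq_single r (fun b _ hb => by simp [hb]) (by simp)]
  simp

theorem smoothOn_normFun (hH : ∀ k l, ContDiffOn ℝ ∞ (fun z => H z k l) O) :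
    ContDiffOn ℝ ∞ (normFun H) (O ×ˢ (Set.univ : Set (Cn n))) := by
  have h := smoothFamily_sesq (I := Set.univ) (O := O) (ε := coordL)
    (Φ := fun _ a b z => H z b a) fun a b =>
      ContDiffOn.comp (hH b a) contDiff_snd.contDiffOn fun q hq => hq.2
  exact h.slice (Set.mem_univ 0)

theorem normFun_real (hherm : ∀ z ∈ O, (H z).IsHermitian) (p : Cn n × Cn n)
    (hp : p ∈ O ×ˢ (Set.univ : Set (Cn n))) : conj (normFun H p) = normFun H p := by
  simp only [normFun, sesq, map_sum, map_mul, Complex.conj_conj]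
  rw [Finset.sum_comm]
  refine Finset.sum_congr rfl fun a _ => Finset.sum_congr rfl fun b _ => ?_
  rw [← (hherm p.1 hp.1).apply b a, RCLike.star_def]
  ring

theorem normLevi_real (hO : IsOpen O) (hH : ∀ k l, ContDiffOn ℝ ∞ (fun z => H z k l) O)
    (hherm : ∀ z ∈ O, (H z).IsHermitian) (q : (Cn n × Cn n) × (Cn n × Cn n))
    (hq : q ∈ (O ×ˢ (Set.univ : Set (Cn n))) ×ˢ (Set.univ : Set (Cn n × Cn n))) :
    conj (normLevi H q) = normLevi H q := by
  have hO' : IsOpen (O ×ˢ (Set.univ : Set (Cn n))) := hO.prod isOpen_univ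
  obtain ⟨p, v⟩ := q
  rw [normLevi, levLift_eq prodBasis_expand (smoothOn_normFun hH) hO' hq.1]
  have := (hessMat_isHermitian (smoothOn_normFun hH) hO' (normFun_real hherm)
    (fun _ : Unit => v) hq.1).apply () ()
  simpa [hessMat] using this

theorem conj_dHvec (hO : IsOpen O) (hherm : ∀ z ∈ O, (H z).IsHermitian)
    {y : (Cn n × Cn n) × Cn n} (hy : y.1.1 ∈ O) (a : Fin n) :
    conj (dHvec H y a) = ∑ c, starRingEnd ℂ (y.1.2 c) * wb y.2 (fun w => H w c a) y.1.1 := by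
  simp only [dHvec, map_sum, map_mul, conj_wd]
  refine Finset.sum_congr rfl fun c _ => ?_
  congr 1
  refine wb_congr ?_ _
  filter_upwards [hO.mem_nhds hy] with z hz
  rw [← (hherm z hz).apply c a, RCLike.star_def]

/-- Completing the square. -/
theorem normLevi_eq (hO : IsOpen O) (hH : ∀ k l, ContDiffOn ℝ ∞ (fun z => H z k l) O)
    (hHG : ∀ z ∈ O, H z * G z = 1)
    (hherm : ∀ z ∈ O, (H z).IsHermitian) {x : Cn n} (hx : x ∈ O) (α ξ A : Cn n) :
    normLevi H ((x, α), (ξ, A)) = griff G H ((x, α), ξ) +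
      ∑ a, ∑ b, (A a - minVec G H ((x, α), ξ) a) *
        starRingEnd ℂ (A b - minVec G H ((x, α), ξ) b) * H x b a := by
  rw [normLevi, levLift_eq prodBasis_expand (smoothOn_normFun hH) (hO.prod isOpen_univ)
    (show (x, α) ∈ O ×ˢ Set.univ from ⟨hx, trivial⟩), wd_wb_normFun hO hH hx]
  set y : (Cn n × Cn n) × Cn n := ((x, α), ξ) with hy
  set b := dHvec H y with hb
  set c : Fin n → ℂ := fun a => ∑ k, G x a k * b k with hc
  have hmin : ∀ a, minVec G H y a = - c a := fun a => rfl
  -- Because H G = 1, the vector c solves H c = b. This is the stationarity equation for A = −c, so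
  -- the terms linear in A complete to a square.
  have h1 : ∀ k, ∑ a, H x k a * c a = b k := by
    intro k
    have : (H x).mulVec ((G x).mulVec b) = b := by
      rw [Matrix.mulVec_mulVec, hHG x hx, Matrix.one_mulVec]
    exact congrFun this k
  have h2 : ∀ a, ∑ k, conj (c k) * H x k a = conj (b a) := by
    intro a
    rw [← h1 a, map_sum]
    refine Finset.sum_congr rfl fun k _ => ?_
    rw [map_mul, ← (hherm x hx).apply k a, RCLike.star_def]; ring
  have hcb := fun a => conj_dHvec hO hherm (y := y) hx a
  have hg : griff G H y = ∑ a, ∑ b, α a * starRingEnd ℂ (α b) * wd ξ (wb ξ fun w => H w b a) x -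
      ∑ a, conj (b a) * c a := by
    simp only [griff, hc, Finset.mul_sum, mul_assoc]
    rfl
  rw [hg]
  simp only [hmin, sub_neg_eq_add, map_add, Finset.sum_add_distrib]
  have e1 : ∑ a, ∑ k, α a * starRingEnd ℂ (A k) * wd ξ (fun z => H z k a) x = ∑ k, starRingEnd ℂ (A k) * b k := by
    rw [Finset.sum_comm]
    refine Finset.sum_congr rfl fun k _ => ?_
    simp only [hb, dHvec, Finset.mul_sum, hy]
    exact Finset.sum_congr rfl fun a _ => by ring
  have e2 : ∑ a, ∑ k, A a * starRingEnd ℂ (α k) * wb ξ (fun z => H z k a) x = ∑ a, conj (b a) * A a := by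
    refine Finset.sum_congr rfl fun a _ => ?_
    rw [hb, hcb, Finset.sum_mul]
    exact Finset.sum_congr rfl fun k _ => by simp only [hy]; ring
  have e3 : ∑ a, ∑ k, (A a + c a) * (starRingEnd ℂ (A k) + conj (c k)) * H x k a =
      ∑ a, ∑ k, A a * starRingEnd ℂ (A k) * H x k a + ∑ k, starRingEnd ℂ (A k) * b k + ∑ a, conj (b a) * A a +
      ∑ a, conj (b a) * c a := by
    have f1 : ∑ k, starRingEnd ℂ (A k) * b k = ∑ a, ∑ k, c a * starRingEnd ℂ (A k) * H x k a := by
      rw [Finset.sum_comm]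
      refine Finset.sum_congr rfl fun k _ => ?_
      rw [← h1 k, Finset.mul_sum]
      exact Finset.sum_congr rfl fun a _ => by ring
    have f2 : ∀ d : Fin n → ℂ, ∑ a, conj (b a) * d a = ∑ a, ∑ k, d a * conj (c k) * H x k a := by
      intro d
      refine Finset.sum_congr rfl fun a _ => ?_
      rw [← h2 a, Finset.sum_mul]
      exact Finset.sum_congr rfl fun k _ => by ring
    rw [f1, f2, f2]
    simp only [← Finset.sum_add_distrib]
    exact Finset.sum_congr rfl fun a _ => Finset.sum_congr rfl fun k _ => by ring
  rw [e1, e2, e3]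
  ring

end Fixed

namespace MetricFlow
variable {τ : ℝ} {O : Set (Cn n)} {G H : ℝ → Cn n → Matrix (Fin n) (Fin n) ℂ}

theorem smoothFamily_normFun (h : MetricFlow τ O G H) :
    SmoothFamily (Set.Ico 0 τ) (O ×ˢ (Set.univ : Set (Cn n))) fun t => normFun (H t) :=
  smoothFamily_sesq (Φ := fun t a b z => H t z b a) fun a b => h.smooth b a

theorem uniqueDiffOn_Ico (τ : ℝ) : UniqueDiffOn ℝ (Set.Ico 0 τ) :=
  _root_.uniqueDiffOn_Ico 0 τ

/-- `normFun` is quadratic in α: its fibre Hessian is H, the mixed derivatives contract α or ᾱ with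
first derivatives of H, and the base Hessian contracts both with ∂∂̄H. Inserted into the Poisson
expression, they give back the evolution of H contracted with α and ᾱ. -/
theorem isPoissonFlow_normFun (h : MetricFlow τ O G H) :
    IsPoissonFlow (Set.Ioo 0 τ) (O ×ˢ (Set.univ : Set (Cn n)))
      (fun m => ((0 : Cn n), stdE m)) (fun m => (stdE m, (0 : Cn n))) fun t => normFun (H t) := by
  rintro t ht ⟨x, α⟩ ⟨hx, -⟩
  have hIco : t ∈ Set.Ico 0 τ := ⟨ht.1.le, ht.2⟩
  have hH : ∀ k l, ContDiffOn ℝ ∞ (fun z => H t z k l) O := fun k l => (h.smooth k l).slice hIco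
  have hder : HasDerivAt (fun s => ∑ a, ∑ b, α a * starRingEnd ℂ (α b) * H s x b a) _ t :=
    HasDerivAt.fun_sum fun a _ => HasDerivAt.fun_sum fun b _ =>
      (h.evolution t ht x hx b a).const_mul (α a * starRingEnd ℂ (α b))
  refine HasDerivAt.congr_deriv (f := fun s => normFun (H s) (x, α)) hder ?_
  simp only [hessQ, hessMat, Sum.elim_inl, Sum.elim_inr, normFun_hess_PP h.isOpen hH hx,
    normFun_hess_XX h.isOpen hH hx, normFun_hess_PX h.isOpen hH hx, normFun_hess_XP h.isOpen hH hx]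
  simp only [Finset.mul_sum, Finset.sum_mul]
  have e : ∀ F : Fin n → Fin n → Fin n → Fin n → ℂ, ∑ a, ∑ b, ∑ m, ∑ r, F a b m r =
      ∑ m, ∑ r, ∑ a, ∑ b, F a b m r := by
    intro F
    rw [Finset.sum_congr rfl fun a _ => Finset.sum_comm, Finset.sum_comm]
    refine Finset.sum_congr rfl fun r _ => ?_
    rw [Finset.sum_congr rfl fun a _ => Finset.sum_comm, Finset.sum_comm]
  rw [e]
  refine Finset.sum_congr rfl fun m _ => Finset.sum_congr rfl fun r _ => ?_
  simp only [← Finset.sum_sub_distrib]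
  refine Finset.sum_congr rfl fun a _ => Finset.sum_congr rfl fun b _ => by ring

end MetricFlow
end Chart

/-! ### The differential inequality for the curvature -/

section Touching
variable {n : ℕ}

/-- The vectors `∂/∂A_m, ∂/∂α_m, ∂/∂x_m, ∂/∂ξ_m` of the space with coordinates
`((x, α), (ξ, A))`. -/
def liftZ (n : ℕ) : (Fin n ⊕ Fin n) ⊕ (Fin n ⊕ Fin n) → (Cn n × Cn n) × (Cn n × Cn n) :=
  Sum.elim
    (Sum.elim (fun m => ((0 : Cn n × Cn n), ((0 : Cn n), stdE m)))
      fun m => (((0 : Cn n), stdE m), (0 : Cn n × Cn n)))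
    (Sum.elim (fun m => ((stdE m, (0 : Cn n)), (0 : Cn n × Cn n)))
      fun m => ((0 : Cn n × Cn n), (stdE m, (0 : Cn n))))

/-- The projection `((x, α), (ξ, A)) ↦ ((x, α), ξ)`. -/
def forgetA (n : ℕ) : (Cn n × Cn n) × (Cn n × Cn n) →L[ℂ] (Cn n × Cn n) × Cn n :=
  (ContinuousLinearMap.id ℂ (Cn n × Cn n)).prodMap (ContinuousLinearMap.fst ℂ (Cn n) (Cn n))

/-- The covector `θ`, placed in the `A` directions. -/
def liftTheta (θ : Fin n → ℂ) : (Fin n ⊕ Fin n) ⊕ (Fin n ⊕ Fin n) → ℂ :=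
  Sum.elim (Sum.elim θ fun _ => 0) fun _ => 0

/-- The section `((x, α), ξ) ↦ ((x, α), (ξ, A))` with `A` the minimizer of `normLevi`. -/
def minSec (G H : Cn n → Matrix (Fin n) (Fin n) ℂ) (y : (Cn n × Cn n) × Cn n) :
    (Cn n × Cn n) × (Cn n × Cn n) := (y.1, (y.2, minVec G H y))

section Fixed
variable {O : Set (Cn n)} {G H : Cn n → Matrix (Fin n) (Fin n) ℂ}

theorem col_liftTheta (U : Matrix ((Fin n ⊕ Fin n) ⊕ (Fin n ⊕ Fin n))
    ((Fin n ⊕ Fin n) ⊕ (Fin n ⊕ Fin n)) ℂ) (θ : Fin n → ℂ) (c) :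
    col U (liftTheta θ) c = ∑ r, U c (.inl (.inl r)) * conj (θ r) := by
  simp [col, liftTheta, Fintype.sum_sum_type]

/-- For θ in the A directions only the A-columns of the Hessian enter `col`. Their A, α and ξ rows,
computed here and in the next two lemmas, contain H and its first derivatives only. The x row
contains second derivatives, but rotation moves it to the A component, which `forgetA` discards;
hence the projected field does not depend on A. -/
theorem normLevi_hess_A (hO : IsOpen O) (hH : ∀ k l, ContDiffOn ℝ ∞ (fun z => H z k l) O)
    {p : Cn n × Cn n} (hp : p.1 ∈ O) (v : Cn n × Cn n) (m r : Fin n) :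
    hessMat (liftZ n) (normLevi H) (p, v) (.inl (.inl m)) (.inl (.inl r)) = H p.1 r m := by
  have hp' : p ∈ O ×ˢ (Set.univ : Set (Cn n)) := ⟨hp, trivial⟩
  simp only [hessMat, liftZ, Sum.elim_inl, normLevi]
  rw [wd_wb_levLift prodBasis_expand (smoothOn_normFun hH) (hO.prod isOpen_univ) hp',
    normFun_hess_PP hO hH hp]
  simp [wd_zero_dir, wb_zero_dir, wd_fun_zero, wb_fun_zero]

theorem normLevi_hess_alpha (hO : IsOpen O) (hH : ∀ k l, ContDiffOn ℝ ∞ (fun z => H z k l) O)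
    {p : Cn n × Cn n} (hp : p.1 ∈ O) (v : Cn n × Cn n) (m r : Fin n) :
    hessMat (liftZ n) (normLevi H) (p, v) (.inl (.inr m)) (.inl (.inl r)) =
      wd v.1 (fun z => H z r m) p.1 := by
  have hp' : p ∈ O ×ˢ (Set.univ : Set (Cn n)) := ⟨hp, trivial⟩
  have hO' : IsOpen (O ×ˢ (Set.univ : Set (Cn n))) := hO.prod isOpen_univ
  simp only [hessMat, liftZ, Sum.elim_inl, Sum.elim_inr, normLevi]
  rw [wd_wb_levLift prodBasis_expand (smoothOn_normFun hH) hO' hp']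
  have e : wb ((0 : Cn n), stdE r) (wd ((0 : Cn n), stdE m) (normFun H)) =ᶠ[nhds p]
      fun q => H q.1 r m := by
    filter_upwards [hO'.mem_nhds hp'] with q hq
    rw [← wd_wb_comm (smoothOn_normFun hH) hO' hq]
    exact normFun_hess_PP hO hH hq.1 q.2 m r
  rw [wd_congr e]
  have h2 := wd_comp (φ := Prod.fst) (p := p) (f := fun z => H z r m)
    (differentiableAt_of_smoothOn (hH r m) hO hp)
    (ContinuousLinearMap.fst ℂ (Cn n) (Cn n)).hasFDerivAt v
  rw [h2]
  simp [wd_zero_dir, wb_zero_dir, wd_fun_zero, wb_fun_zero]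

theorem normLevi_hess_xi (hO : IsOpen O) (hH : ∀ k l, ContDiffOn ℝ ∞ (fun z => H z k l) O)
    {p : Cn n × Cn n} (hp : p.1 ∈ O) (v : Cn n × Cn n) (m r : Fin n) :
    hessMat (liftZ n) (normLevi H) (p, v) (.inr (.inr m)) (.inl (.inl r)) =
      ∑ a, p.2 a * wd (stdE m) (fun z => H z r a) p.1 := by
  have hp' : p ∈ O ×ˢ (Set.univ : Set (Cn n)) := ⟨hp, trivial⟩
  simp only [hessMat, liftZ, Sum.elim_inl, Sum.elim_inr, normLevi]
  rw [wd_wb_levLift prodBasis_expand (smoothOn_normFun hH) (hO.prod isOpen_univ) hp',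
    normFun_hess_XP hO hH hp]
  simp [wd_zero_dir, wb_zero_dir, wd_fun_zero, wb_fun_zero]

theorem toLp_sum_stdE (w : Fin n → ℂ) : ∑ m, w m • (stdE m : Cn n) = WithLp.toLp 2 w := by
  ext j; rw [sum_stdE_apply]

/-- The Hamiltonian vector field of the contraction of the Levi form with `θ` projects to
`twistField`. -/
theorem forgetA_rot_col (hO : IsOpen O) (hH : ∀ k l, ContDiffOn ℝ ∞ (fun z => H z k l) O)
    {y : (Cn n × Cn n) × Cn n} (hy : y.1.1 ∈ O) (A : Cn n) (θ : Fin n → ℂ) :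
    forgetA n (∑ c, rot (col (hessMat (liftZ n) (normLevi H) (y.1, (y.2, A))) (liftTheta θ)) c •
      liftZ n c) = twistField H θ y := by
  have h1 : ∀ w : Fin n → ℂ, ∑ m, w m • (((0 : Cn n), stdE m), (0 : Cn n)) =
      ((0, WithLp.toLp 2 w), 0) := by
    intro w; rw [← toLp_sum_stdE]; ext <;> simp [Prod.fst_sum, Prod.snd_sum]
  have h2 : ∀ w : Fin n → ℂ, ∑ m, w m • ((stdE m, (0 : Cn n)), (0 : Cn n)) =
      ((WithLp.toLp 2 w, 0), 0) := by
    intro w; rw [← toLp_sum_stdE]; ext <;> simp [Prod.fst_sum, Prod.snd_sum]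
  have h3 : ∀ w : Fin n → ℂ, ∑ m, w m • ((0 : Cn n × Cn n), (stdE m : Cn n)) =
      (0, WithLp.toLp 2 w) := by
    intro w; rw [← toLp_sum_stdE]; ext <;> simp [Prod.fst_sum, Prod.snd_sum]
  have z1 : ∀ m, forgetA n (liftZ n (.inl (.inl m))) = 0 := fun _ => rfl
  have z2 : ∀ m, forgetA n (liftZ n (.inl (.inr m))) = (((0 : Cn n), stdE m), (0 : Cn n)) :=
    fun _ => rfl
  have z3 : ∀ m, forgetA n (liftZ n (.inr (.inl m))) = ((stdE m, (0 : Cn n)), (0 : Cn n)) :=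
    fun _ => rfl
  have z4 : ∀ m, forgetA n (liftZ n (.inr (.inr m))) = ((0 : Cn n × Cn n), (stdE m : Cn n)) :=
    fun _ => rfl
  have r1 : ∀ w : (Fin n ⊕ Fin n) ⊕ (Fin n ⊕ Fin n) → ℂ, ∀ a, rot w (.inl a) = -w (.inr a) :=
    fun _ _ => rfl
  have r2 : ∀ w : (Fin n ⊕ Fin n) ⊕ (Fin n ⊕ Fin n) → ℂ, ∀ a, rot w (.inr a) = w (.inl a) :=
    fun _ _ => rfl
  rw [map_sum]
  simp only [map_smul, Fintype.sum_sum_type, z1, z2, z3, z4, r1, r2, smul_zero,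
    Finset.sum_const_zero, zero_add]
  rw [h1, h2, h3]
  simp only [col_liftTheta, normLevi_hess_A hO hH hy, normLevi_hess_alpha hO hH hy,
    normLevi_hess_xi hO hH hy]
  simp only [twistField, zero_add, Prod.mk_add_mk, add_zero, mul_comm]

/-- This identifies the factor in front of the time derivative in the strong inequality as |θ|² for
H, which is locally bounded. -/
theorem levi_liftTheta (hO : IsOpen O) (hH : ∀ k l, ContDiffOn ℝ ∞ (fun z => H z k l) O)
    {p : Cn n × Cn n} (hp : p.1 ∈ O) (v : Cn n × Cn n) (θ : Fin n → ℂ) :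
    levi (hessMat (liftZ n) (normLevi H) (p, v)) (liftTheta θ) =
      ∑ a, ∑ b, θ a * conj (θ b) * H p.1 b a := by
  simp only [levi, liftTheta, Fintype.sum_sum_type, Sum.elim_inl, Sum.elim_inr, map_zero, mul_zero,
    zero_mul, Finset.sum_const_zero, add_zero, normLevi_hess_A hO hH hp]
  exact Finset.sum_congr rfl fun a _ => Finset.sum_congr rfl fun b _ => by ring

end Fixed

namespace MetricFlow
variable {τ : ℝ} {O : Set (Cn n)} {G H : ℝ → Cn n → Matrix (Fin n) (Fin n) ℂ}

/-- The domain of the coordinates `((x, α), ξ)`. -/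
abbrev dom (O : Set (Cn n)) : Set ((Cn n × Cn n) × Cn n) :=
  (O ×ˢ (Set.univ : Set (Cn n))) ×ˢ (Set.univ : Set (Cn n))

/-- The domain of the coordinates `((x, α), (ξ, A))`. -/
abbrev domA (O : Set (Cn n)) : Set ((Cn n × Cn n) × (Cn n × Cn n)) :=
  (O ×ˢ (Set.univ : Set (Cn n))) ×ˢ (Set.univ : Set (Cn n × Cn n))

theorem isOpen_dom (h : MetricFlow τ O G H) : IsOpen (dom O) :=
  (h.isOpen.prod isOpen_univ).prod isOpen_univ

theorem isOpen_domA (h : MetricFlow τ O G H) : IsOpen (domA O) :=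
  (h.isOpen.prod isOpen_univ).prod isOpen_univ

theorem smooth_slice (h : MetricFlow τ O G H) {t : ℝ} (ht : t ∈ Set.Ico 0 τ) (k l : Fin n) :
    ContDiffOn ℝ ∞ (fun z => H t z k l) O := (h.smooth k l).slice ht

theorem smoothFamily_normLevi (h : MetricFlow τ O G H) :
    SmoothFamily (Set.Ico 0 τ) (domA O) fun t => normLevi (H t) :=
  smoothFamily_levLift h.smoothFamily_normFun (uniqueDiffOn_Ico τ) (h.isOpen.prod isOpen_univ)

theorem isPoissonFlow_normLevi (h : MetricFlow τ O G H) {t : ℝ} (ht : t ∈ Set.Ioo 0 τ)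
    {q : (Cn n × Cn n) × (Cn n × Cn n)} (hq : q.1.1 ∈ O) :
    HasDerivAt (fun s => normLevi (H s) q) (hessQ (hessMat (liftZ n) (normLevi (H t)) q)) t :=
  h.isPoissonFlow_normFun.levLift prodBasis_expand
    (h.smoothFamily_normFun.mono Set.Ioo_subset_Ico_self subset_rfl) isOpen_Ioo
    (h.isOpen.prod isOpen_univ) t ht q ⟨⟨hq, trivial⟩, trivial⟩

theorem continuousOn_coord_snd (m : Fin n) (S : Set (ℝ × ((Cn n × Cn n) × Cn n))) :
    ContinuousOn (fun q : ℝ × ((Cn n × Cn n) × Cn n) => q.2.1.2 m) S :=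
  ((coordL m).continuous.comp (continuous_snd.comp (continuous_fst.comp continuous_snd))).continuousOn

/-- Continuity of the derivative of a family of functions in a variable direction. -/
theorem continuousOn_wd_dir {F : ℝ → Cn n → ℂ} (hF : SmoothFamily (Set.Ico 0 τ) O F)
    (hO : IsOpen O) : ContinuousOn (fun q : ℝ × ((Cn n × Cn n) × Cn n) =>
      wd q.2.2 (F q.1) q.2.1.1) (Set.Ico 0 τ ×ˢ dom O) := by
  have e : ∀ q : ℝ × ((Cn n × Cn n) × Cn n), wd q.2.2 (F q.1) q.2.1.1 =
      ∑ m, q.2.2 m * wd (stdE m) (F q.1) q.2.1.1 := by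
    intro q
    conv_lhs => rw [eq_sum_stdE q.2.2]
    exact wd_sum_dir _ _ _ _ _
  simp only [e]
  refine continuousOn_finsetSum _ fun m _ => ContinuousOn.mul ?_ ?_
  · exact ((coordL m).continuous.comp (continuous_snd.comp continuous_snd)).continuousOn
  · exact (hF.wd (uniqueDiffOn_Ico τ) hO (stdE m)).continuousOn.comp
      (f := fun q : ℝ × ((Cn n × Cn n) × Cn n) => (q.1, q.2.1.1)) (by fun_prop)
      fun q hq => ⟨hq.1, hq.2.1.1⟩

theorem continuousOn_dHvec (h : MetricFlow τ O G H) (b : Fin n) :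
    ContinuousOn (fun q : ℝ × ((Cn n × Cn n) × Cn n) => dHvec (H q.1) q.2 b)
      (Set.Ico 0 τ ×ˢ dom O) := by
  unfold dHvec
  refine continuousOn_finsetSum _ fun a _ => ?_
  exact (continuousOn_coord_snd a _).mul
    (continuousOn_wd_dir (F := fun t w => H t w b a) (h.smooth b a) h.isOpen)

theorem continuousOn_entry {F : ℝ → Cn n → ℂ} (hF : SmoothFamily (Set.Ico 0 τ) O F) :
    ContinuousOn (fun q : ℝ × ((Cn n × Cn n) × Cn n) => F q.1 q.2.1.1) (Set.Ico 0 τ ×ˢ dom O) :=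
  hF.continuousOn.comp (f := fun q : ℝ × ((Cn n × Cn n) × Cn n) => (q.1, q.2.1.1)) (by fun_prop)
    fun q hq => ⟨hq.1, hq.2.1.1⟩

theorem continuousOn_minSec (h : MetricFlow τ O G H) :
    ContinuousOn (fun q : ℝ × ((Cn n × Cn n) × Cn n) => minSec (G q.1) (H q.1) q.2)
      (Set.Ico 0 τ ×ˢ dom O) := by
  have h1 : ContinuousOn (fun q : ℝ × ((Cn n × Cn n) × Cn n) => minVec (G q.1) (H q.1) q.2)
      (Set.Ico 0 τ ×ˢ dom O) := by
    refine (PiLp.continuous_toLp 2 _).comp_continuousOn ?_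
    refine continuousOn_pi.2 fun a => ContinuousOn.neg ?_
    exact continuousOn_finsetSum _ fun b _ =>
      (continuousOn_entry (h.smoothG a b)).mul (h.continuousOn_dHvec b)
  unfold minSec
  exact ContinuousOn.prodMk (by fun_prop) (ContinuousOn.prodMk (by fun_prop) h1)

theorem continuousOn_hessMat (h : MetricFlow τ O G H) :
    ContinuousOn (fun q : ℝ × ((Cn n × Cn n) × Cn n) =>
      (hessMat (liftZ n) (normLevi (H q.1)) (minSec (G q.1) (H q.1) q.2) : _ → _ → ℂ))
      (Set.Ico 0 τ ×ˢ dom O) := by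
  refine continuousOn_pi.2 fun c => continuousOn_pi.2 fun d => ?_
  have h1 := ((h.smoothFamily_normLevi.wb (uniqueDiffOn_Ico τ) h.isOpen_domA (liftZ n d)).wd
    (uniqueDiffOn_Ico τ) h.isOpen_domA (liftZ n c)).continuousOn
  exact h1.comp (f := fun q : ℝ × ((Cn n × Cn n) × Cn n) => (q.1, minSec (G q.1) (H q.1) q.2))
    (continuousOn_fst.prodMk h.continuousOn_minSec) fun q hq => ⟨hq.1, ⟨hq.2.1, trivial⟩⟩

theorem quad_nonneg (h : MetricFlow τ O G H) {t : ℝ} (ht : t ∈ Set.Ico 0 τ) {z : Cn n}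
    (hz : z ∈ O) (v : Fin n → ℂ) : 0 ≤ (∑ a, ∑ b, v a * conj (v b) * H t z b a).re := by
  by_cases hv : v = 0
  · simp [hv]
  · exact (h.pos t ht z hz v hv).le

/-- The difference is the square |A − A_min|² for H. Together with equality on `minSec`, this makes
the curvature a partial minimum over A, so that touching from below lifts from `griff` to
`normLevi`. -/
theorem griff_le_normLevi (h : MetricFlow τ O G H) {t : ℝ} (ht : t ∈ Set.Ico 0 τ)
    {q : (Cn n × Cn n) × (Cn n × Cn n)} (hq : q.1.1 ∈ O) :
    (griff (G t) (H t) (forgetA n q)).re ≤ (normLevi (H t) q).re := by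
  obtain ⟨⟨x, α⟩, ξ, A⟩ := q
  rw [normLevi_eq h.isOpen (h.smooth_slice ht) (h.mul_eq_one t ht) (h.herm t ht) hq, Complex.add_re]
  have := h.quad_nonneg ht hq fun a => A a - minVec (G t) (H t) ((x, α), ξ) a
  have e : forgetA n ((x, α), ξ, A) = ((x, α), ξ) := rfl
  rw [e]
  linarith

theorem normLevi_minSec (h : MetricFlow τ O G H) {t : ℝ} (ht : t ∈ Set.Ico 0 τ)
    {y : (Cn n × Cn n) × Cn n} (hy : y.1.1 ∈ O) :
    normLevi (H t) (minSec (G t) (H t) y) = griff (G t) (H t) y := by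
  obtain ⟨⟨x, α⟩, ξ⟩ := y
  rw [minSec, normLevi_eq h.isOpen (h.smooth_slice ht) (h.mul_eq_one t ht) (h.herm t ht) hy]
  simp

theorem continuousOn_griff (h : MetricFlow τ O G H) :
    ContinuousOn (fun q : ℝ × ((Cn n × Cn n) × Cn n) => griff (G q.1) (H q.1) q.2)
      (Set.Ico 0 τ ×ˢ dom O) := by
  have h1 := h.smoothFamily_normLevi.continuousOn.comp
    (f := fun q : ℝ × ((Cn n × Cn n) × Cn n) => (q.1, minSec (G q.1) (H q.1) q.2))
    (continuousOn_fst.prodMk h.continuousOn_minSec) fun q hq => ⟨hq.1, ⟨hq.2.1, trivial⟩⟩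
  exact h1.congr fun q hq => (h.normLevi_minSec hq.1 hq.2.1.1).symm

theorem griff_im (h : MetricFlow τ O G H) {t : ℝ} (ht : t ∈ Set.Ico 0 τ)
    {y : (Cn n × Cn n) × Cn n} (hy : y.1.1 ∈ O) : (griff (G t) (H t) y).im = 0 := by
  rw [← h.normLevi_minSec ht hy, ← Complex.conj_eq_iff_im]
  exact normLevi_real h.isOpen (h.smooth_slice ht) (h.herm t ht) _ ⟨⟨hy, trivial⟩, trivial⟩

theorem normSq_forgetA_le (X : (Fin n ⊕ Fin n) ⊕ (Fin n ⊕ Fin n) → ℂ) :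
    ‖forgetA n (∑ c, X c • liftZ n c)‖ ^ 2 ≤
      (∑ c, ‖forgetA n (liftZ n c)‖ ^ 2) * ∑ c, Complex.normSq (X c) := by
  rw [map_sum]
  have h1 : ‖∑ c, forgetA n (X c • liftZ n c)‖ ≤ ∑ c, ‖X c‖ * ‖forgetA n (liftZ n c)‖ := by
    refine (norm_sum_le _ _).trans_eq (Finset.sum_congr rfl fun c _ => ?_)
    rw [map_smul, norm_smul]
  have h2 := Finset.sum_mul_sq_le_sq_mul_sq Finset.univ (fun c => ‖X c‖)
    fun c => ‖forgetA n (liftZ n c)‖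
  simp only [Complex.normSq_eq_norm_sq]
  rw [mul_comm]
  exact (pow_le_pow_left₀ (norm_nonneg _) h1 2).trans h2

/-- The differential inequality for the curvature term, in the sense of test functions: a test
function with almost nonnegative Hessian touching `griff` from below (in the past) satisfies, up to
an error, `∂v/∂t ≥ 0` and `∂v/∂t ≥ c L(X_θ)`, where `L` is its Levi form. -/
theorem exists_touching_bounds (h : MetricFlow τ O G H) (θ : Fin n → ℂ)
    {t₀ : ℝ} (ht₀ : t₀ ∈ Set.Ico 0 τ) {y₀ : (Cn n × Cn n) × Cn n} (hy₀ : y₀.1.1 ∈ O) :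
    ∃ K : ℝ, 0 ≤ K ∧ ∃ r > 0, ∀ᶠ q : ℝ × ((Cn n × Cn n) × Cn n) in
      nhdsWithin (t₀, y₀) (Set.Ico 0 τ ×ˢ dom O), 0 < q.1 →
      ∀ ψ : (Cn n × Cn n) × Cn n → ℝ, ContDiffAt ℝ 2 ψ q.2 →
      IsLocalMin (fun y => (griff (G q.1) (H q.1) y).re - ψ y) q.2 →
      ∀ (v : ℝ → ℝ) (v' : ℝ), HasDerivAt v v' q.1 →
      (∀ᶠ s in nhdsWithin q.1 (Set.Iio q.1), (griff (G q.1) (H q.1) q.2).re - v q.1 ≤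
        (griff (G s) (H s) q.2).re - v s) →
      ∀ lam ∈ Set.Ico 0 r, (∀ Y, -lam * ‖Y‖ ^ 2 ≤ fderiv ℝ (fderiv ℝ ψ) q.2 Y Y) →
      0 ≤ v' + K * lam ∧
      (fderiv ℝ (fderiv ℝ ψ) q.2 (twistField (H q.1) θ q.2) (twistField (H q.1) θ q.2) +
        fderiv ℝ (fderiv ℝ ψ) q.2 (Complex.I • twistField (H q.1) θ q.2)
          (Complex.I • twistField (H q.1) θ q.2)) / 4 ≤
        (∑ a, ∑ b, θ a * conj (θ b) * H q.1 q.2.1.1 b a).re * (2 * v') + K * lam := by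
  classical
  -- The constants belong to the Hessian at the minimizer over (t₀, y₀). By continuity of `minSec`
  -- and of the Hessian they serve all nearby space-time points.
  obtain ⟨K, hK, r, hr, hev⟩ := exists_hessQ_bounds
    (hessMat (liftZ n) (normLevi (H t₀)) (minSec (G t₀) (H t₀) y₀)) (liftTheta θ)
  set C : ℝ := ∑ c, ‖forgetA n (liftZ n c)‖ ^ 2 with hC
  have hC0 : 0 ≤ C := Finset.sum_nonneg fun _ _ => by positivity
  -- C compares the norm of the projected vector with that of its coefficients, so a lower Hessian
  -- bound −lam for ψ becomes −C·lam for the Levi form upstairs. The denominator C + 1 avoids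
  -- dividing by zero.
  refine ⟨K * C, by positivity, r / (C + 1), by positivity, ?_⟩
  have hcont : ContinuousWithinAt (fun q : ℝ × ((Cn n × Cn n) × Cn n) =>
      (hessMat (liftZ n) (normLevi (H q.1)) (minSec (G q.1) (H q.1) q.2) : _ → _ → ℂ))
      (Set.Ico 0 τ ×ˢ dom O) (t₀, y₀) :=
    h.continuousOn_hessMat (t₀, y₀) ⟨ht₀, ⟨⟨hy₀, trivial⟩, trivial⟩⟩
  filter_upwards [hcont.tendsto.eventually hev, self_mem_nhdsWithin]
  rintro ⟨t, y⟩ hU ⟨ht, ⟨⟨hy, -⟩, -⟩⟩ htpos ψ hψ hmin v v' hv hpast lam hlam hlow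
  dsimp only at hU ht hy htpos hψ hmin hv hpast hlow ⊢
  set q := minSec (G t) (H t) y with hq
  have hπ : forgetA n q = y := rfl
  have hqd : q ∈ domA O := ⟨⟨hy, trivial⟩, trivial⟩
  have hsm := h.smoothFamily_normLevi.slice ht
  have hO := h.isOpen_domA
  have hreal := normLevi_real h.isOpen (h.smooth_slice ht) (h.herm t ht)
  have hherm := hessMat_isHermitian hsm hO hreal (liftZ n) hqd
  let π : (Cn n × Cn n) × (Cn n × Cn n) →L[ℝ] (Cn n × Cn n) × Cn n :=
    (forgetA n).restrictScalars ℝ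
  have hψ' : ContDiffAt ℝ 2 ψ (π q) := hψ
  -- The pulled-back test function is constant in A. It touches `normLevi` from below at the
  -- minimizer, where `normLevi` and `griff` agree.
  have hmin' : IsLocalMin (fun q' => (normLevi (H t) q').re - ψ (π q')) q := by
    have h1 : ∀ᶠ q' in nhds q, (griff (G t) (H t) y).re - ψ y ≤
        (griff (G t) (H t) (π q')).re - ψ (π q') :=
      (π.continuous.tendsto q).eventually hmin
    filter_upwards [h1, hO.mem_nhds hqd] with q' h1 h2
    have h3 := h.griff_le_normLevi ht h2.1.1
    have h4 : (normLevi (H t) q).re = (griff (G t) (H t) y).re := by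
      rw [hq, h.normLevi_minSec ht hy]
    have h5 : ψ (π q) = ψ y := rfl
    have h6 : forgetA n q' = π q' := rfl
    rw [h6] at h3
    linarith
  have htouch : ∀ X : (Fin n ⊕ Fin n) ⊕ (Fin n ⊕ Fin n) → ℂ,
      (fderiv ℝ (fderiv ℝ ψ) y (forgetA n (∑ c, X c • liftZ n c))
        (forgetA n (∑ c, X c • liftZ n c)) +
      fderiv ℝ (fderiv ℝ ψ) y (Complex.I • forgetA n (∑ c, X c • liftZ n c))
        (Complex.I • forgetA n (∑ c, X c • liftZ n c))) / 4 ≤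
      (levi (hessMat (liftZ n) (normLevi (H t)) q) X).re := by
    intro X
    rw [levi_hessMat hsm hO hqd]
    have h1 := le_re_wd_wb_of_touching hsm hO hqd
      (ψ := fun q' => ψ (π q')) (hψ'.comp q π.contDiff.contDiffAt) hmin' (∑ c, X c • liftZ n c)
    rw [fderiv_fderiv_comp_clm π hψ', fderiv_fderiv_comp_clm π hψ'] at h1
    have e : π (Complex.I • ∑ c, X c • liftZ n c) =
        Complex.I • forgetA n (∑ c, X c • liftZ n c) := map_smul (forgetA n) _ _
    rw [e] at h1
    exact h1
  have hlamC : C * lam ∈ Set.Ico 0 r := by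
    refine ⟨mul_nonneg hC0 hlam.1, ?_⟩
    have h1 := (lt_div_iff₀ (by positivity : 0 < C + 1)).1 hlam.2
    nlinarith [hlam.1]
  have hlevi : ∀ X, -(C * lam) * ∑ a, Complex.normSq (X a) ≤
      (levi (hessMat (liftZ n) (normLevi (H t)) q) X).re := by
    intro X
    refine le_trans ?_ (htouch X)
    have h1 := hlow (forgetA n (∑ c, X c • liftZ n c))
    have h2 := hlow (Complex.I • forgetA n (∑ c, X c • liftZ n c))
    rw [norm_smul, Complex.norm_I, one_mul] at h2
    have h3 := normSq_forgetA_le X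
    have h4 := mul_le_mul_of_nonneg_left h3 hlam.1
    have h5 : 0 ≤ lam * ‖forgetA n (∑ c, X c • liftZ n c)‖ ^ 2 :=
      mul_nonneg hlam.1 (by positivity)
    rw [← hC] at h4
    linarith
  obtain ⟨b1, b2⟩ := hU hherm (C * lam) hlamC hlevi
  have hder := h.isPoissonFlow_normLevi (t := t) ⟨htpos, ht.2⟩ (q := q) hy
  have hderre : HasDerivAt (fun s => (normLevi (H s) q).re)
      (hessQ (hessMat (liftZ n) (normLevi (H t)) q)).re t :=
    Complex.reCLM.hasFDerivAt.comp_hasDerivAt t hder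
  -- The point q is frozen while time runs backwards. At an earlier time s it need not be the
  -- minimizer any more, but `normLevi` still dominates `griff` there, which is the direction
  -- needed.
  have hle : (hessQ (hessMat (liftZ n) (normLevi (H t)) q)).re ≤ v' := by
    refine deriv_le_of_touching hderre hv ?_
    have hnear : ∀ᶠ s in nhdsWithin t (Set.Iio t), s ∈ Set.Ioo 0 t :=
      Ioo_mem_nhdsLT htpos
    filter_upwards [hpast, hnear] with s h1 h2
    have h3 := h.griff_le_normLevi (t := s) ⟨h2.1.le, h2.2.trans ht.2⟩ (q := q) hy
    have h4 : (normLevi (H t) q).re = (griff (G t) (H t) y).re := by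
      rw [hq, h.normLevi_minSec ht hy]
    rw [hπ] at h3
    linarith
  have hN := h.quad_nonneg ht hy θ
  have hlev : levi (hessMat (liftZ n) (normLevi (H t)) q) (liftTheta θ) =
      ∑ a, ∑ b, θ a * conj (θ b) * H t y.1.1 b a :=
    levi_liftTheta h.isOpen (h.smooth_slice ht) (p := y.1) hy _ θ
  have hrot := forgetA_rot_col h.isOpen (h.smooth_slice ht) hy (minVec (G t) (H t) y) θ
  have hq' : q = (y.1, (y.2, minVec (G t) (H t) y)) := rfl
  rw [← hq'] at hrot
  have h6 := htouch (rot (col (hessMat (liftZ n) (normLevi (H t)) q) (liftTheta θ)))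
  rw [hrot] at h6
  have b2' := h6.trans b2
  rw [hlev] at b2'
  constructor
  · linarith
  · have := mul_le_mul_of_nonneg_left hle hN
    linarith

end MetricFlow
end Touching

/-! ### Bony's strong maximum principle for test functions -/

section Bony
variable {W : Type*} [NormedAddCommGroup W] [InnerProductSpace ℝ W]

theorem contDiff_expBarrier (ε a : ℝ) (c : W) :
    ContDiff ℝ ∞ fun p : W => ε * Real.exp (-a * ‖p - c‖ ^ 2) := by
  have h : ContDiff ℝ ∞ fun p : W => ‖p - c‖ ^ 2 := (contDiff_id.sub contDiff_const).norm_sq ℝ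
  exact contDiff_const.mul (Real.contDiff_exp.comp (contDiff_const.mul h))

theorem hasFDerivAt_expBarrier (ε a : ℝ) (c p : W) :
    HasFDerivAt (fun p : W => ε * Real.exp (-a * ‖p - c‖ ^ 2))
      ((ε * Real.exp (-a * ‖p - c‖ ^ 2) * (-2 * a)) • innerSL ℝ (p - c)) p := by
  have h1 : HasFDerivAt (fun p : W => ‖p - c‖ ^ 2) (2 • (innerSL ℝ (p - c)).comp
      (ContinuousLinearMap.id ℝ W)) p := ((hasFDerivAt_id p).sub_const c).norm_sq
  have h2 := (((h1.const_mul (-a)).exp).const_mul ε)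
  refine h2.congr_fderiv ?_
  ext Y
  simp only [smul_apply, ContinuousLinearMap.comp_apply, innerSL_apply_apply, smul_eq_mul,
    nsmul_eq_mul, ContinuousLinearMap.id_apply, Nat.cast_ofNat]
  ring

theorem fderiv_expBarrier (ε a : ℝ) (c p Y : W) :
    fderiv ℝ (fun p : W => ε * Real.exp (-a * ‖p - c‖ ^ 2)) p Y =
      ε * Real.exp (-a * ‖p - c‖ ^ 2) * (-2 * a) * inner ℝ (p - c) Y := by
  rw [(hasFDerivAt_expBarrier ε a c p).fderiv]
  simp only [smul_apply, innerSL_apply_apply, smul_eq_mul]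

theorem fderiv_fderiv_expBarrier (ε a : ℝ) (c p Y : W) :
    fderiv ℝ (fderiv ℝ fun p : W => ε * Real.exp (-a * ‖p - c‖ ^ 2)) p Y Y =
      ε * Real.exp (-a * ‖p - c‖ ^ 2) * (4 * a ^ 2 * inner ℝ (p - c) Y ^ 2 - 2 * a * ‖Y‖ ^ 2) := by
  have h0 : DifferentiableAt ℝ (fderiv ℝ fun p : W => ε * Real.exp (-a * ‖p - c‖ ^ 2)) p :=
    ((contDiff_expBarrier ε a c).fderiv_right (m := ∞) (by simp)).differentiable
      (by simp) p
  have h3 := fderiv_clm_apply h0 (differentiableAt_const Y)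
  have h4 := congrArg (fun L : W →L[ℝ] ℝ => L Y) h3
  simp only [fderiv_fun_const, Pi.zero_apply, ContinuousLinearMap.comp_zero, zero_add,
    ContinuousLinearMap.flip_apply] at h4
  rw [← h4]
  simp only [fderiv_expBarrier]
  have h1 := (hasFDerivAt_expBarrier ε a c p).mul_const (-2 * a)
  have h2 : HasFDerivAt (fun q : W => inner ℝ (q - c) Y) (innerSL ℝ Y) p := by
    have : HasFDerivAt (fun q : W => inner ℝ Y (q - c)) ((innerSL ℝ Y).comp
        (ContinuousLinearMap.id ℝ W)) p :=
      (innerSL ℝ Y).hasFDerivAt.comp p ((hasFDerivAt_id p).sub_const c)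
    refine (this.congr_of_eventuallyEq (.of_forall fun q => real_inner_comm _ _)).congr_fderiv ?_
    ext; simp
  rw [(h1.fun_mul h2).fderiv]
  simp only [add_apply, smul_apply, innerSL_apply_apply, smul_eq_mul, real_inner_self_eq_norm_sq]
  ring

variable [FiniteDimensional ℝ W]

/-- The Hopf-type boundary lemma in Bony's maximum principle: at a zero of `u` touched by an
exterior ball, the vector field is tangent to the ball. -/
theorem inner_eq_zero_of_exterior_ball {u : W → ℝ} {X : W → W} {p₀ c : W} {ρ K r : ℝ} (hρ : 0 < ρ)
    (hK : 0 ≤ K) (hr : 0 < r) (hX : ContinuousAt X p₀) (hu : ContinuousOn u (Metric.closedBall p₀ ρ))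
    (hu0 : ∀ p ∈ Metric.closedBall p₀ ρ, 0 ≤ u p) (hp₀ : u p₀ = 0) (hc : p₀ ≠ c)
    (hball : ∀ p ∈ Metric.closedBall p₀ ρ, ‖p - c‖ ≤ ‖p₀ - c‖ → p ≠ p₀ → 0 < u p)
    (H : ∀ᶠ p in nhds p₀, ∀ ψ : W → ℝ, ContDiff ℝ ∞ ψ → IsLocalMin (fun q => u q - ψ q) p →
      ∀ lam ∈ Set.Ico 0 r, (∀ Y, -lam * ‖Y‖ ^ 2 ≤ fderiv ℝ (fderiv ℝ ψ) p Y Y) →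
      fderiv ℝ (fderiv ℝ ψ) p (X p) (X p) ≤ K * (lam + ‖fderiv ℝ ψ p‖)) :
    inner ℝ (p₀ - c) (X p₀) = 0 := by
  by_contra hne
  set σ : ℝ := inner ℝ (p₀ - c) (X p₀) ^ 2 with hσ
  have hσ0 : 0 < σ := by positivity
  set R := ‖p₀ - c‖ with hR
  have hR0 : 0 < R := norm_pos_iff.2 (sub_ne_zero.2 hc)
  set M := ‖X p₀‖ + 1 with hM
  have hinner : ContinuousAt (fun p => inner ℝ (p - c) (X p) ^ 2) p₀ :=
    ((ContinuousAt.inner (𝕜 := ℝ) (f := fun p => p - c)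
      (continuousAt_id.sub continuousAt_const) hX).pow 2)
  have e1 : ∀ᶠ p in nhds p₀, σ / 4 < inner ℝ (p - c) (X p) ^ 2 :=
    hinner.eventually (lt_mem_nhds (show σ / 4 < inner ℝ (p₀ - c) (X p₀) ^ 2 by rw [← hσ]; linarith))
  have e2 : ∀ᶠ p in nhds p₀, ‖X p‖ < M :=
    hX.norm.eventually (gt_mem_nhds (show ‖X p₀‖ < M by rw [hM]; linarith))
  obtain ⟨δ', hδ', hball'⟩ := Metric.eventually_nhds_iff_ball.1 (e1.and (e2.and H))
  set δ := min (δ' / 2) (min ρ R) with hδ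
  have hδ0 : 0 < δ := by positivity
  have hδ1 : δ < δ' := (min_le_left _ _).trans_lt (by linarith)
  have hδρ : δ ≤ ρ := (min_le_right _ _).trans (min_le_left _ _)
  have hδR : δ ≤ R := (min_le_right _ _).trans (min_le_right _ _)
  -- The steepness of the barrier. At the minimum, with E the value of the barrier there, its
  -- Hessian along X is at least E (a² σ − 2 a M²), whereas the hypothesis allows at most K E a (2 +
  -- 4 R); this choice of a makes the two incompatible.
  set a : ℝ := (2 * M ^ 2 + K * (2 + 4 * R)) / σ + 1 with ha
  have ha0 : 0 < a := by positivity
  have haσ : 2 * M ^ 2 + K * (2 + 4 * R) < a * σ := by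
    rw [ha, add_mul, div_mul_cancel₀ _ hσ0.ne']; linarith
  -- a positive lower bound for `u` on the part of the small sphere inside the touching ball
  obtain ⟨η, hη0, hη⟩ : ∃ η > 0, ∀ p ∈ Metric.sphere p₀ δ, ‖p - c‖ ≤ R → η ≤ u p := by
    have hcomp : IsCompact (Metric.sphere p₀ δ ∩ Metric.closedBall c R) :=
      (isCompact_sphere p₀ δ).inter_right Metric.isClosed_closedBall
    rcases (Metric.sphere p₀ δ ∩ Metric.closedBall c R).eq_empty_or_nonempty with hemp | hnon
    · refine ⟨1, one_pos, fun p hp hpR => ?_⟩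
      have : p ∈ Metric.sphere p₀ δ ∩ Metric.closedBall c R := ⟨hp, by simpa [dist_eq_norm] using hpR⟩
      rw [hemp] at this
      exact this.elim
    · have hsub : Metric.sphere p₀ δ ∩ Metric.closedBall c R ⊆ Metric.closedBall p₀ ρ :=
        fun p hp => Metric.closedBall_subset_closedBall hδρ (Metric.sphere_subset_closedBall hp.1)
      obtain ⟨q, hq, hqmin⟩ := hcomp.exists_isMinOn hnon (hu.mono hsub)
      have hqp : q ≠ p₀ := by
        rintro rfl
        have := hq.1
        simp at this
        linarith
      refine ⟨u q, hball q (hsub hq) (by simpa [dist_eq_norm] using hq.2) hqp, fun p hp hpR => ?_⟩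
      exact hqmin ⟨hp, by simpa [dist_eq_norm] using hpR⟩
  -- The first bound keeps the barrier below u on the part of the small sphere inside the touching
  -- ball. The second keeps 2 a E, the constant in the lower Hessian bound of the barrier, below r.
  set ε : ℝ := min (η / 2) (r / (4 * a)) with hε
  have hε0 : 0 < ε := by positivity
  have hεη : ε < η := (min_le_left _ _).trans_lt (by linarith)
  have hεr : 2 * a * ε < r := by
    have h1 : ε ≤ r / (4 * a) := min_le_right _ _
    rw [le_div_iff₀ (by positivity)] at h1
    nlinarith
  set ψ : W → ℝ := fun p => ε * Real.exp (-a * ‖p - c‖ ^ 2) with hψ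
  have hψs : ContDiff ℝ ∞ ψ := contDiff_expBarrier ε a c
  have hexp : ∀ p : W, Real.exp (-a * ‖p - c‖ ^ 2) ≤ 1 := by
    intro p
    rw [Real.exp_le_one_iff]
    have : 0 ≤ a * ‖p - c‖ ^ 2 := by positivity
    linarith
  have hcont : ContinuousOn (fun p => u p - ψ p) (Metric.closedBall p₀ δ) :=
    (hu.mono (Metric.closedBall_subset_closedBall hδρ)).sub hψs.continuous.continuousOn
  obtain ⟨p, hp, hpmin⟩ := (isCompact_closedBall p₀ δ).exists_isMinOn
    ⟨p₀, Metric.mem_closedBall_self hδ0.le⟩ hcont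
  have hple : u p - ψ p ≤ -ψ p₀ := by
    have := hpmin (Metric.mem_closedBall_self hδ0.le)
    simpa [hp₀] using this
  -- On the small sphere u − ψ is larger than its value −ψ(p₀) at p₀: inside the touching ball
  -- because u ≥ η > ε ≥ ψ, outside because ψ decreases with the distance to c and u ≥ 0.
  have hpint : p ∈ Metric.ball p₀ δ := by
    by_contra hout
    have hsph : p ∈ Metric.sphere p₀ δ := by
      rw [Metric.mem_sphere]
      exact le_antisymm hp (not_lt.1 hout)
    have hψ0 : 0 < ψ p₀ := by simp only [hψ]; positivity
    by_cases hpR : ‖p - c‖ ≤ R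
    · have h1 := hη p hsph hpR
      have h2 : ψ p ≤ ε := by
        simp only [hψ]
        exact mul_le_of_le_one_right hε0.le (hexp p)
      linarith
    · have h1 := hu0 p (Metric.closedBall_subset_closedBall hδρ hp)
      have h2 : ψ p < ψ p₀ := by
        simp only [hψ]
        refine mul_lt_mul_of_pos_left (Real.exp_lt_exp.2 ?_) hε0
        rw [← hR]
        have : R ^ 2 < ‖p - c‖ ^ 2 := pow_lt_pow_left₀ (not_le.1 hpR) hR0.le two_ne_zero
        nlinarith
      linarith
  have hloc : IsLocalMin (fun q => u q - ψ q) p :=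
    hpmin.isLocalMin (Filter.mem_of_superset (Metric.isOpen_ball.mem_nhds hpint)
      Metric.ball_subset_closedBall)
  obtain ⟨b1, b2, b3⟩ := hball' p (Metric.ball_subset_ball hδ1.le hpint)
  set E : ℝ := ε * Real.exp (-a * ‖p - c‖ ^ 2) with hE
  have hE0 : 0 < E := by positivity
  have hEε : E ≤ ε := mul_le_of_le_one_right hε0.le (hexp p)
  have hD2 : ∀ Y, fderiv ℝ (fderiv ℝ ψ) p Y Y =
      E * (4 * a ^ 2 * inner ℝ (p - c) Y ^ 2 - 2 * a * ‖Y‖ ^ 2) :=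
    fun Y => fderiv_fderiv_expBarrier ε a c p Y
  have hpc : ‖p - c‖ ≤ 2 * R := by
    have h1 : ‖p - c‖ ≤ ‖p - p₀‖ + ‖p₀ - c‖ := norm_sub_le_norm_sub_add_norm_sub _ _ _
    have h2 : ‖p - p₀‖ < δ := by simpa [dist_eq_norm] using hpint
    linarith
  have hD1 : ‖fderiv ℝ ψ p‖ ≤ E * (2 * a) * (2 * R) := by
    have : fderiv ℝ ψ p = (E * (-2 * a)) • innerSL ℝ (p - c) :=
      (hasFDerivAt_expBarrier ε a c p).fderiv
    rw [this, norm_smul, innerSL_apply_norm, Real.norm_eq_abs]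
    have h1 : |E * (-2 * a)| = E * (2 * a) := by
      rw [show E * (-2 * a) = -(E * (2 * a)) by ring, abs_neg, abs_of_pos (by positivity)]
    rw [h1]
    gcongr
  have hfin := b3 ψ hψs hloc (2 * a * E) ⟨by positivity, by nlinarith⟩ (by
    intro Y
    rw [hD2]
    have : 0 ≤ E * (4 * a ^ 2 * inner ℝ (p - c) Y ^ 2) := by positivity
    linarith)
  rw [hD2] at hfin
  have h1 : E * (a ^ 2 * σ - 2 * a * M ^ 2) ≤
      E * (4 * a ^ 2 * inner ℝ (p - c) (X p) ^ 2 - 2 * a * ‖X p‖ ^ 2) := by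
    refine mul_le_mul_of_nonneg_left ?_ hE0.le
    have h2 : ‖X p‖ ^ 2 ≤ M ^ 2 := pow_le_pow_left₀ (norm_nonneg _) b2.le 2
    have h3 : 4 * a ^ 2 * (σ / 4) ≤ 4 * a ^ 2 * inner ℝ (p - c) (X p) ^ 2 :=
      mul_le_mul_of_nonneg_left b1.le (by positivity)
    have h4 : 2 * a * ‖X p‖ ^ 2 ≤ 2 * a * M ^ 2 := mul_le_mul_of_nonneg_left h2 (by positivity)
    linarith
  have h5 : K * (2 * a * E + ‖fderiv ℝ ψ p‖) ≤ K * (2 * a * E + E * (2 * a) * (2 * R)) :=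
    mul_le_mul_of_nonneg_left (by linarith) hK
  have h6 : (E * a) * (a * σ) ≤ (E * a) * (2 * M ^ 2 + K * (2 + 4 * R)) := by
    nlinarith [h1.trans (hfin.trans h5)]
  have h7 := le_of_mul_le_mul_left h6 (by positivity)
  linarith

/-- Invariance of the zero set under a vector field that is tangent to it, in the sense of exterior
balls. -/
theorem zero_along_curve {u : W → ℝ} {σ : ℝ → W} {Y : ℝ → W → W} {ρ T L : ℝ} (hρ : 0 < ρ)
    (hu : ContinuousOn u (Metric.closedBall (σ 0) ρ))
    (hu0 : ∀ p ∈ Metric.closedBall (σ 0) ρ, 0 ≤ u p) (hσc : ContinuousOn σ (Set.Icc 0 T))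
    (hσd : ∀ s ∈ Set.Ico 0 T, HasDerivWithinAt σ (Y s (σ s)) (Set.Ici s) s)
    (hσm : ∀ s ∈ Set.Icc 0 T, σ s ∈ Metric.closedBall (σ 0) (ρ / 8))
    (hY : ∀ s ∈ Set.Ico 0 T, ∀ p ∈ Metric.closedBall (σ 0) ρ, ∀ q ∈ Metric.closedBall (σ 0) ρ,
      ‖Y s p - Y s q‖ ≤ L * ‖p - q‖)
    (horth : ∀ s ∈ Set.Ico 0 T, ∀ q ∈ Metric.closedBall (σ 0) (ρ / 2), u q = 0 → ∀ c, q ≠ c →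
      ‖q - c‖ ≤ ρ / 8 → (∀ p, ‖p - c‖ ≤ ‖q - c‖ → p ≠ q → 0 < u p) →
      inner ℝ (q - c) (Y s q) = 0)
    (h0 : u (σ 0) = 0) : ∀ s ∈ Set.Icc 0 T, u (σ s) = 0 := by
  set F : Set W := {q ∈ Metric.closedBall (σ 0) (ρ / 2) | u q = 0} with hF
  have hFcl : IsClosed F := by
    have h1 : ContinuousOn u (Metric.closedBall (σ 0) (ρ / 2)) :=
      hu.mono (Metric.closedBall_subset_closedBall (by linarith))
    exact h1.preimage_isClosed_of_isClosed Metric.isClosed_closedBall (isClosed_singleton (x := 0))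
  have hF0 : σ 0 ∈ F := ⟨Metric.mem_closedBall_self (by positivity), h0⟩
  -- The squared distance to the zero set vanishes at time 0. It need not be differentiable, so
  -- Grönwall's inequality is used in the form that asks only for bounds on right difference
  -- quotients.
  set f : ℝ → ℝ := fun s => Metric.infDist (σ s) F ^ 2 with hf
  have hfc : ContinuousOn f (Set.Icc 0 T) :=
    ((Metric.continuous_infDist_pt F).comp_continuousOn hσc).pow 2
  have key : ∀ s ∈ Set.Ico 0 T, ∀ b : ℝ, 2 * L * f s < b →
      ∃ᶠ z in nhdsWithin s (Set.Ioi s), (z - s)⁻¹ * (f z - f s) < b := by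
    intro s hs b hb
    have hsI : s ∈ Set.Icc 0 T := ⟨hs.1, hs.2.le⟩
    obtain ⟨q, hqF, hqd⟩ := hFcl.exists_infDist_eq_dist ⟨_, hF0⟩ (σ s)
    have hd8 : dist (σ s) q ≤ ρ / 8 := by
      rw [← hqd]
      exact (Metric.infDist_le_dist_of_mem hF0).trans (hσm s hsI)
    have hort : inner ℝ (σ s - q) (Y s q) = 0 := by
      by_cases hsq : σ s = q
      · simp [hsq]
      -- The ball about σ s through its nearest point q may meet F in other points as well. The ball
      -- about the midpoint, through q and σ s, meets F only in q, by the parallelogram law, so that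
      -- it is a strict exterior ball.
      set c : W := (1 / 2 : ℝ) • (σ s + q) with hc
      have hqc : q - c = -((1 / 2 : ℝ) • (σ s - q)) := by rw [hc]; module
      have hsc : σ s - c = (1 / 2 : ℝ) • (σ s - q) := by rw [hc]; module
      have hnqc : ‖q - c‖ = ‖σ s - q‖ / 2 := by
        rw [hqc, norm_neg, norm_smul]; norm_num; ring
      have hnsc : ‖σ s - c‖ = ‖σ s - q‖ / 2 := by
        rw [hsc, norm_smul]; norm_num; ring
      have hpos : 0 < ‖σ s - q‖ := norm_pos_iff.2 (sub_ne_zero.2 hsq)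
      rw [dist_eq_norm] at hd8
      have hσs : ‖σ s - σ 0‖ ≤ ρ / 8 := by simpa [dist_eq_norm] using hσm s hsI
      have := horth s hs q hqF.1 hqF.2 c
        (fun h => by rw [← h] at hnqc; simp at hnqc; linarith) (by rw [hnqc]; linarith) ?_
      · rw [hqc, inner_neg_left, inner_smul_left] at this
        simpa using this
      intro p hp hpq
      have hps : ‖p - σ 0‖ ≤ ρ / 2 := by
        have h1 : ‖p - σ 0‖ ≤ ‖p - c‖ + ‖c - σ s‖ + ‖σ s - σ 0‖ := by
          have e : p - σ 0 = (p - c) + (c - σ s) + (σ s - σ 0) := by abel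
          rw [e]
          exact norm_add₃_le
        rw [norm_sub_rev c] at h1
        rw [hnqc] at hp
        linarith
      have hpb : p ∈ Metric.closedBall (σ 0) (ρ / 2) := by simpa [dist_eq_norm] using hps
      refine lt_of_le_of_ne (hu0 p (Metric.closedBall_subset_closedBall (by linarith) hpb)) ?_
      intro hup
      have hpF : p ∈ F := ⟨hpb, hup.symm⟩
      have hdp : ‖σ s - q‖ ≤ ‖σ s - p‖ := by
        rw [← dist_eq_norm, ← dist_eq_norm, ← hqd]
        exact Metric.infDist_le_dist_of_mem hpF
      have hpar := parallelogram_law_with_norm ℝ (σ s - c) (p - c)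
      have e1 : σ s - c - (p - c) = σ s - p := by abel
      rw [e1, hnsc] at hpar
      rw [hnqc] at hp
      have hz : ‖σ s - c + (p - c)‖ = 0 := by
        nlinarith [norm_nonneg (σ s - c + (p - c)), norm_nonneg (p - c)]
      have hz' := norm_eq_zero.1 hz
      apply hpq
      have : p = c - (σ s - c) := by
        rw [eq_sub_iff_add_eq, ← sub_eq_zero]
        rw [← hz']; abel
      rw [this, hsc, hc]; module
    -- With q frozen, this function bounds f from above and agrees with it at s, so its derivative
    -- controls the difference quotients of f.
    have hder : HasDerivWithinAt (fun z => ‖σ z - q‖ ^ 2) (2 * inner ℝ (σ s - q) (Y s (σ s)))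
        (Set.Ici s) s := ((hσd s hs).sub_const q).norm_sq
    have hsl := (hasDerivWithinAt_iff_tendsto_slope' (by simp : s ∉ Set.Ioi s)).1
      (hder.mono Set.Ioi_subset_Ici_self)
    have hfs : f s = ‖σ s - q‖ ^ 2 := by
      simp only [hf]; rw [hqd, dist_eq_norm]
    have hqρ : q ∈ Metric.closedBall (σ 0) ρ :=
      Metric.closedBall_subset_closedBall (by linarith) hqF.1
    have hsρ : σ s ∈ Metric.closedBall (σ 0) ρ :=
      Metric.closedBall_subset_closedBall (by linarith) (hσm s hsI)
    have hle : 2 * inner ℝ (σ s - q) (Y s (σ s)) ≤ 2 * L * f s := by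
      -- Tangency at q makes the subtracted term vanish. The Lipschitz bound then yields L ‖σ s −
      -- q‖² instead of a first power of the distance.
      have h1 : inner ℝ (σ s - q) (Y s (σ s)) = inner ℝ (σ s - q) (Y s (σ s) - Y s q) := by
        rw [inner_sub_right, hort, sub_zero]
      rw [h1, hfs]
      have h2 := real_inner_le_norm (σ s - q) (Y s (σ s) - Y s q)
      have h3 := mul_le_mul_of_nonneg_left (hY s hs _ hsρ _ hqρ) (norm_nonneg (σ s - q))
      nlinarith
    have hev := hsl.eventually (gt_mem_nhds (hle.trans_lt hb))
    refine Filter.Eventually.frequently ?_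
    filter_upwards [hev, self_mem_nhdsWithin] with z hz hzs
    refine lt_of_le_of_lt ?_ hz
    rw [slope_def_field, inv_mul_eq_div, hfs]
    have hzs' : 0 < z - s := sub_pos.2 hzs
    refine div_le_div_of_nonneg_right (sub_le_sub_right ?_ _) hzs'.le
    simp only [hf]
    rw [← dist_eq_norm]
    exact pow_le_pow_left₀ Metric.infDist_nonneg (Metric.infDist_le_dist_of_mem hqF) 2
  have hgr := le_gronwallBound_of_liminf_deriv_right_le (f := f) (f' := fun s => 2 * L * f s)
    (δ := 0) (K := 2 * L) (ε := 0) hfc key (by simp [hf, Metric.infDist_zero_of_mem hF0])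
    (fun s _ => by simp)
  intro s hs
  have h1 := hgr s hs
  rw [gronwallBound_ε0_δ0] at h1
  have h2 : Metric.infDist (σ s) F = 0 := by
    have : f s = 0 := le_antisymm h1 (by positivity)
    simpa [hf] using this
  exact ((hFcl.mem_iff_infDist_zero ⟨_, hF0⟩).2 h2).2

end Bony

/-! ### Propagation of zeros of the curvature along the twisted fields -/

namespace MetricFlow
variable {n : ℕ} {τ : ℝ} {O : Set (Cn n)} {G H : ℝ → Cn n → Matrix (Fin n) (Fin n) ℂ}

theorem smoothOn_twistField (h : MetricFlow τ O G H) (θ : Fin n → ℂ) :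
    ContDiffOn ℝ ∞ (fun q : ℝ × ((Cn n × Cn n) × Cn n) => twistField (H q.1) θ q.2)
      (Set.Ico 0 τ ×ˢ dom O) := by
  have hx : ContDiff ℝ ∞ fun q : ℝ × ((Cn n × Cn n) × Cn n) => (q.1, q.2.1.1) := by fun_prop
  have hmaps : Set.MapsTo (fun q : ℝ × ((Cn n × Cn n) × Cn n) => (q.1, q.2.1.1))
      (Set.Ico 0 τ ×ˢ dom O) (Set.Ico 0 τ ×ˢ O) := fun q hq => ⟨hq.1, hq.2.1.1⟩
  have hα : ∀ a, ContDiffOn ℝ ∞ (fun q : ℝ × ((Cn n × Cn n) × Cn n) => q.2.1.2 a)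
      (Set.Ico 0 τ ×ˢ dom O) := fun a => by fun_prop
  have hξ : ∀ a, ContDiffOn ℝ ∞ (fun q : ℝ × ((Cn n × Cn n) × Cn n) => q.2.2 a)
      (Set.Ico 0 τ ×ˢ dom O) := fun a => by fun_prop
  have hF : ∀ {F : ℝ → Cn n → ℂ}, SmoothFamily (Set.Ico 0 τ) O F →
      ContDiffOn ℝ ∞ (fun q : ℝ × ((Cn n × Cn n) × Cn n) => F q.1 q.2.1.1)
        (Set.Ico 0 τ ×ˢ dom O) := fun hF => ContDiffOn.comp hF hx.contDiffOn hmaps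
  have hw : ∀ {F : ℝ → Cn n → ℂ}, SmoothFamily (Set.Ico 0 τ) O F →
      ContDiffOn ℝ ∞ (fun q : ℝ × ((Cn n × Cn n) × Cn n) => wd q.2.2 (F q.1) q.2.1.1)
        (Set.Ico 0 τ ×ˢ dom O) := by
    intro F hF'
    have e : ∀ q : ℝ × ((Cn n × Cn n) × Cn n), wd q.2.2 (F q.1) q.2.1.1 =
        ∑ m, q.2.2 m * wd (stdE m) (F q.1) q.2.1.1 := by
      intro q
      conv_lhs => rw [eq_sum_stdE q.2.2]
      exact wd_sum_dir _ _ _ _ _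
    simp only [e]
    exact ContDiffOn.sum fun m _ => (hξ m).mul (hF (hF'.wd (uniqueDiffOn_Ico τ) h.isOpen (stdE m)))
  unfold twistField
  refine ContDiffOn.prodMk (ContDiffOn.prodMk ?_ ?_) ?_ <;>
    refine (contDiffOn_piLp 2).2 fun m => ?_ <;> dsimp only
  · exact ContDiffOn.sum fun r _ => contDiffOn_const.mul (hF (h.smooth r m))
  · exact (ContDiffOn.sum fun r _ => contDiffOn_const.mul (ContDiffOn.sum fun a _ =>
      (hα a).mul (hF ((h.smooth r a).wd (uniqueDiffOn_Ico τ) h.isOpen (stdE m))))).neg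
  · exact ContDiffOn.sum fun r _ => contDiffOn_const.mul (hw (h.smooth r m))

/-- Conjugate-linearity in θ: finitely many smooth fields generate all others, which gives a
Lipschitz constant uniform over bounded controls. -/
theorem twistField_eq_sum (H : Cn n → Matrix (Fin n) (Fin n) ℂ) (θ : Fin n → ℂ)
    (y : (Cn n × Cn n) × Cn n) :
    twistField H θ y = ∑ r, starRingEnd ℂ (θ r) • twistField H (Pi.single r 1) y := by
  have e : ∀ (r : Fin n) (c : Fin n → ℂ),
      ∑ r', conj ((Pi.single r 1 : Fin n → ℂ) r') * c r' = c r := by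
    intro r c
    rw [Finset.sum_eq_single r] <;> simp +contextual
  simp only [twistField, e]
  ext m <;> simp [Prod.fst_sum, Prod.snd_sum, Finset.sum_neg_distrib]

/-- Used with c = −1, to run an integral curve backwards by negating its control. -/
theorem twistField_smul (H : Cn n → Matrix (Fin n) (Fin n) ℂ) (c : ℝ) (θ : Fin n → ℂ)
    (y : (Cn n × Cn n) × Cn n) : twistField H (c • θ) y = c • twistField H θ y := by
  rw [twistField_eq_sum H θ, twistField_eq_sum, Finset.smul_sum]
  refine Finset.sum_congr rfl fun r _ => ?_
  simp only [Pi.smul_apply, Complex.real_smul, map_mul, Complex.conj_ofReal]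
  rw [mul_smul]
  exact Complex.coe_smul _ _

section Bony
variable {W : Type*} [NormedAddCommGroup W] [InnerProductSpace ℝ W] [FiniteDimensional ℝ W]
  (e : (ℝ × ((Cn n × Cn n) × Cn n)) ≃L[ℝ] W)

/-- The curvature term as a function on space-time, read in `W`. -/
def griffIn (G H : ℝ → Cn n → Matrix (Fin n) (Fin n) ℂ) (w : W) : ℝ :=
  (griff (G (e.symm w).1) (H (e.symm w).1) (e.symm w).2).re

/-- The field `twistField` on space-time, read in `W`. -/
def twistIn (H : ℝ → Cn n → Matrix (Fin n) (Fin n) ℂ) (θ : Fin n → ℂ) (w : W) : W :=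
  e (0, twistField (H (e.symm w).1) θ (e.symm w).2)

theorem smoothOn_twistIn (h : MetricFlow τ O G H) (θ : Fin n → ℂ) :
    ContDiffOn ℝ ∞ (twistIn e H θ) (e.symm ⁻¹' (Set.Ico 0 τ ×ˢ dom O)) :=
  e.contDiff.comp_contDiffOn (contDiffOn_const.prodMk
    ((h.smoothOn_twistField θ).comp e.symm.contDiff.contDiffOn fun _ hq => hq))

theorem continuousOn_griffIn (h : MetricFlow τ O G H) :
    ContinuousOn (griffIn e G H) (e.symm ⁻¹' (Set.Ico 0 τ ×ˢ dom O)) :=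
  Complex.continuous_re.comp_continuousOn
    (h.continuousOn_griff.comp e.symm.continuous.continuousOn fun _ hq => hq)

theorem mem_nhds_dom (h : MetricFlow τ O G H) {p : ℝ × ((Cn n × Cn n) × Cn n)}
    (hp : p ∈ Set.Ioo 0 τ ×ˢ dom O) : Set.Ico 0 τ ×ˢ dom O ∈ nhds p :=
  Filter.mem_of_superset ((isOpen_Ioo.prod h.isOpen_dom).mem_nhds hp)
    (Set.prod_mono Set.Ioo_subset_Ico_self subset_rfl)

/-- The zero set of the curvature term is tangent to `twistField` in the sense of exterior balls. -/
theorem inner_twistIn_eq_zero (h : MetricFlow τ O G H) (θ : Fin n → ℂ) {p₀ c : W}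
    (hp₀ : e.symm p₀ ∈ Set.Ioo 0 τ ×ˢ dom O) {ρ : ℝ} (hρ : 0 < ρ)
    (hsub : ∀ w ∈ Metric.closedBall p₀ ρ, e.symm w ∈ Set.Ioo 0 τ ×ˢ dom O)
    (hnn : ∀ w ∈ Metric.closedBall p₀ ρ, 0 ≤ griffIn e G H w) (h0 : griffIn e G H p₀ = 0)
    (hc : p₀ ≠ c) (hball : ∀ p ∈ Metric.closedBall p₀ ρ, ‖p - c‖ ≤ ‖p₀ - c‖ → p ≠ p₀ →
      0 < griffIn e G H p) : inner ℝ (p₀ - c) (twistIn e H θ p₀) = 0 := by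
  have hnhds := h.mem_nhds_dom hp₀
  have hpre : e.symm ⁻¹' (Set.Ico 0 τ ×ˢ dom O) ∈ nhds p₀ :=
    e.symm.continuous.continuousAt hnhds
  obtain ⟨K, hK, r, hr, hev⟩ := h.exists_touching_bounds θ (t₀ := (e.symm p₀).1)
    (y₀ := (e.symm p₀).2) (Set.Ioo_subset_Ico_self hp₀.1) hp₀.2.1.1
  rw [Prod.mk.eta, nhdsWithin_eq_nhds.2 hnhds] at hev
  set A : (ℝ × ((Cn n × Cn n) × Cn n)) →L[ℝ] W := e.toContinuousLinearMap with hA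
  set a : ℝ := ‖A‖ with ha
  have ha0 : 0 ≤ a := norm_nonneg A
  have hAle : ∀ q, ‖e q‖ ≤ a * ‖q‖ := fun q => A.le_opNorm q
  -- local bounds of the coefficients
  have hNcont : ContinuousAt (fun q : ℝ × ((Cn n × Cn n) × Cn n) =>
      (∑ a, ∑ b, θ a * conj (θ b) * H q.1 q.2.1.1 b a).re) (e.symm p₀) := by
    have : ContinuousOn (fun q : ℝ × ((Cn n × Cn n) × Cn n) =>
        ∑ a, ∑ b, θ a * conj (θ b) * H q.1 q.2.1.1 b a) (Set.Ico 0 τ ×ˢ dom O) :=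
      continuousOn_finsetSum _ fun a _ => continuousOn_finsetSum _ fun b _ =>
        continuousOn_const.mul (continuousOn_entry (h.smooth b a))
    exact (Complex.continuous_re.comp_continuousOn this).continuousAt hnhds
  have hMcont : ContinuousAt (fun q : ℝ × ((Cn n × Cn n) × Cn n) => twistField (H q.1) θ q.2)
      (e.symm p₀) := (h.smoothOn_twistField θ).continuousOn.continuousAt hnhds
  obtain ⟨N, hN⟩ : ∃ N : ℝ, ∀ᶠ q : ℝ × ((Cn n × Cn n) × Cn n) in nhds (e.symm p₀),
      |(∑ a, ∑ b, θ a * conj (θ b) * H q.1 q.2.1.1 b a).re| < N :=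
    ⟨_, hNcont.abs.eventually (gt_mem_nhds (lt_add_one _))⟩
  obtain ⟨M, hM⟩ : ∃ M : ℝ, ∀ᶠ q : ℝ × ((Cn n × Cn n) × Cn n) in nhds (e.symm p₀),
      ‖twistField (H q.1) θ q.2‖ < M :=
    ⟨_, hMcont.norm.eventually (gt_mem_nhds (lt_add_one _))⟩
  have hN0 : 0 ≤ N := (abs_nonneg _).trans hN.self_of_nhds.le
  have hone : ‖((1 : ℝ), (0 : (Cn n × Cn n) × Cn n))‖ = 1 := by simp [Prod.norm_def]
  have hev2 : ∀ᶠ w in nhds p₀, _ := e.symm.continuous.continuousAt.eventually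
    (hev.and (hN.and (hM.and ((isOpen_Ioo.prod h.isOpen_dom).mem_nhds hp₀))))
  -- The Levi form controls only the sum of the second derivatives along X and iX. The iX term is
  -- bounded below by the lower Hessian bound of the test function, which accounts for M² a². The
  -- time derivative is at most a times the norm of the differential and is multiplied by |θ|² ≤ N,
  -- which accounts for 8 N a.
  refine inner_eq_zero_of_exterior_ball (u := griffIn e G H) (ρ := ρ)
    (K := (4 * K + M ^ 2) * a ^ 2 + 8 * N * a) (r := r / (a ^ 2 + 1)) hρ (by positivity)
    (by positivity) ((h.smoothOn_twistIn e θ).continuousOn.continuousAt hpre)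
    ((h.continuousOn_griffIn e).mono fun w hw =>
      Set.prod_mono Set.Ioo_subset_Ico_self subset_rfl (hsub w hw)) hnn h0 hc hball ?_
  filter_upwards [hev2] with p hp ψ hψ hmin lam hlam hlow
  obtain ⟨h1, h2, h3, h4⟩ := hp
  set t := (e.symm p).1 with ht
  set y := (e.symm p).2 with hy
  have hety : e (t, y) = p := by rw [ht, hy, Prod.mk.eta, e.apply_symm_apply]
  let π : ((Cn n × Cn n) × Cn n) →L[ℝ] W := A.comp (ContinuousLinearMap.inr ℝ ℝ _)
  have hπ : ∀ Y, π Y = e (0, Y) := fun _ => rfl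
  -- the test function at fixed time
  set ψ₂ : (Cn n × Cn n) × Cn n → ℝ := fun y' => ψ (e (t, y')) with hψ₂
  have hψ2' : ∀ y', e (t, y') = π y' + e (t, 0) := by
    intro y'
    rw [hπ, ← map_add]; simp
  have hD2 : ∀ Y, fderiv ℝ (fderiv ℝ ψ₂) y Y Y = fderiv ℝ (fderiv ℝ ψ) p (π Y) (π Y) := by
    intro Y
    have hs : ContDiff ℝ ∞ fun w => ψ (w + e (t, 0)) := hψ.comp (contDiff_id.add contDiff_const)
    have e1 : ψ₂ = fun y' => (fun w => ψ (w + e (t, 0))) (π y') := by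
      funext y'; simp only [hψ₂]; rw [hψ2' y']
    rw [e1, fderiv_fderiv_comp_clm π (hs.contDiffAt.of_le two_le_infty),
      ← deriv_deriv_line (hs.contDiffAt.of_le two_le_infty),
      ← deriv_deriv_line (hψ.contDiffAt.of_le two_le_infty)]
    congr 2
    funext s
    rw [← hety, hψ2' y]
    congr 1
    abel
  have hgr : ∀ s y', griffIn e G H (e (s, y')) = (griff (G s) (H s) y').re := by
    intro s y'
    unfold griffIn
    rw [e.symm_apply_apply]
  have hgrp : griffIn e G H p = (griff (G t) (H t) y).re := by rw [← hgr, hety]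
  have hmin2 : IsLocalMin (fun y' => (griff (G t) (H t) y').re - ψ₂ y') y := by
    have hc2 : Filter.Tendsto (fun y' => e (t, y')) (nhds y) (nhds p) := by
      have : Continuous fun y' : (Cn n × Cn n) × Cn n => e (t, y') := by fun_prop
      rw [← hety]; exact this.tendsto y
    have := hc2.eventually hmin
    filter_upwards [this] with y' hy'
    rw [hgr, hgrp] at hy'
    simp only [hψ₂, hety]
    exact hy'
  have hv : HasDerivAt (fun s => ψ (e (s, y))) (fderiv ℝ ψ p (e (1, 0))) t := by
    have hl : HasDerivAt (fun s : ℝ => e (s, y)) (e (1, 0)) t :=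
      e.hasFDerivAt.comp_hasDerivAt t ((hasDerivAt_id t).prodMk (hasDerivAt_const t y))
    have hd : HasFDerivAt ψ (fderiv ℝ ψ p) (e (t, y)) := by
      rw [hety]; exact (hψ.differentiable (by simp) p).hasFDerivAt
    exact hd.comp_hasDerivAt t hl
  have hpast : ∀ᶠ s in nhdsWithin t (Set.Iio t), (griff (G t) (H t) y).re - ψ (e (t, y)) ≤
      (griff (G s) (H s) y).re - ψ (e (s, y)) := by
    have hc2 : Filter.Tendsto (fun s => e (s, y)) (nhds t) (nhds p) := by
      have : Continuous fun s : ℝ => e (s, y) := by fun_prop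
      rw [← hety]; exact this.tendsto t
    have := hc2.eventually hmin
    filter_upwards [nhdsWithin_le_nhds this] with s hs
    rw [hgr, hgrp] at hs
    rw [hety]
    exact hs
  have hπn : ∀ Y, ‖π Y‖ ≤ a * ‖Y‖ := by
    intro Y
    refine (hAle (0, Y)).trans (le_of_eq ?_)
    simp [Prod.norm_def]
  have hlow2 : ∀ Y, -(lam * a ^ 2) * ‖Y‖ ^ 2 ≤ fderiv ℝ (fderiv ℝ ψ₂) y Y Y := by
    intro Y
    rw [hD2]
    refine le_trans ?_ (hlow (π Y))
    have := pow_le_pow_left₀ (norm_nonneg _) (hπn Y) 2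
    have := mul_le_mul_of_nonneg_left this hlam.1
    rw [mul_pow] at this
    linarith
  have hlam2 : lam * a ^ 2 ∈ Set.Ico 0 r := by
    refine ⟨mul_nonneg hlam.1 (by positivity), ?_⟩
    have := (lt_div_iff₀ (by positivity : 0 < a ^ 2 + 1)).1 hlam.2
    nlinarith [hlam.1]
  obtain ⟨-, hfin⟩ := h1 h4.1.1 ψ₂ ((hψ.comp (by fun_prop : ContDiff ℝ ∞ fun y' => e (t, y'))
    ).contDiffAt.of_le two_le_infty) hmin2 _ _ hv hpast _ hlam2 hlow2
  set X := twistField (H t) θ y with hX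
  have hX' : twistIn e H θ p = π X := rfl
  have hI := hlow2 (Complex.I • X)
  rw [norm_smul, Complex.norm_I, one_mul] at hI
  have hXM : ‖X‖ ^ 2 ≤ M ^ 2 := pow_le_pow_left₀ (norm_nonneg _) h3.le 2
  have hXM' := mul_le_mul_of_nonneg_left hXM hlam2.1
  rw [hX', ← hD2]
  have hv' : |fderiv ℝ ψ p (e (1, 0))| ≤ ‖fderiv ℝ ψ p‖ * a := by
    refine ((fderiv ℝ ψ p).le_opNorm _).trans ?_
    have := hAle (1, 0)
    rw [hone, mul_one] at this
    exact mul_le_mul_of_nonneg_left this (norm_nonneg _)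
  have hprod : (∑ a, ∑ b, θ a * conj (θ b) * H t y.1.1 b a).re * (2 * fderiv ℝ ψ p (e (1, 0))) ≤
      2 * (N * (‖fderiv ℝ ψ p‖ * a)) := by
    have := le_abs_self ((∑ a, ∑ b, θ a * conj (θ b) * H t y.1.1 b a).re *
      (fderiv ℝ ψ p (e (1, 0))))
    rw [abs_mul] at this
    have h5 := mul_le_mul h2.le hv' (abs_nonneg _) hN0
    linarith
  have hfin2 := hfin.trans (add_le_add_left hprod _)
  have h8 : 0 ≤ N * a * lam := by have := hlam.1; positivity
  have h9 : 0 ≤ (4 * K + M ^ 2) * a ^ 2 * ‖fderiv ℝ ψ p‖ := by positivity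
  nlinarith

/-- Bony's invariance in space-time, applied to the curve (t₀, y s) and the field with zero time
component. The neighbourhood depends only on y₀ and the bound B for the controls, not on the curve.
Passing to a Euclidean space provides the inner product that the product norm does not come from. -/
theorem zero_forward (h : MetricFlow τ O G H)
    (hnn : ∀ t ∈ Set.Ico 0 τ, ∀ y : (Cn n × Cn n) × Cn n, y.1.1 ∈ O → 0 ≤ (griff (G t) (H t) y).re)
    {t₀ : ℝ} (ht₀ : t₀ ∈ Set.Ioo 0 τ) {y₀ : (Cn n × Cn n) × Cn n} (hy₀ : y₀.1.1 ∈ O) (B : ℝ) :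
    ∃ U ∈ nhds y₀, ∀ (y : ℝ → (Cn n × Cn n) × Cn n) (θ : ℝ → Fin n → ℂ) (T : ℝ),
      (∀ s ∈ Set.Icc 0 T, y s ∈ U) → (∀ s ∈ Set.Icc 0 T, ∀ r, ‖θ s r‖ ≤ B) →
      (∀ s ∈ Set.Icc 0 T, HasDerivWithinAt y (twistField (H t₀) (θ s) (y s)) (Set.Icc 0 T) s) →
      (griff (G t₀) (H t₀) (y 0)).re = 0 →
      ∀ s ∈ Set.Icc 0 T, (griff (G t₀) (H t₀) (y s)).re = 0 := by
  let e : (ℝ × ((Cn n × Cn n) × Cn n)) ≃L[ℝ]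
    EuclideanSpace ℝ (Fin (Module.finrank ℝ (ℝ × ((Cn n × Cn n) × Cn n)))) := toEuclidean
  set p₀ := e (t₀, y₀) with hp₀
  have hmem : e.symm p₀ ∈ Set.Ioo 0 τ ×ˢ dom O := by
    rw [hp₀, e.symm_apply_apply]; exact ⟨ht₀, ⟨⟨hy₀, trivial⟩, trivial⟩⟩
  set A : (ℝ × ((Cn n × Cn n) × Cn n)) →L[ℝ] _ := e.toContinuousLinearMap with hA
  set a : ℝ := ‖A‖ with ha
  have ha0 : 0 ≤ a := norm_nonneg A
  have hAle : ∀ q, ‖e q‖ ≤ a * ‖q‖ := fun q => A.le_opNorm q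
  have hlip : ∀ r, ∃ K : NNReal, ∃ V ∈ nhds p₀, LipschitzOnWith K
      (fun w => twistField (H (e.symm w).1) (Pi.single r 1) (e.symm w).2) V := by
    intro r
    have h1 : ContDiffAt ℝ ∞ (fun q : ℝ × ((Cn n × Cn n) × Cn n) =>
        twistField (H q.1) (Pi.single r 1) q.2) (e.symm p₀) :=
      (h.smoothOn_twistField _).contDiffAt (h.mem_nhds_dom hmem)
    have h2 : ContDiffAt ℝ 1 (fun w => twistField (H (e.symm w).1) (Pi.single r 1) (e.symm w).2)
        p₀ := (h1.comp p₀ e.symm.contDiff.contDiffAt).of_le (by simp)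
    exact h2.exists_lipschitzOnWith
  choose K V hV hKV using hlip
  have hev : ∀ᶠ w in nhds p₀, (∀ r, w ∈ V r) ∧ e.symm w ∈ Set.Ioo 0 τ ×ˢ dom O :=
    (Filter.eventually_all.2 hV).and (e.symm.continuous.continuousAt.eventually
      ((isOpen_Ioo.prod h.isOpen_dom).mem_nhds hmem))
  obtain ⟨ρ₀, hρ₀, hball⟩ := Metric.nhds_basis_closedBall.eventually_iff.1 hev
  -- Two points of this ball are at distance at most ρ₀/16, which is ρ/8 for the radius ρ = ρ₀/2
  -- used in `zero_along_curve`.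
  have hU : (fun y => e (t₀, y)) ⁻¹' Metric.closedBall p₀ (ρ₀ / 32) ∈ nhds y₀ := by
    have : Continuous fun y : (Cn n × Cn n) × Cn n => e (t₀, y) := by fun_prop
    exact this.continuousAt (Metric.closedBall_mem_nhds _ (by positivity))
  refine ⟨_, hU, fun y θ T hyU hθ hder h0 s hs => ?_⟩
  have hT : 0 ≤ T := hs.1.trans hs.2
  have h0T : (0 : ℝ) ∈ Set.Icc 0 T := ⟨le_rfl, hT⟩
  have hgr : ∀ s, griffIn e G H (e (t₀, y s)) = (griff (G t₀) (H t₀) (y s)).re := by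
    intro s
    unfold griffIn
    rw [e.symm_apply_apply]
  have hsub : ∀ w ∈ Metric.closedBall (e (t₀, y 0)) (ρ₀ / 2), w ∈ Metric.closedBall p₀ ρ₀ := by
    intro w hw
    have h1 := hyU 0 h0T
    rw [Set.mem_preimage, Metric.mem_closedBall] at h1
    rw [Metric.mem_closedBall] at hw ⊢
    linarith [dist_triangle w (e (t₀, y 0)) p₀]
  have hnn' : ∀ w ∈ Metric.closedBall p₀ ρ₀, 0 ≤ griffIn e G H w := fun w hw =>
    hnn _ (Set.Ioo_subset_Ico_self (hball hw).2.1) _ (hball hw).2.2.1.1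
  have hcont : ContinuousOn (griffIn e G H) (Metric.closedBall p₀ ρ₀) :=
    (h.continuousOn_griffIn e).mono fun w hw =>
      Set.prod_mono Set.Ioo_subset_Ico_self subset_rfl (hball hw).2
  have hσd : ∀ s ∈ Set.Icc 0 T, HasDerivWithinAt (fun s => e (t₀, y s))
      (twistIn e H (θ s) (e (t₀, y s))) (Set.Icc 0 T) s := by
    intro s hs
    have h1 := e.hasFDerivAt.comp_hasDerivWithinAt s
      ((hasDerivWithinAt_const s (Set.Icc 0 T) t₀).prodMk (hder s hs))
    refine h1.congr_deriv ?_
    unfold twistIn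
    rw [e.symm_apply_apply]
    rfl
  have := zero_along_curve (u := griffIn e G H) (σ := fun s => e (t₀, y s))
    (Y := fun s => twistIn e H (θ s)) (ρ := ρ₀ / 2) (T := T) (L := a * ∑ r, B * K r)
    (by positivity) (hcont.mono hsub) (fun w hw => hnn' w (hsub w hw))
    (fun s hs => (hσd s hs).continuousWithinAt)
    (fun s hs => (hσd s ⟨hs.1, hs.2.le⟩).mono_of_mem_nhdsWithin
      (Filter.mem_of_superset (Icc_mem_nhdsGE hs.2) (Set.Icc_subset_Icc_left hs.1)))
    (fun s hs => by
      have h1 := hyU s hs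
      have h2 := hyU 0 h0T
      rw [Set.mem_preimage, Metric.mem_closedBall] at h1 h2
      rw [Metric.mem_closedBall]
      linarith [dist_triangle_right (e (t₀, y s)) (e (t₀, y 0)) p₀])
    ?_ ?_ ((hgr 0).trans h0) s hs
  · exact (hgr s).symm.trans this
  · intro s hs p hp q hq
    have hp' := (hball (hsub p hp)).1
    have hq' := (hball (hsub q hq)).1
    unfold twistIn
    rw [← map_sub, Prod.mk_sub_mk, sub_zero]
    refine (hAle _).trans ?_
    rw [mul_assoc]
    refine mul_le_mul_of_nonneg_left ?_ ha0
    rw [Prod.norm_mk, norm_zero, max_eq_right (norm_nonneg _), twistField_eq_sum (H (e.symm p).1),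
      twistField_eq_sum (H (e.symm q).1), ← Finset.sum_sub_distrib, Finset.sum_mul]
    refine (norm_sum_le _ _).trans (Finset.sum_le_sum fun r _ => ?_)
    rw [← smul_sub, norm_smul, RCLike.norm_conj, mul_assoc]
    have h1 := (hKV r).norm_sub_le (hp' r) (hq' r)
    exact mul_le_mul (hθ s ⟨hs.1, hs.2.le⟩ r) h1 (norm_nonneg _)
      ((norm_nonneg _).trans (hθ s ⟨hs.1, hs.2.le⟩ r))
  · intro s hs q hq hq0 c hqc _ hpos
    have hsub' : ∀ w ∈ Metric.closedBall q (ρ₀ / 4), w ∈ Metric.closedBall p₀ ρ₀ := by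
      intro w hw
      refine hsub w ?_
      rw [Metric.mem_closedBall] at hw hq ⊢
      linarith [dist_triangle w q (e (t₀, y 0))]
    have hqm := hsub' q (Metric.mem_closedBall_self (by positivity))
    exact h.inner_twistIn_eq_zero e (θ s) (hball hqm).2 (ρ := ρ₀ / 4) (by positivity)
      (fun w hw => (hball (hsub' w hw)).2) (fun w hw => hnn' w (hsub' w hw)) hq0 hqc
      fun p _ h1 h2 => hpos p h1 h2

/-- Vanishing of the curvature term propagates, in both directions, along short integral curves of
`twistField` with bounded control `θ`. -/
theorem zero_iff_along (h : MetricFlow τ O G H)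
    (hnn : ∀ t ∈ Set.Ico 0 τ, ∀ y : (Cn n × Cn n) × Cn n, y.1.1 ∈ O → 0 ≤ (griff (G t) (H t) y).re)
    {t₀ : ℝ} (ht₀ : t₀ ∈ Set.Ioo 0 τ) {y₀ : (Cn n × Cn n) × Cn n} (hy₀ : y₀.1.1 ∈ O) (B : ℝ) :
    ∃ U ∈ nhds y₀, ∀ (y : ℝ → (Cn n × Cn n) × Cn n) (θ : ℝ → Fin n → ℂ) (a b : ℝ), a ≤ b →
      (∀ s ∈ Set.Icc a b, y s ∈ U) → (∀ s ∈ Set.Icc a b, ∀ r, ‖θ s r‖ ≤ B) →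
      (∀ s ∈ Set.Icc a b, HasDerivWithinAt y (twistField (H t₀) (θ s) (y s)) (Set.Icc a b) s) →
      ((griff (G t₀) (H t₀) (y a)).re = 0 ↔ (griff (G t₀) (H t₀) (y b)).re = 0) := by
  obtain ⟨U, hU, hfwd⟩ := h.zero_forward hnn ht₀ hy₀ B
  refine ⟨U, hU, fun y θ a b hab hyU hθ hder => ⟨fun h0 => ?_, fun h0 => ?_⟩⟩
  · have hmaps : Set.MapsTo (fun s => a + s) (Set.Icc 0 (b - a)) (Set.Icc a b) :=
      fun s hs => ⟨by linarith [hs.1], by linarith [hs.2]⟩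
    have := hfwd (fun s => y (a + s)) (fun s => θ (a + s)) (b - a) (fun s hs => hyU _ (hmaps hs))
      (fun s hs => hθ _ (hmaps hs)) (fun s hs => ?_) (by simpa using h0) (b - a)
      ⟨by linarith, le_rfl⟩
    · simpa using this
    · have h1 : HasDerivWithinAt (fun s => a + s) 1 (Set.Icc 0 (b - a)) s :=
        ((hasDerivAt_id s).const_add a).hasDerivWithinAt
      have := (hder _ (hmaps hs)).scomp s h1 hmaps
      rw [one_smul] at this
      exact this
  · have hmaps : Set.MapsTo (fun s => b - s) (Set.Icc 0 (b - a)) (Set.Icc a b) :=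
      fun s hs => ⟨by linarith [hs.2], by linarith [hs.1]⟩
    have := hfwd (fun s => y (b - s)) (fun s => (-1 : ℝ) • θ (b - s)) (b - a)
      (fun s hs => hyU _ (hmaps hs))
      (fun s hs r => by simpa using hθ _ (hmaps hs) r) (fun s hs => ?_) (by simpa using h0) (b - a)
      ⟨by linarith, le_rfl⟩
    · simpa using this
    · have h1 : HasDerivWithinAt (fun s => b - s) (-1) (Set.Icc 0 (b - a)) s :=
        ((hasDerivAt_id s).const_sub b).hasDerivWithinAt
      have := (hder _ (hmaps hs)).scomp s h1 hmaps
      rw [twistField_smul]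
      exact this

end Bony
end MetricFlow

/-! ### Entrywise Wirtinger calculus for matrices and their inverses -/

section MatrixDeriv
variable {E : Type*} [NormedAddCommGroup E] [NormedSpace ℝ E] [NormedSpace ℂ E]
  {ι κ μ : Type*}

/-- The entrywise Wirtinger derivative `∂_X` of a function with values in matrices. -/
def mwd (X : E) (A : E → Matrix ι κ ℂ) (p : E) : Matrix ι κ ℂ :=
  Matrix.of fun i j => wd X (fun q => A q i j) p

/-- The entrywise Wirtinger derivative `∂̄_X` of a function with values in matrices. -/
def mwb (X : E) (A : E → Matrix ι κ ℂ) (p : E) : Matrix ι κ ℂ :=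
  Matrix.of fun i j => wb X (fun q => A q i j) p

theorem mwd_apply (X : E) (A : E → Matrix ι κ ℂ) (p : E) (i j) :
    mwd X A p i j = wd X (fun q => A q i j) p := rfl

theorem mwb_apply (X : E) (A : E → Matrix ι κ ℂ) (p : E) (i j) :
    mwb X A p i j = wb X (fun q => A q i j) p := rfl

/-- Entrywise real differentiability. -/
def EntryDiffAt (A : E → Matrix ι κ ℂ) (p : E) : Prop := ∀ i j, DifferentiableAt ℝ (fun q => A q i j) p

theorem mwd_congr {A B : E → Matrix ι κ ℂ} {p : E} (h : A =ᶠ[nhds p] B) (X : E) :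
    mwd X A p = mwd X B p := by
  ext i j
  exact wd_congr (h.mono fun q hq => by rw [hq]) X

theorem mwb_congr {A B : E → Matrix ι κ ℂ} {p : E} (h : A =ᶠ[nhds p] B) (X : E) :
    mwb X A p = mwb X B p := by
  ext i j
  exact wb_congr (h.mono fun q hq => by rw [hq]) X

theorem mwd_const (X : E) (A : Matrix ι κ ℂ) (p : E) : mwd X (fun _ => A) p = 0 := by
  ext i j; exact wd_const X _ p

theorem mwb_const (X : E) (A : Matrix ι κ ℂ) (p : E) : mwb X (fun _ => A) p = 0 := by
  ext i j; exact wb_const X _ p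

variable [Fintype κ]

theorem EntryDiffAt.mul {A : E → Matrix ι κ ℂ} {B : E → Matrix κ μ ℂ} {p : E} (hA : EntryDiffAt A p)
    (hB : EntryDiffAt B p) : EntryDiffAt (fun q => A q * B q) p := fun i j => by
  simp only [Matrix.mul_apply]
  exact DifferentiableAt.fun_sum fun k _ => (hA i k).fun_mul (hB k j)

theorem mwd_add {A B : E → Matrix ι κ ℂ} {p : E} (hA : EntryDiffAt A p)
    (hB : EntryDiffAt B p) (X : E) : mwd X (fun q => A q + B q) p = mwd X A p + mwd X B p := by
  ext i j; exact wd_add (hA i j) (hB i j) X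

theorem mwd_mul {A : E → Matrix ι κ ℂ} {B : E → Matrix κ μ ℂ} {p : E} (hA : EntryDiffAt A p)
    (hB : EntryDiffAt B p) (X : E) :
    mwd X (fun q => A q * B q) p = mwd X A p * B p + A p * mwd X B p := by
  ext i j
  simp only [mwd_apply, Matrix.add_apply, Matrix.mul_apply]
  rw [wd_sum _ fun k _ => (hA i k).fun_mul (hB k j), ← Finset.sum_add_distrib]
  exact Finset.sum_congr rfl fun k _ => wd_mul (hA i k) (hB k j) X

theorem mwb_mul {A : E → Matrix ι κ ℂ} {B : E → Matrix κ μ ℂ} {p : E} (hA : EntryDiffAt A p)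
    (hB : EntryDiffAt B p) (X : E) :
    mwb X (fun q => A q * B q) p = mwb X A p * B p + A p * mwb X B p := by
  ext i j
  simp only [mwb_apply, Matrix.add_apply, Matrix.mul_apply]
  rw [wb_sum _ fun k _ => (hA i k).fun_mul (hB k j), ← Finset.sum_add_distrib]
  exact Finset.sum_congr rfl fun k _ => wb_mul (hA i k) (hB k j) X

/-- Entrywise smoothness. -/
def EntrySmoothOn (A : E → Matrix ι κ ℂ) (O : Set E) : Prop :=
  ∀ i j, ContDiffOn ℝ ∞ (fun q => A q i j) O

theorem EntrySmoothOn.entryDiffAt {A : E → Matrix ι κ ℂ} {O : Set E} (hA : EntrySmoothOn A O) (hO : IsOpen O)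
    {p : E} (hp : p ∈ O) : EntryDiffAt A p := fun i j => differentiableAt_of_smoothOn (hA i j) hO hp

theorem EntrySmoothOn.mwd {A : E → Matrix ι κ ℂ} {O : Set E} (hA : EntrySmoothOn A O) (hO : IsOpen O)
    (X : E) : EntrySmoothOn (mwd X A) O := fun i j => smoothOn_wd (hA i j) hO X

theorem EntrySmoothOn.mwb {A : E → Matrix ι κ ℂ} {O : Set E} (hA : EntrySmoothOn A O) (hO : IsOpen O)
    (X : E) : EntrySmoothOn (mwb X A) O := fun i j => smoothOn_wb (hA i j) hO X

end MatrixDeriv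

section Inverse
variable {E : Type*} [NormedAddCommGroup E] [NormedSpace ℝ E] {ι : Type*} [Fintype ι]
  [DecidableEq ι]

theorem contDiffOn_det {A : E → Matrix ι ι ℂ} {O : Set E}
    (hA : ∀ i j, ContDiffOn ℝ ∞ (fun q => A q i j) O) :
    ContDiffOn ℝ ∞ (fun q => (A q).det) O := by
  simp only [Matrix.det_apply]
  refine ContDiffOn.sum fun σ _ => ?_
  simp only [Units.smul_def, zsmul_eq_mul]
  exact contDiffOn_const.mul (contDiffOn_prod fun i _ => hA _ _)

theorem contDiffOn_inv_entry {A : E → Matrix ι ι ℂ} {O : Set E}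
    (hA : ∀ i j, ContDiffOn ℝ ∞ (fun q => A q i j) O) (hdet : ∀ q ∈ O, IsUnit (A q).det) (i j : ι) :
    ContDiffOn ℝ ∞ (fun q => (A q)⁻¹ i j) O := by
  simp only [Matrix.inv_def, Matrix.smul_apply, smul_eq_mul, Ring.inverse_eq_inv']
  refine ((contDiffOn_det hA).inv fun q hq => (hdet q hq).ne_zero).mul ?_
  simp only [Matrix.adjugate_apply]
  refine contDiffOn_det fun k l => ?_
  by_cases h : k = j
  · subst h; simpa using contDiffOn_const
  · simpa [Matrix.updateRow_ne h] using hA k l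

end Inverse

/-! ### The Chern curvature in matrix form -/

section Curv
variable {n : ℕ}

/-- The curvature `Ω(X, Ȳ, ∂_k, ∂_{l̄})` as a matrix, for `G` with inverse `H`. -/
def curvMat (G H : Cn n → Matrix (Fin n) (Fin n) ℂ) (z X Y : Cn n) : Matrix (Fin n) (Fin n) ℂ :=
  mwd X G z * H z * mwb Y G z - mwd X (mwb Y G) z

variable {O : Set (Cn n)} {G H : Cn n → Matrix (Fin n) (Fin n) ℂ}

theorem mwd_inv (hO : IsOpen O) (hG : EntrySmoothOn G O) (hH : EntrySmoothOn H O)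
    (h1 : ∀ z ∈ O, H z * G z = 1) {z : Cn n} (hz : z ∈ O) (X : Cn n) :
    mwd X H z * G z = -(H z * mwd X G z) := by
  have h2 := mwd_mul (hH.entryDiffAt hO hz) (hG.entryDiffAt hO hz) X
  have h3 : (fun q => H q * G q) =ᶠ[nhds z] fun _ => 1 := by
    filter_upwards [hO.mem_nhds hz] with w hw using h1 w hw
  rw [mwd_congr h3, mwd_const] at h2
  exact eq_neg_of_add_eq_zero_left h2.symm

theorem mwb_inv (hO : IsOpen O) (hG : EntrySmoothOn G O) (hH : EntrySmoothOn H O)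
    (h1 : ∀ z ∈ O, H z * G z = 1) {z : Cn n} (hz : z ∈ O) (X : Cn n) :
    mwb X H z * G z = -(H z * mwb X G z) := by
  have h2 := mwb_mul (hH.entryDiffAt hO hz) (hG.entryDiffAt hO hz) X
  have h3 : (fun q => H q * G q) =ᶠ[nhds z] fun _ => 1 := by
    filter_upwards [hO.mem_nhds hz] with w hw using h1 w hw
  rw [mwb_congr h3, mwb_const] at h2
  exact eq_neg_of_add_eq_zero_left h2.symm

theorem mwd_mwb_comm (hO : IsOpen O) (hG : EntrySmoothOn G O) {z : Cn n} (hz : z ∈ O) (X Y : Cn n) :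
    mwb Y (mwd X G) z = mwd X (mwb Y G) z := by
  ext i j
  exact (wd_wb_comm (hG i j) hO hz X Y).symm

/-- The Chern symbols are the entries of ∂_i G · G⁻¹. After the product rule, the derivative of the
inverse is removed by ∂̄(G⁻¹) G = −G⁻¹ ∂̄G. -/
theorem chernCurv_eq (hO : IsOpen O) (hG : EntrySmoothOn G O) (hdet : ∀ z ∈ O, IsUnit (G z).det)
    {z : Cn n} (hz : z ∈ O) (i j k l : Fin n) :
    chernCurv G z i j k l = curvMat G (fun w => (G w)⁻¹) z (stdE i) (stdE j) k l := by
  have hH : EntrySmoothOn (fun w => (G w)⁻¹) O := contDiffOn_inv_entry hG hdet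
  have h1 : ∀ w ∈ O, (G w)⁻¹ * G w = 1 := fun w hw => Matrix.nonsing_inv_mul _ (hdet w hw)
  have e1 : ∀ w p, chernSymbol G w i k p = (mwd (stdE i) G w * (G w)⁻¹) k p := by
    intro w p
    simp only [chernSymbol, Matrix.mul_apply, mwd_apply, dz_eq_wd]
  have e2 : chernCurv G z i j k l =
      -((mwb (stdE j) (fun w => mwd (stdE i) G w * (G w)⁻¹) z * G z) k l) := by
    simp only [chernCurv, Matrix.mul_apply, mwb_apply, dzbar_eq_wb, e1]
  have e3 := mwb_inv hO hG hH h1 hz (stdE j)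
  rw [e2, mwb_mul ((hG.mwd hO _).entryDiffAt hO hz) (hH.entryDiffAt hO hz), Matrix.add_mul, Matrix.mul_assoc,
    Matrix.mul_assoc, h1 z hz, Matrix.mul_one, e3, mwd_mwb_comm hO hG hz, ← Matrix.neg_apply]
  rw [curvMat, Matrix.mul_neg, ← sub_eq_add_neg, neg_sub, Matrix.mul_assoc]

/-- The curvature, with the last two indices raised. -/
theorem inv_mul_curvMat_mul_inv (hO : IsOpen O) (hG : EntrySmoothOn G O) (hH : EntrySmoothOn H O)
    (h1 : ∀ z ∈ O, H z * G z = 1) {z : Cn n} (hz : z ∈ O) (X Y : Cn n) :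
    H z * curvMat G H z X Y * H z =
      mwd X (mwb Y H) z - mwb Y H z * G z * mwd X H z := by
  have h2 : G z * H z = 1 := mul_eq_one_comm.1 (h1 z hz)
  have e1 := mwd_inv hO hG hH h1 hz X
  have e2 := mwb_inv hO hG hH h1 hz Y
  -- differentiate `∂̄H G + H ∂̄G = 0`
  have e3 : (fun w => mwb Y H w * G w + H w * mwb Y G w) =ᶠ[nhds z] fun _ => 0 := by
    filter_upwards [hO.mem_nhds hz] with w hw
    rw [mwb_inv hO hG hH h1 hw Y, neg_add_cancel]
  have dbH := (hH.mwb hO Y).entryDiffAt hO hz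
  have dbG := (hG.mwb hO Y).entryDiffAt hO hz
  have e4 := mwd_congr e3 X
  rw [mwd_const, mwd_add (dbH.mul (hG.entryDiffAt hO hz)) ((hH.entryDiffAt hO hz).mul dbG),
    mwd_mul dbH (hG.entryDiffAt hO hz), mwd_mul (hH.entryDiffAt hO hz) dbG] at e4
  set U := mwd X (mwb Y H) z
  set V := mwd X (mwb Y G) z
  have e5 : H z * V = -(U * G z) - mwb Y H z * mwd X G z - mwd X H z * mwb Y G z := by
    rw [eq_sub_iff_add_eq, eq_sub_iff_add_eq, ← add_eq_zero_iff_eq_neg, ← e4]; abel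
  have e6 : mwd X G z * H z = -(G z * mwd X H z) := by
    calc mwd X G z * H z = G z * (H z * mwd X G z) * H z := by
          rw [← Matrix.mul_assoc, h2, Matrix.one_mul]
      _ = -(G z * mwd X H z * (G z * H z)) := by
          rw [← neg_eq_iff_eq_neg.2 e1]; noncomm_ring
      _ = _ := by rw [h2, Matrix.mul_one]
  have e7 : H z * mwd X G z = -(mwd X H z * G z) := by rw [e1, neg_neg]
  rw [curvMat, Matrix.mul_sub, e5]
  have e8 : H z * (mwd X G z * H z * mwb Y G z) = -(mwd X H z * mwb Y G z) := by
    rw [e6, ← Matrix.mul_assoc, Matrix.mul_neg, ← Matrix.mul_assoc, h1 z hz, Matrix.one_mul,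
      Matrix.neg_mul]
  rw [e8]
  have e9 : (-(mwd X H z * mwb Y G z) - (-(U * G z) - mwb Y H z * mwd X G z -
      mwd X H z * mwb Y G z)) * H z = U * (G z * H z) + mwb Y H z * (mwd X G z * H z) := by
    noncomm_ring
  rw [e9, h2, e6, Matrix.mul_one]
  noncomm_ring

theorem wd_wb_expand (hO : IsOpen O) {f : Cn n → ℂ} (hf : ContDiffOn ℝ ∞ f O) {z : Cn n}
    (hz : z ∈ O) (X Y : Cn n) :
    wd X (wb Y f) z = ∑ i, ∑ j, X i * starRingEnd ℂ (Y j) * wd (stdE i) (wb (stdE j) f) z := by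
  have e1 : wb Y f = fun w => ∑ j, starRingEnd ℂ (Y j) * wb (stdE j) f w := by
    funext w
    conv_lhs => rw [eq_sum_stdE Y]
    exact wb_sum_dir _ _ _ _ _
  have hd : ∀ j, DifferentiableAt ℝ (wb (stdE j) f) z := fun j =>
    differentiableAt_of_smoothOn (smoothOn_wb hf hO _) hO hz
  conv_lhs => rw [eq_sum_stdE X]
  rw [wd_sum_dir]
  refine Finset.sum_congr rfl fun i _ => ?_
  rw [e1, wd_sum _ fun j _ => (hd j).const_mul _, Finset.mul_sum]
  refine Finset.sum_congr rfl fun j _ => ?_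
  rw [wd_mul (differentiableAt_const _) (hd j), wd_const]
  ring

theorem curvMat_expand (hO : IsOpen O) (hG : EntrySmoothOn G O) {z : Cn n} (hz : z ∈ O) (X Y : Cn n) :
    curvMat G H z X Y = ∑ i, ∑ j, (X i * starRingEnd ℂ (Y j)) • curvMat G H z (stdE i) (stdE j) := by
  have e1 : mwd X G z = ∑ i, X i • mwd (stdE i) G z := by
    ext k l
    simp only [Matrix.sum_apply, Matrix.smul_apply, mwd_apply, smul_eq_mul]
    conv_lhs => rw [eq_sum_stdE X]
    exact wd_sum_dir _ _ _ _ _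
  have e2 : mwb Y G z = ∑ i, starRingEnd ℂ (Y i) • mwb (stdE i) G z := by
    ext k l
    simp only [Matrix.sum_apply, Matrix.smul_apply, mwb_apply, smul_eq_mul]
    conv_lhs => rw [eq_sum_stdE Y]
    exact wb_sum_dir _ _ _ _ _
  have e3 : mwd X (mwb Y G) z = ∑ i, ∑ j, (X i * starRingEnd ℂ (Y j)) •
      mwd (stdE i) (mwb (stdE j) G) z := by
    ext k l
    simp only [Matrix.sum_apply, Matrix.smul_apply, smul_eq_mul]
    exact wd_wb_expand hO (hG k l) hz X Y
  simp only [curvMat, smul_sub, Finset.sum_sub_distrib]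
  rw [e3, e1, e2]
  congr 1
  simp only [Matrix.sum_mul, Matrix.mul_sum, Matrix.smul_mul, Matrix.mul_smul,
    Finset.smul_sum, smul_smul, Matrix.mul_assoc]
  rw [Finset.sum_comm]
  exact Finset.sum_congr rfl fun i _ => Finset.sum_congr rfl fun j _ => by rw [mul_comm]

/-- The form `Ω(ξ, ξ̄, η, η̄)` in coordinates. -/
def curvForm (G H : Cn n → Matrix (Fin n) (Fin n) ℂ) (z ξ η : Cn n) : ℂ :=
  ∑ k, ∑ l, η k * starRingEnd ℂ (η l) * curvMat G H z ξ ξ k l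

theorem sum_chernCurv (hO : IsOpen O) (hG : EntrySmoothOn G O) (hdet : ∀ z ∈ O, IsUnit (G z).det)
    {z : Cn n} (hz : z ∈ O) (ξ η : Cn n) :
    ∑ i, ∑ j, ∑ k, ∑ l, chernCurv G z i j k l * ξ i * starRingEnd ℂ (ξ j) * η k *
      starRingEnd ℂ (η l) = curvForm G (fun w => (G w)⁻¹) z ξ η := by
  unfold curvForm
  rw [curvMat_expand hO hG hz]
  simp only [chernCurv_eq hO hG hdet hz, Matrix.sum_apply, Matrix.smul_apply, smul_eq_mul,
    Finset.mul_sum]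
  have e : ∀ F : Fin n → Fin n → Fin n → Fin n → ℂ, ∑ a, ∑ b, ∑ m, ∑ r, F a b m r =
      ∑ m, ∑ r, ∑ a, ∑ b, F a b m r := by
    intro F
    rw [Finset.sum_congr rfl fun a _ => Finset.sum_comm, Finset.sum_comm]
    refine Finset.sum_congr rfl fun r _ => ?_
    rw [Finset.sum_congr rfl fun a _ => Finset.sum_comm, Finset.sum_comm]
  rw [e]
  exact Finset.sum_congr rfl fun k _ => Finset.sum_congr rfl fun l _ => Finset.sum_congr rfl
    fun i _ => Finset.sum_congr rfl fun j _ => by ring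

/-- The covector `l ↦ g(∂_l, η)` dual to `η̄`. -/
def lowerConj (G : Matrix (Fin n) (Fin n) ℂ) (η : Cn n) : Cn n :=
  WithLp.toLp 2 fun l => conj (∑ k, η k * G k l)

theorem lowerConj_apply (G : Matrix (Fin n) (Fin n) ℂ) (η : Cn n) (l : Fin n) :
    lowerConj G η l = conj (∑ k, η k * G k l) := rfl

theorem sum_sum_eq_dotProduct (u v : Fin n → ℂ) (C : Matrix (Fin n) (Fin n) ℂ) :
    ∑ k, ∑ l, u k * v l * C k l = dotProduct u (C.mulVec v) := by
  simp only [dotProduct, Matrix.mulVec, Finset.mul_sum]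
  exact Finset.sum_congr rfl fun k _ => Finset.sum_congr rfl fun l _ => by ring

/-- For α dual to η̄ one recovers η as ᾱ H and η̄ as H α. Contracting the curvature with η and η̄
therefore contracts the sandwich H Ω H with ᾱ and α, and `inv_mul_curvMat_mul_inv` expresses that
through derivatives of H. -/
theorem curvForm_eq_griff (hO : IsOpen O) (hG : EntrySmoothOn G O) (hH : EntrySmoothOn H O)
    (h1 : ∀ z ∈ O, H z * G z = 1) (hherm : ∀ z ∈ O, (H z).IsHermitian) {z : Cn n} (hz : z ∈ O)
    (ξ η : Cn n) : curvForm G H z ξ η = griff G H ((z, lowerConj (G z) η), ξ) := by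
  set α := lowerConj (G z) η with hα
  have h2 : G z * H z = 1 := mul_eq_one_comm.1 (h1 z hz)
  have eη : (fun k => η k) = Matrix.vecMul (fun b => starRingEnd ℂ (α b)) (H z) := by
    have : Matrix.vecMul (fun k => η k) (G z * H z) = fun k => η k := by
      rw [h2, Matrix.vecMul_one]
    rw [← Matrix.vecMul_vecMul] at this
    rw [← this]
    congr 1
    funext l
    simp only [Matrix.vecMul, dotProduct, hα, lowerConj_apply, Complex.conj_conj]
  have eη' : (fun l => starRingEnd ℂ (η l)) = (H z).mulVec fun a => α a := by
    funext l
    rw [congrFun eη l]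
    simp only [Matrix.vecMul, Matrix.mulVec, dotProduct, map_sum]
    refine Finset.sum_congr rfl fun a _ => ?_
    rw [map_mul, Complex.conj_conj, mul_comm, ← (hherm z hz).apply l a, RCLike.star_def]
  have e1 : curvForm G H z ξ η = dotProduct (fun b => starRingEnd ℂ (α b))
      ((H z * curvMat G H z ξ ξ * H z).mulVec fun a => α a) := by
    have := sum_sum_eq_dotProduct (fun k => η k) (fun l => starRingEnd ℂ (η l))
      (curvMat G H z ξ ξ)
    rw [eη, eη', ← Matrix.dotProduct_mulVec, Matrix.mulVec_mulVec,
      Matrix.mulVec_mulVec] at this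
    exact this
  have hd : dHvec H ((z, α), ξ) = (mwd ξ H z).mulVec fun a => α a := by
    funext b
    simp only [dHvec, Matrix.mulVec, dotProduct, mwd_apply]
    exact Finset.sum_congr rfl fun a _ => mul_comm _ _
  have hd' : (fun a => conj (dHvec H ((z, α), ξ) a)) =
      Matrix.vecMul (fun b => starRingEnd ℂ (α b)) (mwb ξ H z) := by
    funext a
    rw [conj_dHvec hO hherm (y := ((z, α), ξ)) hz]
    rfl
  have e2 : ∑ a, ∑ b, conj (dHvec H ((z, α), ξ) a) * G z a b * dHvec H ((z, α), ξ) b =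
      dotProduct (fun b => starRingEnd ℂ (α b))
        ((mwb ξ H z * G z * mwd ξ H z).mulVec fun a => α a) := by
    rw [Matrix.mul_assoc, ← Matrix.mulVec_mulVec, Matrix.dotProduct_mulVec, ← hd',
      ← Matrix.mulVec_mulVec, ← hd, ← sum_sum_eq_dotProduct]
    exact Finset.sum_congr rfl fun k _ => Finset.sum_congr rfl fun l _ => by ring
  rw [e1, inv_mul_curvMat_mul_inv hO hG hH h1 hz, Matrix.sub_mulVec, dotProduct_sub]
  simp only [griff]
  rw [e2, ← sum_sum_eq_dotProduct, Finset.sum_comm]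
  congr 1
  exact Finset.sum_congr rfl fun k _ => Finset.sum_congr rfl fun l _ => by
    rw [mul_comm (starRingEnd ℂ (α l))]; rfl

end Curv

/-! ### The Hermitian curvature flow as an equation for the inverse metric -/

section
open scoped ComplexOrder

section Torsion
variable {n : ℕ}

/-- Raising the indices of the torsion term `Q`. Here `D`, `B` stand for the derivatives `∂G`,
`∂̄G`. -/
theorem inv_mul_torsion_mul_inv (H : Matrix (Fin n) (Fin n) ℂ)
    (D B : Fin n → Matrix (Fin n) (Fin n) ℂ) (a b : Fin n) :
    (H * (Matrix.of fun i j => (1 / 2) * ∑ m, ∑ r, ∑ p, ∑ s, H r m * H s p *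
      (D p m j - D m p j) * (B s i r - B r i s)) * H) a b =
    ∑ m, ∑ r, (H r m * (H * B r * H * D m * H) a b -
      (H * B r * H) a m * (H * D m * H) r b) := by
  have e0 : (H * (Matrix.of fun i j => (1 / 2) * ∑ m, ∑ r, ∑ p, ∑ s, H r m * H s p *
      (D p m j - D m p j) * (B s i r - B r i s)) * H) a b =
      (1 / 2) * ∑ m, ∑ r, ∑ p, ∑ s, H r m * H s p *
        ((D p * H) m b - (D m * H) p b) * ((H * B s) a r - (H * B r) a s) := by
    have e1 : ∀ m r p s, H r m * H s p * ((D p * H) m b - (D m * H) p b) *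
        ((H * B s) a r - (H * B r) a s) = ∑ j, ∑ i, H a i * (H r m * H s p *
          (D p m j - D m p j) * (B s i r - B r i s)) * H j b := by
      intro m r p s
      simp only [Matrix.mul_apply]
      rw [← Finset.sum_sub_distrib, ← Finset.sum_sub_distrib, mul_assoc, Finset.sum_mul_sum,
        Finset.mul_sum]
      refine Finset.sum_congr rfl fun j _ => ?_
      rw [Finset.mul_sum]
      exact Finset.sum_congr rfl fun i _ => by ring
    simp only [e1]
    rw [Matrix.mul_apply]
    simp only [Matrix.mul_apply, Matrix.of_apply]
    rw [Finset.mul_sum]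
    have e2 : ∀ F : Fin n → Fin n → Fin n → Fin n → Fin n → Fin n → ℂ,
        ∑ m, ∑ r, ∑ p, ∑ s, ∑ j, ∑ i, F m r p s j i = ∑ j, ∑ i, ∑ m, ∑ r, ∑ p, ∑ s, F m r p s j i := by
      intro F
      simp only [← Fintype.sum_prod_type']
      refine Fintype.sum_equiv ⟨fun x => (x.2.2.2.2.1, x.2.2.2.2.2, x.1, x.2.1, x.2.2.1, x.2.2.2.1),
        fun x => (x.2.2.1, x.2.2.2.1, x.2.2.2.2.1, x.2.2.2.2.2, x.1, x.2.1), fun _ => rfl,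
        fun _ => rfl⟩ _ _ fun _ => rfl
    rw [← Finset.mul_sum, e2, Finset.mul_sum]
    refine Finset.sum_congr rfl fun j _ => ?_
    rw [Finset.sum_mul, Finset.mul_sum]
    refine Finset.sum_congr rfl fun i _ => ?_
    simp only [Finset.mul_sum, Finset.sum_mul]
    refine Finset.sum_congr rfl fun m _ => Finset.sum_congr rfl fun r _ =>
      Finset.sum_congr rfl fun p _ => Finset.sum_congr rfl fun s _ => by ring
  have e3 : ∀ F : Fin n → Fin n → Fin n → Fin n → ℂ,
      ∑ m, ∑ r, ∑ p, ∑ s, F m r p s = ∑ m, ∑ r, ∑ p, ∑ s, F p s m r := by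
    intro F
    simp only [← Fintype.sum_prod_type']
    exact Fintype.sum_equiv ⟨fun x => (x.2.2.1, x.2.2.2, x.1, x.2.1),
        fun x => (x.2.2.1, x.2.2.2, x.1, x.2.1), fun _ => rfl,
        fun _ => rfl⟩ _ _ fun _ => rfl
  -- the four terms of the product agree in pairs
  have e4 : ∑ m, ∑ r, ∑ p, ∑ s, H r m * H s p *
        ((D p * H) m b - (D m * H) p b) * ((H * B s) a r - (H * B r) a s) =
      2 * ((∑ m, ∑ r, ∑ p, ∑ s, H s p * H r m * (D m * H) p b * (H * B r) a s) -
        ∑ m, ∑ r, ∑ p, ∑ s, H s p * H r m * (D m * H) p b * (H * B s) a r) := by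
    have f1 : ∀ m r p s, H r m * H s p *
        ((D p * H) m b - (D m * H) p b) * ((H * B s) a r - (H * B r) a s) =
        (H r m * H s p * (D p * H) m b * (H * B s) a r -
          H r m * H s p * (D p * H) m b * (H * B r) a s) +
        (H s p * H r m * (D m * H) p b * (H * B r) a s -
          H s p * H r m * (D m * H) p b * (H * B s) a r) := fun m r p s => by ring
    simp only [f1, Finset.sum_add_distrib, Finset.sum_sub_distrib]
    rw [e3 fun m r p s => H r m * H s p * (D p * H) m b * (H * B s) a r,
      e3 fun m r p s => H r m * H s p * (D p * H) m b * (H * B r) a s]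
    ring
  rw [e0, e4, ← mul_assoc, one_div, inv_mul_cancel₀ two_ne_zero, one_mul]
  simp only [Finset.sum_sub_distrib]
  congr 1
  · refine Finset.sum_congr rfl fun m _ => Finset.sum_congr rfl fun r _ => ?_
    rw [Matrix.mul_assoc (H * B r * H), Matrix.mul_apply, Finset.mul_sum]
    refine Finset.sum_congr rfl fun p _ => ?_
    rw [Matrix.mul_apply (M := H * B r), Finset.sum_mul, Finset.mul_sum]
    exact Finset.sum_congr rfl fun s _ => by ring
  · have e5 : ∀ F : Fin n → Fin n → Fin n → Fin n → ℂ,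
        ∑ m, ∑ r, ∑ p, ∑ s, F m r p s = ∑ m, ∑ s, ∑ r, ∑ p, F m r p s := by
      intro F
      simp only [← Fintype.sum_prod_type']
      exact Fintype.sum_equiv ⟨fun x => (x.1, x.2.2.2, x.2.1, x.2.2.1),
        fun x => (x.1, x.2.2.1, x.2.2.2, x.2.1), fun _ => rfl, fun _ => rfl⟩ _ _ fun _ => rfl
    rw [e5]
    refine Finset.sum_congr rfl fun m _ => Finset.sum_congr rfl fun r _ => ?_
    rw [Matrix.mul_assoc H (D m), Matrix.mul_apply, Matrix.mul_apply (M := H), Finset.sum_mul_sum]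
    exact Finset.sum_congr rfl fun p _ => Finset.sum_congr rfl fun s _ => by ring

variable {O : Set (Cn n)} {G : Cn n → Matrix (Fin n) (Fin n) ℂ}

/-- Lowering the index cancels the inverse metric in the Chern symbols, so the lowered torsion is an
antisymmetrized first derivative of G. -/
theorem torsionLow_eq {z : Cn n} (hdet : IsUnit (G z).det) (p m j : Fin n) :
    torsionLow G z p m j = mwd (stdE p) G z m j - mwd (stdE m) G z p j := by
  have e1 : ∀ i j k, chernSymbol G z i j k = (mwd (stdE i) G z * (G z)⁻¹) j k := by
    intro i j k
    simp only [chernSymbol, Matrix.mul_apply, mwd_apply, dz_eq_wd]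
  have e2 : ∀ i j l, ∑ k, (mwd (stdE i) G z * (G z)⁻¹) j k * G z k l = mwd (stdE i) G z j l := by
    intro i j l
    rw [← Matrix.mul_apply, Matrix.mul_assoc, Matrix.nonsing_inv_mul _ hdet, Matrix.mul_one]
  simp only [torsionLow, torsion, e1, sub_mul, Finset.sum_sub_distrib, e2]

theorem conj_mwd (hO : IsOpen O) (hherm : ∀ z ∈ O, (G z).IsHermitian) {z : Cn n} (hz : z ∈ O)
    (X : Cn n) (i j : Fin n) : conj (mwd X G z i j) = mwb X G z j i := by
  rw [mwd_apply, mwb_apply, conj_wd]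
  refine wb_congr ?_ _
  filter_upwards [hO.mem_nhds hz] with w hw
  rw [← (hherm w hw).apply j i, RCLike.star_def]

theorem torsionQ_eq (hO : IsOpen O) (hherm : ∀ z ∈ O, (G z).IsHermitian) {z : Cn n} (hz : z ∈ O)
    (hdet : IsUnit (G z).det) (i j : Fin n) :
    torsionQ G z i j = (1 / 2) * ∑ m, ∑ r, ∑ p, ∑ s, (G z)⁻¹ r m * (G z)⁻¹ s p *
      (mwd (stdE p) G z m j - mwd (stdE m) G z p j) *
      (mwb (stdE s) G z i r - mwb (stdE r) G z i s) := by
  simp only [torsionQ, torsionLow_eq hdet, map_sub, conj_mwd hO hherm hz]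

theorem isUnit_det_of_posDef {A : Matrix (Fin n) (Fin n) ℂ} (h : A.PosDef) : IsUnit A.det :=
  (Matrix.isUnit_iff_isUnit_det A).1 h.isUnit

/-- In the Hermitian curvature flow, the evolution of the inverse metric. -/
theorem inv_mul_flow_mul_inv (hO : IsOpen O) (hG : EntrySmoothOn G O)
    (hpos : ∀ z ∈ O, (G z).PosDef) {z : Cn n} (hz : z ∈ O) (a b : Fin n) :
    ((G z)⁻¹ * (Matrix.of fun i j => secondRicci G z i j + torsionQ G z i j) * (G z)⁻¹) a b =
      ∑ m, ∑ r, ((G z)⁻¹ r m * wd (stdE m) (wb (stdE r) fun w => (G w)⁻¹ a b) z -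
        wb (stdE r) (fun w => (G w)⁻¹ a m) z * wd (stdE m) (fun w => (G w)⁻¹ r b) z) := by
  have hdet : ∀ z ∈ O, IsUnit (G z).det := fun z hz => isUnit_det_of_posDef (hpos z hz)
  have hH : EntrySmoothOn (fun w => (G w)⁻¹) O := contDiffOn_inv_entry hG hdet
  have h1 : ∀ w ∈ O, (G w)⁻¹ * G w = 1 := fun w hw => Matrix.nonsing_inv_mul _ (hdet w hw)
  have h2 : G z * (G z)⁻¹ = 1 := mul_eq_one_comm.1 (h1 z hz)
  have eD : ∀ m, G z * mwd (stdE m) (fun w => (G w)⁻¹) z = -(mwd (stdE m) G z * (G z)⁻¹) := by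
    intro m
    have e := mwd_inv hO hG hH h1 hz (stdE m)
    calc _ = G z * (mwd (stdE m) (fun w => (G w)⁻¹) z * G z) * (G z)⁻¹ := by
          rw [Matrix.mul_assoc, Matrix.mul_assoc, h2, Matrix.mul_one]
      _ = -(G z * (G z)⁻¹ * mwd (stdE m) G z * (G z)⁻¹) := by rw [e]; noncomm_ring
      _ = _ := by rw [h2, Matrix.one_mul]
  have eD' : ∀ m, (G z)⁻¹ * mwd (stdE m) G z * (G z)⁻¹ =
      -mwd (stdE m) (fun w => (G w)⁻¹) z := by
    intro m
    rw [Matrix.mul_assoc, ← neg_eq_iff_eq_neg.2 (eD m), Matrix.mul_neg, ← Matrix.mul_assoc,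
      h1 z hz, Matrix.one_mul]
  have eB : ∀ r, (G z)⁻¹ * mwb (stdE r) G z * (G z)⁻¹ =
      -mwb (stdE r) (fun w => (G w)⁻¹) z := by
    intro r
    have e := mwb_inv hO hG hH h1 hz (stdE r)
    rw [← neg_eq_iff_eq_neg.2 e, Matrix.neg_mul, Matrix.mul_assoc, h2, Matrix.mul_one]
  have eS : (Matrix.of fun i j => secondRicci G z i j + torsionQ G z i j) =
      (∑ m, ∑ r, (G z)⁻¹ r m • curvMat G (fun w => (G w)⁻¹) z (stdE m) (stdE r)) +
      Matrix.of fun i j => (1 / 2) * ∑ m, ∑ r, ∑ p, ∑ s, (G z)⁻¹ r m * (G z)⁻¹ s p *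
      (mwd (stdE p) G z m j - mwd (stdE m) G z p j) *
      (mwb (stdE s) G z i r - mwb (stdE r) G z i s) := by
    ext i j
    simp only [Matrix.of_apply, Matrix.add_apply, Matrix.sum_apply, Matrix.smul_apply, smul_eq_mul]
    rw [torsionQ_eq hO (fun z hz => (hpos z hz).isHermitian) hz (hdet z hz)]
    simp only [secondRicci, chernCurv_eq hO hG hdet hz]
  rw [eS, Matrix.mul_add, Matrix.add_mul, Matrix.add_apply,
    inv_mul_torsion_mul_inv _ (fun p => mwd (stdE p) G z) (fun s => mwb (stdE s) G z)]
  simp only [Matrix.mul_sum, Matrix.sum_mul, Matrix.mul_smul, Matrix.smul_mul, Matrix.sum_apply,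
    Matrix.smul_apply, smul_eq_mul, inv_mul_curvMat_mul_inv hO hG hH h1 hz]
  rw [← Finset.sum_add_distrib]
  refine Finset.sum_congr rfl fun m _ => ?_
  rw [← Finset.sum_add_distrib]
  refine Finset.sum_congr rfl fun r _ => ?_
  -- The first half of the raised torsion term cancels the product ∂̄H G ∂H in the raised curvature.
  -- What remains is ∂∂̄H together with the crossed product of first derivatives from the second
  -- half.
  have e1 : (G z)⁻¹ * mwb (stdE r) G z * (G z)⁻¹ * mwd (stdE m) G z * (G z)⁻¹ =
      mwb (stdE r) (fun w => (G w)⁻¹) z * G z * mwd (stdE m) (fun w => (G w)⁻¹) z := by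
    rw [eB, Matrix.mul_assoc, ← neg_eq_iff_eq_neg.2 (eD m), Matrix.neg_mul, Matrix.mul_neg, neg_neg,
      Matrix.mul_assoc]
  rw [e1, eB, eD', Matrix.sub_apply]
  simp only [Matrix.neg_apply, mwd_apply, mwb_apply]
  ring_nf

end Torsion

section Flow
variable {n : ℕ} {τ : ℝ} {O : Set (Cn n)} {G : ℝ → Cn n → Matrix (Fin n) (Fin n) ℂ}

/-- A solution of the Hermitian curvature flow, in a chart. -/
theorem metricFlow_of_evolution (hO : IsOpen O)
    (hG : ∀ k l, SmoothFamily (Set.Ico 0 τ) O fun t z => G t z k l)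
    (hpos : ∀ t ∈ Set.Ico 0 τ, ∀ z ∈ O, (G t z).PosDef)
    (hev : ∀ t ∈ Set.Ico 0 τ, ∀ z ∈ O, ∀ i j, HasDerivWithinAt (fun s => G s z i j)
      (-secondRicci (G t) z i j - torsionQ (G t) z i j) (Set.Ico 0 τ) t) :
    MetricFlow τ O G fun t z => (G t z)⁻¹ := by
  have hdet : ∀ t ∈ Set.Ico 0 τ, ∀ z ∈ O, IsUnit (G t z).det := fun t ht z hz =>
    isUnit_det_of_posDef (hpos t ht z hz)
  have hH : ∀ k l, SmoothFamily (Set.Ico 0 τ) O fun t z => (G t z)⁻¹ k l := fun k l =>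
    contDiffOn_inv_entry (A := fun q : ℝ × Cn n => G q.1 q.2) hG
      (fun q hq => hdet q.1 hq.1 q.2 hq.2) k l
  have h1 : ∀ t ∈ Set.Ico 0 τ, ∀ z ∈ O, (G t z)⁻¹ * G t z = 1 := fun t ht z hz =>
    Matrix.nonsing_inv_mul _ (hdet t ht z hz)
  refine ⟨hO, hG, hH, h1, fun t ht z hz => (hpos t ht z hz).isHermitian,
    fun t ht z hz => (hpos t ht z hz).inv.isHermitian, fun t ht z hz v hv => ?_,
    fun t ht z hz a b => ?_⟩
  · have h := (Complex.pos_iff.1 ((hpos t ht z hz).inv.dotProduct_mulVec_pos hv)).1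
    have e : star v ⬝ᵥ (G t z)⁻¹.mulVec v = ∑ a, ∑ b, v a * conj (v b) * (G t z)⁻¹ b a := by
      rw [← sum_sum_eq_dotProduct, Finset.sum_comm]
      refine Finset.sum_congr rfl fun a _ => Finset.sum_congr rfl fun b _ => ?_
      rw [Pi.star_apply, RCLike.star_def]; ring
    rwa [e] at h
  · have htI : t ∈ Set.Ico 0 τ := Set.Ioo_subset_Ico_self ht
    have hdH : ∀ k l, HasDerivAt (fun s => (G s z)⁻¹ k l) (deriv (fun s => (G s z)⁻¹ k l) t) t := by
      intro k l
      have h2 : ContDiffAt ℝ ∞ (fun q : ℝ × Cn n => (G q.1 q.2)⁻¹ k l) (t, z) :=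
        ContDiffOn.contDiffAt (hH k l) (Filter.mem_of_superset ((isOpen_Ioo.prod hO).mem_nhds
          ⟨ht, hz⟩) (Set.prod_mono Set.Ioo_subset_Ico_self subset_rfl))
      have h3 : DifferentiableAt ℝ (fun s : ℝ => (s, z)) t := by fun_prop
      exact ((h2.differentiableAt (by simp)).comp t h3).hasDerivAt
    have hdG : ∀ k l, HasDerivAt (fun s => G s z k l)
        (-secondRicci (G t) z k l - torsionQ (G t) z k l) t := fun k l =>
      (hev t htI z hz k l).hasDerivAt (Ico_mem_nhds ht.1 ht.2)
    set D : Matrix (Fin n) (Fin n) ℂ := Matrix.of fun k l => deriv (fun s => (G s z)⁻¹ k l) t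
    set R : Matrix (Fin n) (Fin n) ℂ :=
      Matrix.of fun i j => secondRicci (G t) z i j + torsionQ (G t) z i j with hR
    -- Differentiate H G = 1 in time; the sign from the derivative of the inverse cancels the sign
    -- in the flow.
    have e1 : D * G t z = (G t z)⁻¹ * R := by
      ext k l
      have h2 : HasDerivAt (fun s => ∑ j, (G s z)⁻¹ k j * G s z j l) _ t :=
        HasDerivAt.fun_sum fun j _ => (hdH k j).fun_mul (hdG j l)
      have h3 : (fun s => ∑ j, (G s z)⁻¹ k j * G s z j l) =ᶠ[nhds t]
          fun _ => (1 : Matrix (Fin n) (Fin n) ℂ) k l := by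
        filter_upwards [Ico_mem_nhds ht.1 ht.2] with s hs
        rw [← Matrix.mul_apply, h1 s hs z hz]
      have h4 := h2.unique ((hasDerivAt_const t _).congr_of_eventuallyEq h3)
      rw [Finset.sum_add_distrib] at h4
      rw [Matrix.mul_apply, Matrix.mul_apply]
      refine (eq_neg_of_add_eq_zero_left h4).trans ?_
      rw [← Finset.sum_neg_distrib]
      refine Finset.sum_congr rfl fun j _ => ?_
      rw [hR, Matrix.of_apply]; ring
    have e2 : D = (G t z)⁻¹ * R * (G t z)⁻¹ := by
      rw [← e1, Matrix.mul_assoc, mul_eq_one_comm.1 (h1 t htI z hz), Matrix.mul_one]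
    have e3 := inv_mul_flow_mul_inv hO (fun k l => (hG k l).slice htI) (hpos t htI) hz a b
    rw [← hR, ← e2] at e3
    rw [← e3]
    exact hdH a b

end Flow

end

/-! ### Holomorphic charts and components of metrics -/

section
open scoped ComplexOrder

section Charts
variable {n : ℕ} {M : Type*} [TopologicalSpace M] [ChartedSpace (Cn n) M]
  [IsManifold 𝓘(ℂ, Cn n) ω M] {e e' : OpenPartialHomeomorph M (Cn n)}

theorem mdifferentiableAt_chart (he : e ∈ holCharts n M) {x : M} (hx : x ∈ e.source) :
    MDifferentiableAt 𝓘(ℂ, Cn n) 𝓘(ℂ, Cn n) e x :=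
  ((contMDiffOn_of_mem_maximalAtlas he).contMDiffAt (e.open_source.mem_nhds hx)).mdifferentiableAt
    (by simp)

theorem mdifferentiableAt_chart_symm (he : e ∈ holCharts n M) {z : Cn n} (hz : z ∈ e.target) :
    MDifferentiableAt 𝓘(ℂ, Cn n) 𝓘(ℂ, Cn n) e.symm z :=
  ((contMDiffOn_symm_of_mem_maximalAtlas he).contMDiffAt
    (e.open_target.mem_nhds hz)).mdifferentiableAt (by simp)

/-- The vector at `e.symm z` with components `v` in the chart `e`. -/
def ofCoords (e : OpenPartialHomeomorph M (Cn n)) (z : Cn n) : Cn n →L[ℂ] T10 n (e.symm z) :=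
  mfderiv 𝓘(ℂ, Cn n) 𝓘(ℂ, Cn n) e.symm z

theorem coords_ofCoords (he : e ∈ holCharts n M) {z : Cn n} (hz : z ∈ e.target) (v : Cn n) :
    coords e (e.symm z) (ofCoords e z v) = v := by
  have h1 : mfderiv 𝓘(ℂ, Cn n) 𝓘(ℂ, Cn n) (e ∘ e.symm) z =
      (mfderiv 𝓘(ℂ, Cn n) 𝓘(ℂ, Cn n) e (e.symm z)).comp
        (mfderiv 𝓘(ℂ, Cn n) 𝓘(ℂ, Cn n) e.symm z) :=
    mfderiv_comp z (mdifferentiableAt_chart he (e.map_target hz))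
      (mdifferentiableAt_chart_symm he hz)
  have h2 : (e ∘ e.symm) =ᶠ[nhds z] id := by
    filter_upwards [e.open_target.mem_nhds hz] with w hw using e.right_inv hw
  have h3 : mfderiv 𝓘(ℂ, Cn n) 𝓘(ℂ, Cn n) (e ∘ e.symm) z =
      mfderiv 𝓘(ℂ, Cn n) 𝓘(ℂ, Cn n) id z := h2.mfderiv_eq
  rw [h1, mfderiv_id] at h3
  exact congrArg (fun L : Cn n →L[ℂ] Cn n => L v) h3

/-- In finite dimension a one-sided inverse is two-sided, which avoids differentiating the other
composition of the chart with its inverse. -/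
theorem ofCoords_coords (he : e ∈ holCharts n M) {z : Cn n} (hz : z ∈ e.target)
    (ξ : T10 n (e.symm z)) : ofCoords e z (coords e (e.symm z) ξ) = ξ := by
  let L : Cn n →L[ℂ] Cn n := ofCoords e z
  have hinj : Function.Surjective L.toLinearMap :=
    LinearMap.injective_iff_surjective.1 (Function.LeftInverse.injective (coords_ofCoords he hz))
  obtain ⟨v, hv⟩ := hinj ξ
  have hv' : ofCoords e z v = ξ := hv
  rw [← hv', coords_ofCoords he hz]

theorem coordVec_eq (z : Cn n) (k : Fin n) : coordVec e z k = ofCoords e z (stdE k) := rfl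

theorem ofCoords_eq_sum (z v : Cn n) : ofCoords e z v = ∑ k, v k • coordVec e z k := by
  conv_lhs => rw [eq_sum_stdE v]
  rw [map_sum]
  exact Finset.sum_congr rfl fun k _ => by rw [map_smul, coordVec_eq]

theorem form_ofCoords (g : HermitianMetric n M) (z v w : Cn n) :
    g.form (e.symm z) (ofCoords e z v) (ofCoords e z w) =
      ∑ k, ∑ l, v k * starRingEnd ℂ (w l) * g.comps e z k l := by
  rw [ofCoords_eq_sum, ofCoords_eq_sum]
  simp only [map_sum, LinearMap.sum_apply, map_smulₛₗ, LinearMap.smul_apply, smul_eq_mul,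
    RingHom.id_apply, HermitianMetric.comps, Matrix.of_apply]
  simp only [Finset.mul_sum]
  rw [Finset.sum_comm]
  exact Finset.sum_congr rfl fun k _ => Finset.sum_congr rfl fun l _ => by ring

/-- The metric in terms of components. -/
theorem form_eq (g : HermitianMetric n M) (he : e ∈ holCharts n M) {x : M} (hx : x ∈ e.source)
    (ξ η : T10 n x) : g.form x ξ η =
      ∑ k, ∑ l, coords e x ξ k * starRingEnd ℂ (coords e x η l) * g.comps e (e x) k l := by
  obtain ⟨z, hz, rfl⟩ : ∃ z ∈ e.target, e.symm z = x := ⟨e x, e.map_source hx, e.left_inv hx⟩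
  conv_lhs => rw [← ofCoords_coords he hz ξ, ← ofCoords_coords he hz η]
  rw [form_ofCoords, e.right_inv hz]

theorem coords_eq_zero (he : e ∈ holCharts n M) {x : M} (hx : x ∈ e.source) {ξ : T10 n x}
    (h : coords e x ξ = 0) : ξ = 0 := by
  obtain ⟨z, hz, rfl⟩ : ∃ z ∈ e.target, e.symm z = x := ⟨e x, e.map_source hx, e.left_inv hx⟩
  rw [← ofCoords_coords he hz ξ, h, map_zero]

theorem comps_isHermitian (g : HermitianMetric n M) (z : Cn n) :
    (g.comps e z).IsHermitian := by
  ext k l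
  simp only [Matrix.conjTranspose_apply, HermitianMetric.comps, Matrix.of_apply]
  rw [g.conj_symm _ (coordVec e z k) (coordVec e z l), RCLike.star_def, Complex.conj_conj]

theorem comps_posDef (g : HermitianMetric n M) (he : e ∈ holCharts n M) {z : Cn n}
    (hz : z ∈ e.target) : (g.comps e z).PosDef := by
  refine Matrix.PosDef.of_dotProduct_mulVec_pos (comps_isHermitian g z) fun v hv => ?_
  refine Complex.pos_iff.2 ⟨?_, ((comps_isHermitian g z).im_star_dotProduct_mulVec_self v).symm⟩
  set w : Cn n := WithLp.toLp 2 fun k => conj (v k) with hw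
  have hw0 : ofCoords e z w ≠ 0 := by
    intro h0
    have := coords_ofCoords he hz w
    rw [h0] at this
    have h1 : w = 0 := by rw [← this]; exact map_zero _
    refine hv (funext fun k => ?_)
    have h2 : w k = 0 := by rw [h1]; rfl
    have h3 : conj (v k) = 0 := h2
    simpa using h3
  have h1 := g.pos _ _ hw0
  rw [form_ofCoords, sum_sum_eq_dotProduct] at h1
  have h2 : (fun l => starRingEnd ℂ (w l)) = v := by
    funext l
    show conj (conj (v l)) = v l
    rw [Complex.conj_conj]
  rw [h2] at h1
  exact h1

theorem comps_smooth (g : HermitianMetric n M) (he : e ∈ holCharts n M) :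
    EntrySmoothOn (g.comps e) e.target := fun k l => g.smooth e he k l

/-- The Hermitian curvature flow in a chart. -/
theorem IsHCF.metricFlow {τ : ℝ} {g : ℝ → HermitianMetric n M} (hg : IsHCF τ g)
    (he : e ∈ holCharts n M) : MetricFlow τ e.target (fun t z => (g t).comps e z)
      fun t z => ((g t).comps e z)⁻¹ :=
  metricFlow_of_evolution e.open_target (hg.smooth e he)
    (fun t _ _ hz => comps_posDef (g t) he hz) fun t ht z hz => hg.evolution e he z hz t ht

/-! ### Change of charts -/

theorem isOpen_transition (e e' : OpenPartialHomeomorph M (Cn n)) :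
    IsOpen (e.target ∩ e.symm ⁻¹' e'.source) :=
  (e.symm.trans e').open_source

theorem differentiableOn_transition (he : e ∈ holCharts n M) (he' : e' ∈ holCharts n M) :
    ContDiffOn ℂ ω (e' ∘ e.symm) (e.target ∩ e.symm ⁻¹' e'.source) := by
  rw [← contMDiffOn_iff_contDiffOn]
  exact (contMDiffOn_of_mem_maximalAtlas he').comp
    ((contMDiffOn_symm_of_mem_maximalAtlas he).mono Set.inter_subset_left) fun z hz => hz.2

theorem coords_transition (he : e ∈ holCharts n M) (he' : e' ∈ holCharts n M) {x : M}
    (hx : x ∈ e.source) (hx' : x ∈ e'.source) (ξ : T10 n x) :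
    coords e' x ξ = fderiv ℂ (e' ∘ e.symm) (e x) (coords e x ξ) := by
  obtain ⟨z, hz, rfl⟩ : ∃ z ∈ e.target, e.symm z = x := ⟨e x, e.map_source hx, e.left_inv hx⟩
  rw [e.right_inv hz]
  have h1 : mfderiv 𝓘(ℂ, Cn n) 𝓘(ℂ, Cn n) (e' ∘ e.symm) z =
      (mfderiv 𝓘(ℂ, Cn n) 𝓘(ℂ, Cn n) e' (e.symm z)).comp
        (mfderiv 𝓘(ℂ, Cn n) 𝓘(ℂ, Cn n) e.symm z) :=
    mfderiv_comp z (mdifferentiableAt_chart he' hx') (mdifferentiableAt_chart_symm he hz)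
  rw [mfderiv_eq_fderiv] at h1
  rw [h1]
  conv_lhs => rw [← ofCoords_coords he hz ξ]
  rfl

theorem comps_transition (g : HermitianMetric n M) (he : e ∈ holCharts n M)
    (he' : e' ∈ holCharts n M) {z : Cn n} (hz : z ∈ e.target ∩ e.symm ⁻¹' e'.source) (k l : Fin n) :
    g.comps e z k l = ∑ a, ∑ b, fderiv ℂ (e' ∘ e.symm) z (stdE k) a *
      starRingEnd ℂ (fderiv ℂ (e' ∘ e.symm) z (stdE l) b) *
        g.comps e' ((e' ∘ e.symm) z) a b := by
  have h1 : g.comps e z k l = g.form (e.symm z) (coordVec e z k) (coordVec e z l) := rfl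
  rw [h1, form_eq g he' hz.2]
  have h2 : ∀ k, coords e' (e.symm z) (coordVec e z k) =
      fderiv ℂ (e' ∘ e.symm) z (stdE k) := by
    intro k
    rw [coords_transition he he' (e.map_target hz.1) hz.2, e.right_inv hz.1, coordVec_eq,
      coords_ofCoords he hz.1]
  rw [h2, h2]
  rfl

end Charts

end

/-! ### Tensoriality of the curvature -/

section
open scoped ComplexOrder

section Transition
variable {n : ℕ} {O O' : Set (Cn n)} {φ : Cn n → Cn n}

/-- The Jacobian matrix `∂_k φ^a`. -/
def jacMat (φ : Cn n → Cn n) (z : Cn n) : Matrix (Fin n) (Fin n) ℂ :=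
  Matrix.of fun k a => fderiv ℂ φ z (stdE k) a

theorem vecMul_jacMat (φ : Cn n → Cn n) (z v : Cn n) :
    Matrix.vecMul (fun k => v k) (jacMat φ z) = fun a => fderiv ℂ φ z v a := by
  funext a
  conv_rhs => rw [eq_sum_stdE v]
  simp only [map_sum, map_smul, Matrix.vecMul, dotProduct, jacMat, Matrix.of_apply]
  have : ∀ s : Fin n → Cn n, (∑ k, s k) a = ∑ k, s k a := fun s => map_sum (coordL a) s _
  rw [this]
  rfl

theorem contDiffOn_fderiv_apply (hO : IsOpen O) (hφ : ContDiffOn ℂ ω φ O) (v : Cn n) (a : Fin n) :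
    ContDiffOn ℂ ω (fun z => fderiv ℂ φ z v a) O :=
  (coordL a).contDiff.comp_contDiffOn
    ((hφ.fderiv_of_isOpen hO (m := ω) (by simp)).clm_apply contDiffOn_const)

theorem smooth_of_holomorphic {F : Type*} [NormedAddCommGroup F] [NormedSpace ℂ F]
    {f : Cn n → F} (hf : ContDiffOn ℂ ω f O) : ContDiffOn ℝ ∞ f O :=
  (hf.restrict_scalars ℝ).of_le (by simp)

variable {G G' H H' : Cn n → Matrix (Fin n) (Fin n) ℂ}

theorem wb_transition (hO : IsOpen O) (hO' : IsOpen O') (hφ : ContDiffOn ℂ ω φ O)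
    (hm : Set.MapsTo φ O O') {f : Cn n → ℂ} (hf : ContDiffOn ℝ ∞ f O') {z : Cn n} (hz : z ∈ O)
    (X : Cn n) : wb X (fun w => f (φ w)) z = wb (fderiv ℂ φ z X) f (φ z) :=
  wb_comp (differentiableAt_of_smoothOn hf hO' (hm hz))
    ((hφ.contDiffAt (hO.mem_nhds hz)).differentiableAt (by simp)).hasFDerivAt X

theorem wd_transition (hO : IsOpen O) (hO' : IsOpen O') (hφ : ContDiffOn ℂ ω φ O)
    (hm : Set.MapsTo φ O O') {f : Cn n → ℂ} (hf : ContDiffOn ℝ ∞ f O') {z : Cn n} (hz : z ∈ O)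
    (X : Cn n) : wd X (fun w => f (φ w)) z = wd (fderiv ℂ φ z X) f (φ z) :=
  wd_comp (differentiableAt_of_smoothOn hf hO' (hm hz))
    ((hφ.contDiffAt (hO.mem_nhds hz)).differentiableAt (by simp)).hasFDerivAt X

/-- No second derivatives of φ appear: after ∂̄ the coefficients are conjugates of holomorphic
Jacobian entries, and ∂ annihilates them. -/
theorem wd_wb_transition (hO : IsOpen O) (hO' : IsOpen O') (hφ : ContDiffOn ℂ ω φ O)
    (hm : Set.MapsTo φ O O') {f : Cn n → ℂ} (hf : ContDiffOn ℝ ∞ f O') {z : Cn n} (hz : z ∈ O)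
    (X Y : Cn n) : wd X (wb Y fun w => f (φ w)) z =
      wd (fderiv ℂ φ z X) (wb (fderiv ℂ φ z Y) f) (φ z) := by
  have e1 : wb Y (fun w => f (φ w)) =ᶠ[nhds z]
      fun w => ∑ a, starRingEnd ℂ (fderiv ℂ φ w Y a) * wb (stdE a) f (φ w) := by
    filter_upwards [hO.mem_nhds hz] with w hw
    rw [wb_transition hO hO' hφ hm hf hw]
    conv_lhs => rw [eq_sum_stdE (fderiv ℂ φ w Y)]
    exact wb_sum_dir _ _ _ _ _
  have hz' := hm hz
  have hhol : ∀ a, DifferentiableAt ℂ (fun w => fderiv ℂ φ w Y a) z := fun a =>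
    ((contDiffOn_fderiv_apply hO hφ Y a).contDiffAt (hO.mem_nhds hz)).differentiableAt (by simp)
  have d1 : ∀ a, DifferentiableAt ℝ (fun w => starRingEnd ℂ (fderiv ℂ φ w Y a)) z := fun a =>
    differentiableAt_of_smoothOn
      (smoothOn_conj (smooth_of_holomorphic (contDiffOn_fderiv_apply hO hφ Y a))) hO hz
  have hfb : ∀ a, ContDiffOn ℝ ∞ (wb (stdE a) f) O' := fun a => smoothOn_wb hf hO' _
  have d2 : ∀ a, DifferentiableAt ℝ (fun w => wb (stdE a) f (φ w)) z := fun a =>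
    differentiableAt_of_smoothOn ((hfb a).comp (smooth_of_holomorphic hφ) hm) hO hz
  rw [wd_congr e1, wd_sum _ fun a _ => (d1 a).fun_mul (d2 a)]
  have e2 : wb (fderiv ℂ φ z Y) f = fun w => ∑ a, starRingEnd ℂ (fderiv ℂ φ z Y a) *
      wb (stdE a) f w := by
    funext w
    conv_lhs => rw [eq_sum_stdE (fderiv ℂ φ z Y)]
    exact wb_sum_dir _ _ _ _ _
  rw [e2, wd_sum _ fun a _ => (differentiableAt_of_smoothOn (hfb a) hO' hz').const_mul _]
  refine Finset.sum_congr rfl fun a _ => ?_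
  rw [wd_mul (d1 a) (d2 a), wd_mul (differentiableAt_const _)
    (differentiableAt_of_smoothOn (hfb a) hO' hz'), wd_const, ← conj_wb,
    wb_eq_zero_of_differentiableAt (hhol a), map_zero, wd_transition hO hO' hφ hm (hfb a) hz]

/-- The curvature is a tensor. -/
theorem curvForm_transition (hO : IsOpen O) (hO' : IsOpen O') (hφ : ContDiffOn ℂ ω φ O)
    (hm : Set.MapsTo φ O O') (hG' : EntrySmoothOn G' O') (h1 : ∀ z ∈ O, H z * G z = 1)
    (h1' : ∀ z ∈ O', H' z * G' z = 1)
    (hGG' : ∀ z ∈ O, G z = jacMat φ z * G' (φ z) * (jacMat φ z).conjTranspose) {z : Cn n}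
    (hz : z ∈ O) (ξ η : Cn n) :
    curvForm G H z ξ η = curvForm G' H' (φ z) (fderiv ℂ φ z ξ) (fderiv ℂ φ z η) := by
  set ζ := fderiv ℂ φ z ξ with hζ
  set P := jacMat φ with hP
  set Q : Cn n → Matrix (Fin n) (Fin n) ℂ := fun w => (jacMat φ w).conjTranspose with hQ
  set A : Cn n → Matrix (Fin n) (Fin n) ℂ := fun w => G' (φ w) with hA
  have hz' := hm hz
  have sP : EntrySmoothOn P O := fun k a =>
    smooth_of_holomorphic (contDiffOn_fderiv_apply hO hφ (stdE k) a)
  have sQ : EntrySmoothOn Q O := fun a k => smoothOn_conj (sP k a)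
  have sA : EntrySmoothOn A O := fun k l => (hG' k l).comp (smooth_of_holomorphic hφ) hm
  have bP : ∀ w ∈ O, mwb ξ P w = 0 := by
    intro w hw
    ext k a
    exact wb_eq_zero_of_differentiableAt (((contDiffOn_fderiv_apply hO hφ (stdE k) a).contDiffAt
      (hO.mem_nhds hw)).differentiableAt (by simp)) ξ
  have dQ : ∀ w ∈ O, mwd ξ Q w = 0 := by
    intro w hw
    ext a k
    have h2 : wd ξ (fun w => conj (P w k a)) w = 0 := by
      rw [← conj_wb]
      have h3 : wb ξ (fun w => P w k a) w = 0 := congrFun (congrFun (bP w hw) k) a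
      rw [h3, map_zero]
    exact h2
  have dA : mwd ξ A z = mwd ζ G' (φ z) := by
    ext k l; exact wd_transition hO hO' hφ hm (hG' k l) hz ξ
  have bA : mwb ξ A z = mwb ζ G' (φ z) := by
    ext k l; exact wb_transition hO hO' hφ hm (hG' k l) hz ξ
  have dbA : mwd ξ (mwb ξ A) z = mwd ζ (mwb ζ G') (φ z) := by
    ext k l; exact wd_wb_transition hO hO' hφ hm (hG' k l) hz ξ ξ
  have diffP : ∀ w ∈ O, EntryDiffAt P w := fun w hw => sP.entryDiffAt hO hw
  have diffQ : ∀ w ∈ O, EntryDiffAt Q w := fun w hw => sQ.entryDiffAt hO hw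
  have diffA : ∀ w ∈ O, EntryDiffAt A w := fun w hw => sA.entryDiffAt hO hw
  have diffbA : EntryDiffAt (mwb ξ A) z := (sA.mwb hO ξ).entryDiffAt hO hz
  have diffbQ : EntryDiffAt (mwb ξ Q) z := (sQ.mwb hO ξ).entryDiffAt hO hz
  have dG : mwd ξ G z = mwd ξ P z * A z * Q z + P z * mwd ξ A z * Q z := by
    have h2 : G =ᶠ[nhds z] fun w => P w * A w * Q w := by
      filter_upwards [hO.mem_nhds hz] with w hw using hGG' w hw
    rw [mwd_congr h2, mwd_mul ((diffP z hz).mul (diffA z hz)) (diffQ z hz),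
      mwd_mul (diffP z hz) (diffA z hz), dQ z hz, Matrix.mul_zero, add_zero, Matrix.add_mul]
  have bG : ∀ w ∈ O, mwb ξ G w = P w * mwb ξ A w * Q w + P w * A w * mwb ξ Q w := by
    intro w hw
    have h2 : G =ᶠ[nhds w] fun w => P w * A w * Q w := by
      filter_upwards [hO.mem_nhds hw] with w hw using hGG' w hw
    rw [mwb_congr h2, mwb_mul ((diffP w hw).mul (diffA w hw)) (diffQ w hw),
      mwb_mul (diffP w hw) (diffA w hw), bP w hw, Matrix.zero_mul, zero_add]
  have dbQ : mwd ξ (mwb ξ Q) z = 0 := by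
    rw [← mwd_mwb_comm hO sQ hz]
    have h2 : mwd ξ Q =ᶠ[nhds z] fun _ => 0 := by
      filter_upwards [hO.mem_nhds hz] with w hw using dQ w hw
    rw [mwb_congr h2, mwb_const]
  have dbG : mwd ξ (mwb ξ G) z = mwd ξ P z * mwb ξ A z * Q z + P z * mwd ξ (mwb ξ A) z * Q z +
      (mwd ξ P z * A z * mwb ξ Q z + P z * mwd ξ A z * mwb ξ Q z) := by
    have h2 : mwb ξ G =ᶠ[nhds z] fun w => P w * mwb ξ A w * Q w + P w * A w * mwb ξ Q w := by
      filter_upwards [hO.mem_nhds hz] with w hw using bG w hw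
    rw [mwd_congr h2, mwd_add (((diffP z hz).mul diffbA).mul (diffQ z hz))
        (((diffP z hz).mul (diffA z hz)).mul diffbQ),
      mwd_mul ((diffP z hz).mul diffbA) (diffQ z hz), mwd_mul (diffP z hz) diffbA,
      mwd_mul ((diffP z hz).mul (diffA z hz)) diffbQ, mwd_mul (diffP z hz) (diffA z hz), dQ z hz,
      dbQ, Matrix.mul_zero, Matrix.mul_zero, add_zero, add_zero, Matrix.add_mul, Matrix.add_mul]
  have hinv : Q z * H z * P z = H' (φ z) := by
    have h2 := h1 z hz
    rw [hGG' z hz] at h2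
    have h3 : Q z * (H z * P z * A z) = 1 := by
      refine mul_eq_one_comm.1 ?_
      rw [← h2]
      simp only [Matrix.mul_assoc]
      rfl
    have h4 : A z * H' (φ z) = 1 := mul_eq_one_comm.1 (h1' _ hz')
    calc Q z * H z * P z = Q z * (H z * P z * A z) * H' (φ z) := by
          simp only [Matrix.mul_assoc]
          rw [h4, Matrix.mul_one]
      _ = _ := by rw [h3, Matrix.one_mul]
  have hAinv : A z * H' (φ z) = 1 := mul_eq_one_comm.1 (h1' _ hz')
  have hAinv' : H' (φ z) * A z = 1 := h1' _ hz'
  -- Here G = P A Q with ∂̄P = 0 and ∂Q = 0. Since Q H P is the inverse of A, every term containing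
  -- ∂P or ∂̄Q occurs in both ∂G H ∂̄G and ∂∂̄G, and these cancel.
  have hC : curvMat G H z ξ ξ = P z * curvMat G' H' (φ z) ζ ζ * Q z := by
    rw [curvMat, dbG, dG, bG z hz, curvMat, ← dA, ← bA, ← dbA, ← hinv]
    have h5 : (mwd ξ P z * A z * Q z + P z * mwd ξ A z * Q z) * H z *
        (P z * mwb ξ A z * Q z + P z * A z * mwb ξ Q z) =
        (mwd ξ P z * A z + P z * mwd ξ A z) * (Q z * H z * P z) *
          (mwb ξ A z * Q z + A z * mwb ξ Q z) := by noncomm_ring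
    rw [h5, hinv]
    have h6 : (mwd ξ P z * A z + P z * mwd ξ A z) * H' (φ z) *
          (mwb ξ A z * Q z + A z * mwb ξ Q z) =
        mwd ξ P z * (A z * H' (φ z)) * (mwb ξ A z * Q z + A z * mwb ξ Q z) +
        P z * (mwd ξ A z * H' (φ z) * mwb ξ A z) * Q z +
        P z * mwd ξ A z * (H' (φ z) * A z) * mwb ξ Q z := by noncomm_ring
    rw [h6, hAinv, hAinv']
    noncomm_ring
  have h7 := sum_sum_eq_dotProduct (fun k => η k) (fun l => starRingEnd ℂ (η l))
    (curvMat G H z ξ ξ)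
  have h8 := sum_sum_eq_dotProduct (fun k => fderiv ℂ φ z η k)
    (fun l => starRingEnd ℂ (fderiv ℂ φ z η l)) (curvMat G' H' (φ z) ζ ζ)
  have h9 : (Q z).mulVec (fun l => starRingEnd ℂ (η l)) =
      fun l => starRingEnd ℂ (fderiv ℂ φ z η l) := by
    funext l
    rw [← congrFun (vecMul_jacMat φ z η) l]
    simp only [Matrix.mulVec, Matrix.vecMul, dotProduct, map_sum, map_mul]
    exact Finset.sum_congr rfl fun k _ => mul_comm _ _
  rw [curvForm, curvForm, h7, h8, hC, ← Matrix.mulVec_mulVec, ← Matrix.mulVec_mulVec, h9,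
    Matrix.dotProduct_mulVec, vecMul_jacMat]

end Transition

section Curvature
variable {n : ℕ} {M : Type*} [TopologicalSpace M] [ChartedSpace (Cn n) M]
  [IsManifold 𝓘(ℂ, Cn n) ω M] {e e' : OpenPartialHomeomorph M (Cn n)}

theorem comps_inv_mul (g : HermitianMetric n M) (he : e ∈ holCharts n M) {z : Cn n}
    (hz : z ∈ e.target) : (g.comps e z)⁻¹ * g.comps e z = 1 :=
  Matrix.nonsing_inv_mul _ (isUnit_det_of_posDef (comps_posDef g he hz))

theorem chartAt_mem_holCharts (x : M) : chartAt (Cn n) x ∈ holCharts n M :=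
  IsManifold.chart_mem_maximalAtlas x

/-- The curvature in an arbitrary chart. -/
theorem curvature_eq_curvForm (g : HermitianMetric n M) (he : e ∈ holCharts n M) {x : M}
    (hx : x ∈ e.source) (ξ η : T10 n x) : g.curvature x ξ ξ η η =
      curvForm (g.comps e) (fun w => (g.comps e w)⁻¹) (e x) (coords e x ξ) (coords e x η) := by
  set c := chartAt (Cn n) x with hc
  have hcx : x ∈ c.source := mem_chart_source _ x
  have hch : c ∈ holCharts n M := chartAt_mem_holCharts x
  have h1 : g.curvature x ξ ξ η η =
      curvForm (g.comps c) (fun w => (g.comps c w)⁻¹) (c x) (coords c x ξ) (coords c x η) :=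
    sum_chernCurv c.open_target (comps_smooth g hch)
      (fun z hz => isUnit_det_of_posDef (comps_posDef g hch hz)) (c.map_source hcx) _ _
  rw [h1]
  have hz : c x ∈ c.target ∩ c.symm ⁻¹' e.source :=
    ⟨c.map_source hcx, by rw [Set.mem_preimage, c.left_inv hcx]; exact hx⟩
  rw [curvForm_transition (isOpen_transition c e) e.open_target
    (differentiableOn_transition hch he) (fun w hw => e.map_source hw.2) (comps_smooth g he)
    (fun w hw => comps_inv_mul g hch hw.1) (fun w hw => comps_inv_mul g he hw) ?_ hz,
    ← coords_transition hch he hcx hx, ← coords_transition hch he hcx hx, Function.comp_apply,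
    c.left_inv hcx]
  intro w hw
  ext k l
  rw [comps_transition g hch he hw]
  simp only [Matrix.mul_apply, Finset.sum_mul]
  rw [Finset.sum_comm]
  refine Finset.sum_congr rfl fun b _ => Finset.sum_congr rfl fun a _ => ?_
  simp only [jacMat, Matrix.of_apply, Matrix.conjTranspose_apply, RCLike.star_def]
  ring

/-- The curvature in terms of `griff`. -/
theorem curvature_eq_griff (g : HermitianMetric n M) (he : e ∈ holCharts n M) {x : M}
    (hx : x ∈ e.source) (ξ η : T10 n x) : g.curvature x ξ ξ η η =
      griff (g.comps e) (fun w => (g.comps e w)⁻¹)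
        ((e x, lowerConj (g.comps e (e x)) (coords e x η)), coords e x ξ) := by
  rw [curvature_eq_curvForm g he hx]
  exact curvForm_eq_griff e.open_target (comps_smooth g he)
    (contDiffOn_inv_entry (comps_smooth g he)
      fun z hz => isUnit_det_of_posDef (comps_posDef g he hz))
    (fun w hw => comps_inv_mul g he hw) (fun w hw => (comps_posDef g he hw).inv.isHermitian)
    (e.map_source hx) _ _

end Curvature

end

/-! ### Local bounds for derivatives of smooth families -/

section Bounds
variable {E : Type*} [NormedAddCommGroup E] [NormedSpace ℝ E] [NormedSpace ℂ E] {I : Set ℝ}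
  {O : Set E} {F : ℝ → E → ℂ}

theorem fderiv_fderiv_clm_comp {f : E → ℂ} (L : ℂ →L[ℝ] ℝ) (hf : ContDiffOn ℝ ∞ f O)
    (hO : IsOpen O) {p : E} (hp : p ∈ O) (X Y : E) :
    fderiv ℝ (fderiv ℝ fun q => L (f q)) p X Y = L (fderiv ℝ (fderiv ℝ f) p X Y) := by
  have h1 : ContDiffOn ℝ ∞ (fun q => L (f q)) O := L.contDiff.comp_contDiffOn hf
  rw [← fderiv_fderiv_apply h1 hO hp, ← fderiv_fderiv_apply hf hO hp]
  have h2 : (fun q => fderiv ℝ (fun q => L (f q)) q Y) =ᶠ[nhds p] fun q => L (fderiv ℝ f q Y) := by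
    filter_upwards [hO.mem_nhds hp] with q hq
    have := (L.hasFDerivAt.comp q (differentiableAt_of_smoothOn hf hO hq).hasFDerivAt).fderiv
    exact congrArg (fun A : E →L[ℝ] ℝ => A Y) this
  rw [h2.fderiv_eq]
  have := (L.hasFDerivAt.comp p
    (differentiableAt_of_smoothOn (smoothOn_fderiv_dir hf hO Y) hO hp).hasFDerivAt).fderiv
  exact congrArg (fun A : E →L[ℝ] ℝ => A X) this

/-- Locally uniform bounds for the Hessians of a smooth family. -/
theorem SmoothFamily.exists_hess_bound [FiniteDimensional ℝ E] (hF : SmoothFamily I O F)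
    (hI : UniqueDiffOn ℝ I) (hO : IsOpen O) {t₀ : ℝ} (ht₀ : t₀ ∈ I) {p₀ : E} (hp₀ : p₀ ∈ O) :
    ∃ C, 0 ≤ C ∧ ∀ᶠ q : ℝ × E in nhdsWithin (t₀, p₀) (I ×ˢ O), ∀ Y,
      ‖fderiv ℝ (fderiv ℝ (F q.1)) q.2 Y Y‖ ≤ C * ‖Y‖ ^ 2 := by
  set b := Module.finBasis ℝ E
  set D : ℝ × E → ℝ := fun q => ∑ i, ∑ j, ‖fderiv ℝ (fun p => fderiv ℝ (F q.1) p (b j)) q.2 (b i)‖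
    with hD
  have hDc : ContinuousOn D (I ×ˢ O) :=
    continuousOn_finsetSum _ fun i _ => continuousOn_finsetSum _ fun j _ =>
      ((hF.fderiv_dir hI hO (b j)).fderiv_dir hI hO (b i)).continuousOn.norm
  have hev : ∀ᶠ q in nhdsWithin (t₀, p₀) (I ×ˢ O), D q < D (t₀, p₀) + 1 :=
    (hDc (t₀, p₀) ⟨ht₀, hp₀⟩).eventually (gt_mem_nhds (lt_add_one _))
  set κ : ℝ := ∑ i, ‖LinearMap.toContinuousLinearMap (b.coord i)‖ with hκ
  have hκi : ∀ i Y, |b.repr Y i| ≤ κ * ‖Y‖ := by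
    intro i Y
    refine ((LinearMap.toContinuousLinearMap (b.coord i)).le_opNorm Y).trans ?_
    refine mul_le_mul_of_nonneg_right ?_ (norm_nonneg _)
    exact Finset.single_le_sum (f := fun i => ‖LinearMap.toContinuousLinearMap (b.coord i)‖)
      (fun _ _ => norm_nonneg _) (Finset.mem_univ i)
  have hκ0 : 0 ≤ κ := Finset.sum_nonneg fun _ _ => norm_nonneg _
  have hD0 : ∀ q, 0 ≤ D q := fun q =>
    Finset.sum_nonneg fun i _ => Finset.sum_nonneg fun j _ => norm_nonneg _
  refine ⟨κ ^ 2 * (D (t₀, p₀) + 1), by have := hD0 (t₀, p₀); positivity, ?_⟩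
  filter_upwards [hev, self_mem_nhdsWithin] with q hq hqm Y
  have e1 : fderiv ℝ (fderiv ℝ (F q.1)) q.2 Y Y = ∑ i, ∑ j, (b.repr Y i * b.repr Y j : ℝ) •
      fderiv ℝ (fun p => fderiv ℝ (F q.1) p (b j)) q.2 (b i) := by
    conv_lhs => rw [← b.sum_repr Y]
    simp only [map_sum, map_smul, sum_apply, smul_apply, fderiv_fderiv_apply (hF.slice hqm.1) hO hqm.2]
    simp only [Finset.smul_sum, smul_smul]
    rw [Finset.sum_comm]
    exact Finset.sum_congr rfl fun i _ => Finset.sum_congr rfl fun j _ => by rw [mul_comm]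
  rw [e1]
  calc _ ≤ ∑ i, ∑ j, (κ * ‖Y‖) * (κ * ‖Y‖) *
        ‖fderiv ℝ (fun p => fderiv ℝ (F q.1) p (b j)) q.2 (b i)‖ := by
        refine (norm_sum_le _ _).trans (Finset.sum_le_sum fun i _ =>
          (norm_sum_le _ _).trans (Finset.sum_le_sum fun j _ => ?_))
        rw [norm_smul, norm_mul]
        gcongr
        · exact hκi i Y
        · exact hκi j Y
    _ = κ ^ 2 * D q * ‖Y‖ ^ 2 := by
        simp only [hD, ← Finset.mul_sum]; ring
    _ ≤ _ := by gcongr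

/-- Locally uniform bounds for the time derivative of a smooth family. -/
theorem SmoothFamily.exists_time_bound (hF : SmoothFamily I O F) (hI : UniqueDiffOn ℝ I)
    (hO : IsOpen O) {t₀ : ℝ} (ht₀ : t₀ ∈ I) {p₀ : E} (hp₀ : p₀ ∈ O) :
    ∃ C, ∀ᶠ q : ℝ × E in nhdsWithin (t₀, p₀) (I ×ˢ O), ∃ d,
      HasDerivWithinAt (fun s => F s q.2) d I q.1 ∧ ‖d‖ ≤ C := by
  have h1 : ContinuousOn (fun q : ℝ × E =>
      fderivWithin ℝ (fun q : ℝ × E => F q.1 q.2) (I ×ˢ O) q ((1 : ℝ), (0 : E))) (I ×ˢ O) :=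
    ((ContDiffOn.continuousOn_fderivWithin hF (hI.prod hO.uniqueDiffOn) (by simp)).clm_apply
      continuousOn_const)
  refine ⟨‖fderivWithin ℝ (fun q : ℝ × E => F q.1 q.2) (I ×ˢ O) (t₀, p₀) ((1 : ℝ), (0 : E))‖ + 1, ?_⟩
  filter_upwards [(h1.norm (t₀, p₀) ⟨ht₀, hp₀⟩).eventually (gt_mem_nhds (lt_add_one _)),
    self_mem_nhdsWithin] with q hq hqm
  refine ⟨_, ?_, hq.le⟩
  have h2 := (ContDiffOn.differentiableOn hF (by simp) q hqm).hasFDerivWithinAt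
  have h3 : HasDerivWithinAt (fun s : ℝ => (s, q.2)) ((1 : ℝ), (0 : E)) I q.1 :=
    (hasDerivWithinAt_id q.1 I).prodMk (hasDerivWithinAt_const q.1 I q.2)
  exact h2.comp_hasDerivWithinAt (t := I ×ˢ O) q.1 h3 fun s hs => ⟨hs, hqm.2⟩

end Bounds

/-! ### The weak maximum principle in a chart -/

section Barrier
variable {n : ℕ}

/-- The product `|ξ|² |η|²`, as a function of `((x, α), ξ)` for the covector `α` dual to `η̄`. -/
def normProd (G H : Cn n → Matrix (Fin n) (Fin n) ℂ) (y : (Cn n × Cn n) × Cn n) : ℂ :=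
  (∑ k, ∑ l, y.2 k * starRingEnd ℂ (y.2 l) * G y.1.1 k l) *
    ∑ a, ∑ b, y.1.2 a * starRingEnd ℂ (y.1.2 b) * H y.1.1 b a

theorem sum_sum_im_eq_zero {A : Matrix (Fin n) (Fin n) ℂ} (hA : A.IsHermitian) (v : Fin n → ℂ) :
    (∑ k, ∑ l, v k * starRingEnd ℂ (v l) * A k l).im = 0 := by
  rw [sum_sum_eq_dotProduct]
  have := hA.im_star_dotProduct_mulVec_self fun l => starRingEnd ℂ (v l)
  have e : star (fun l => starRingEnd ℂ (v l)) = v := by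
    funext l; simp
  rw [e] at this
  exact this

namespace MetricFlow
variable {τ : ℝ} {O : Set (Cn n)} {G H : ℝ → Cn n → Matrix (Fin n) (Fin n) ℂ}

theorem smoothFamily_normProd (h : MetricFlow τ O G H) :
    SmoothFamily (Set.Ico 0 τ) (dom O) fun t => normProd (G t) (H t) := by
  have hm : Set.MapsTo (fun y : (Cn n × Cn n) × Cn n => y.1.1) (dom O) O := fun y hy => hy.1.1
  have h1 : ContDiff ℝ ∞ fun y : (Cn n × Cn n) × Cn n => y.1.1 := by fun_prop
  have hξ : ∀ k, SmoothFamily (Set.Ico 0 τ) (dom O)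
      fun _ (y : (Cn n × Cn n) × Cn n) => y.2 k := fun k => .of_contDiff (by fun_prop)
  have hα : ∀ k, SmoothFamily (Set.Ico 0 τ) (dom O)
      fun _ (y : (Cn n × Cn n) × Cn n) => y.1.2 k := fun k => .of_contDiff (by fun_prop)
  exact (SmoothFamily.sum fun k _ => SmoothFamily.sum fun l _ =>
      ((hξ k).mul (hξ l).star).mul ((h.smoothG k l).comp h1 hm)).mul
    (SmoothFamily.sum fun a _ => SmoothFamily.sum fun b _ =>
      ((hα a).mul (hα b).star).mul ((h.smooth b a).comp h1 hm))

/-- The curvature term, perturbed by `ε e^{Ct} |ξ|² |η|²`. -/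
def perturbed (G H : ℝ → Cn n → Matrix (Fin n) (Fin n) ℂ) (ε C t : ℝ)
    (y : (Cn n × Cn n) × Cn n) : ℝ :=
  (griff (G t) (H t) y).re + ε * Real.exp (C * t) * (normProd (G t) (H t) y).re

theorem continuousOn_perturbed (h : MetricFlow τ O G H) (ε C : ℝ) :
    ContinuousOn (fun q : ℝ × ((Cn n × Cn n) × Cn n) => perturbed G H ε C q.1 q.2)
      (Set.Ico 0 τ ×ˢ dom O) := by
  refine (Complex.continuous_re.comp_continuousOn h.continuousOn_griff).add (ContinuousOn.mul ?_
    (Complex.continuous_re.comp_continuousOn h.smoothFamily_normProd.continuousOn))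
  exact Continuous.continuousOn (by fun_prop)

/-- The maximum principle: where the perturbed curvature term is nonnegative, locally and in the
past, it is positive. -/
theorem exists_perturbed_pos (h : MetricFlow τ O G H) {t₀ : ℝ} (ht₀ : t₀ ∈ Set.Ico 0 τ)
    {y₀ : (Cn n × Cn n) × Cn n} (hy₀ : y₀.1.1 ∈ O)
    (hpos : 0 < (normProd (G t₀) (H t₀) y₀).re) :
    ∃ C₀ : ℝ, ∃ ε₀ > 0, ∀ᶠ q : ℝ × ((Cn n × Cn n) × Cn n) in
      nhdsWithin (t₀, y₀) (Set.Ico 0 τ ×ˢ dom O), ∀ C ≥ C₀, ∀ ε > 0,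
      ε * Real.exp (C * q.1) < ε₀ → 0 < q.1 →
      (∀ᶠ y in nhds q.2, 0 ≤ perturbed G H ε C q.1 y) →
      (∀ᶠ s in nhdsWithin q.1 (Set.Iio q.1), 0 ≤ perturbed G H ε C s q.2) →
      0 < perturbed G H ε C q.1 q.2 := by
  have hy₀d : y₀ ∈ dom O := ⟨⟨hy₀, trivial⟩, trivial⟩
  -- With θ = 0 only the first conclusion is of interest here: the time derivative of a touching
  -- function is almost nonnegative.
  obtain ⟨K, hK, r, hr, hev⟩ := h.exists_touching_bounds 0 ht₀ hy₀
  have hsm := h.smoothFamily_normProd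
  have hI := uniqueDiffOn_Ico τ
  obtain ⟨A, hA, hevA⟩ := hsm.exists_hess_bound hI h.isOpen_dom ht₀ hy₀d
  obtain ⟨B, hevB⟩ := hsm.exists_time_bound hI h.isOpen_dom ht₀ hy₀d
  set c := (normProd (G t₀) (H t₀) y₀).re / 2 with hc
  have hc0 : 0 < c := by positivity
  have hevc : ∀ᶠ q : ℝ × ((Cn n × Cn n) × Cn n) in
      nhdsWithin (t₀, y₀) (Set.Ico 0 τ ×ˢ dom O), c < (normProd (G q.1) (H q.1) q.2).re :=
    ((Complex.continuous_re.comp_continuousOn hsm.continuousOn) (t₀, y₀) ⟨ht₀, hy₀d⟩).eventually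
      (lt_mem_nhds (show c < _ by simp only [hc, Function.comp_apply]; linarith))
  -- If the perturbed curvature vanished, −m |ξ|² |η|² with m = ε e^{Ct} would touch the curvature
  -- from below, with Hessian at least −m A. Dividing the resulting inequality by m leaves C |ξ|²
  -- |η|² ≤ B + K A, where B bounds the time derivative of |ξ|² |η|². Since c bounds |ξ|² |η|² from
  -- below, the choice of C₀ excludes this; ε₀ ensures m A < r.
  refine ⟨max 0 ((B + K * A) / c + 1), r / (A + 1), by positivity, ?_⟩
  filter_upwards [hev, hevA, hevB, hevc, self_mem_nhdsWithin]
  rintro ⟨t, y⟩ h1 h2 h3 h4 ⟨ht, hy⟩ C hC ε hε hεr ht0 hloc hpast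
  dsimp only at h1 h2 h3 h4 ht hy hεr ht0 hloc hpast ⊢
  obtain ⟨d, hd, hdB⟩ := h3
  by_contra hneg
  set m := ε * Real.exp (C * t) with hm
  have hm0 : 0 < m := by positivity
  have h0 : perturbed G H ε C t y = 0 := le_antisymm (not_lt.1 hneg) hloc.self_of_nhds
  set L : ℂ →L[ℝ] ℝ := (-m) • Complex.reCLM with hL
  have hLa : ∀ w : ℂ, L w = -m * w.re := fun w => rfl
  have hsl := hsm.slice ht
  have hlam : m * A ∈ Set.Ico 0 r := by
    refine ⟨by positivity, ?_⟩
    have := (lt_div_iff₀ (by positivity)).1 hεr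
    nlinarith
  have hder : HasDerivAt (fun s => -(ε * Real.exp (C * s)) * (normProd (G s) (H s) y).re)
      (-(ε * (Real.exp (C * t) * C)) * (normProd (G t) (H t) y).re + -m * d.re) t := by
    have e1 : HasDerivAt (fun s => Real.exp (C * s)) (Real.exp (C * t) * C) t := by
      have := ((hasDerivAt_id t).const_mul C).exp
      simpa using this
    have e2 : HasDerivAt (fun s => (normProd (G s) (H s) y).re) d.re t :=
      Complex.reCLM.hasFDerivAt.comp_hasDerivAt t (hd.hasDerivAt (Ico_mem_nhds ht0 ht.2))
    exact (e1.const_mul ε).fun_neg.fun_mul e2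
  have hfin := (h1 ht0 (fun y' => L (normProd (G t) (H t) y'))
    (((L.contDiff.comp_contDiffOn hsl).contDiffAt (h.isOpen_dom.mem_nhds hy)).of_le two_le_infty)
    ?_ _ _ hder ?_ (m * A) hlam ?_).1
  · have hCc : (B + K * A) / c + 1 ≤ C := (le_max_right _ _).trans hC
    have hC0 : 0 ≤ C := (le_max_left _ _).trans hC
    have e1 : B + K * A < C * c := by
      have := mul_le_mul_of_nonneg_right hCc hc0.le
      rw [add_mul, div_mul_cancel₀ _ hc0.ne'] at this
      linarith
    have e2 : -B ≤ d.re := by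
      have := (abs_le.1 (Complex.abs_re_le_norm d)).1
      linarith
    have e3 : C * c ≤ C * (normProd (G t) (H t) y).re := mul_le_mul_of_nonneg_left h4.le hC0
    have e4 : 0 ≤ m * (-(C * (normProd (G t) (H t) y).re) - d.re + K * A) := by
      rw [hm] at hfin ⊢
      linarith
    have e5 := nonneg_of_mul_nonneg_right e4 hm0
    linarith
  · filter_upwards [hloc] with y' hy'
    rw [hLa, hLa]
    unfold perturbed at hy' h0
    linarith
  · filter_upwards [hpast] with s hs
    unfold perturbed at hs h0
    linarith
  · intro Y
    rw [fderiv_fderiv_clm_comp L hsl h.isOpen_dom hy, hLa]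
    have e1 := (Complex.abs_re_le_norm (fderiv ℝ (fderiv ℝ (normProd (G t) (H t))) y Y Y)).trans (h2 Y)
    have e2 := (abs_le.1 e1).2
    nlinarith

end MetricFlow
end Barrier

/-! ### Reduction to unit vectors and uniform constants on compact sets -/

section Homogeneity
variable {n : ℕ}

/-- Differentiability of f is not needed: multiplication by a nonzero constant is invertible, so the
default derivative 0 is respected as well. -/
theorem wd_const_mul {E : Type*} [NormedAddCommGroup E] [NormedSpace ℝ E] [NormedSpace ℂ E]
    (X : E) (c : ℂ) (f : E → ℂ) (p : E) : wd X (fun q => c * f q) p = c * wd X f p := by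
  by_cases hc : c = 0
  · subst hc
    simp [wd]
  have : Invertible c := invertibleOfNonzero hc
  have h : fderiv ℝ (fun q => c * f q) p = c • fderiv ℝ f p := fderiv_const_smul_of_invertible c
  simp only [wd, h, smul_apply, smul_eq_mul]
  ring

theorem griff_smul (G H : Cn n → Matrix (Fin n) (Fin n) ℂ) (z α ξ : Cn n) (a b : ℂ) :
    griff G H ((z, a • α), b • ξ) = (a * conj a) * (b * conj b) * griff G H ((z, α), ξ) := by
  have h1 : ∀ f : Cn n → ℂ, wd (b • ξ) (wb (b • ξ) f) z = b * conj b * wd ξ (wb ξ f) z := by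
    intro f
    have : wb (b • ξ) f = fun w => conj b * wb ξ f w := by
      funext w; exact wb_smul_dir b ξ f w
    rw [wd_smul_dir, this, wd_const_mul]
    ring
  have h2 : ∀ k, dHvec H ((z, a • α), b • ξ) k = a * b * dHvec H ((z, α), ξ) k := by
    intro k
    simp only [dHvec, wd_smul_dir, PiLp.smul_apply, smul_eq_mul, Finset.mul_sum]
    exact Finset.sum_congr rfl fun _ _ => by ring
  simp only [griff, h1, h2, PiLp.smul_apply, smul_eq_mul, map_mul, mul_sub, Finset.mul_sum]
  congr 1 <;> exact Finset.sum_congr rfl fun _ _ => Finset.sum_congr rfl fun _ _ => by ring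

theorem normProd_smul (G H : Cn n → Matrix (Fin n) (Fin n) ℂ) (z α ξ : Cn n) (a b : ℂ) :
    normProd G H ((z, a • α), b • ξ) = (a * conj a) * (b * conj b) * normProd G H ((z, α), ξ) := by
  have h1 : ∀ (c : ℂ) (v : Cn n) (A : Matrix (Fin n) (Fin n) ℂ),
      ∑ k, ∑ l, (c • v) k * starRingEnd ℂ ((c • v) l) * A k l =
        (c * conj c) * ∑ k, ∑ l, v k * starRingEnd ℂ (v l) * A k l := by
    intro c v A
    simp only [PiLp.smul_apply, smul_eq_mul, map_mul, Finset.mul_sum]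
    exact Finset.sum_congr rfl fun _ _ => Finset.sum_congr rfl fun _ _ => by ring
  have h2 := h1 a α (H z).transpose
  simp only [Matrix.transpose_apply] at h2
  simp only [normProd]
  rw [h1, h2]
  ring

theorem perturbed_smul (G H : ℝ → Cn n → Matrix (Fin n) (Fin n) ℂ) (ε C t : ℝ) (z α ξ : Cn n)
    (a b : ℝ) : MetricFlow.perturbed G H ε C t ((z, a • α), b • ξ) =
      (a ^ 2 * b ^ 2) * MetricFlow.perturbed G H ε C t ((z, α), ξ) := by
  have e : ((z, a • α), b • ξ) = ((z, (a : ℂ) • α), (b : ℂ) • ξ) := by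
    simp only [Complex.coe_smul]
  have e2 : (a : ℂ) * conj (a : ℂ) * ((b : ℂ) * conj (b : ℂ)) = ((a ^ 2 * b ^ 2 : ℝ) : ℂ) := by
    rw [Complex.conj_ofReal, Complex.conj_ofReal]; push_cast; ring
  rw [e, MetricFlow.perturbed, griff_smul, normProd_smul, e2, Complex.re_ofReal_mul,
    Complex.re_ofReal_mul, MetricFlow.perturbed]
  ring

/-- Homogeneity of degree two in each of α and ξ reduces positivity to coordinate unit spheres,
which are compact and do not move with the metric. -/
theorem perturbed_pos_of_sphere {G H : ℝ → Cn n → Matrix (Fin n) (Fin n) ℂ} {ε C t : ℝ} {z : Cn n}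
    (h : ∀ α ∈ Metric.sphere (0 : Cn n) 1, ∀ ξ ∈ Metric.sphere (0 : Cn n) 1,
      0 < MetricFlow.perturbed G H ε C t ((z, α), ξ)) {α ξ : Cn n} (hα : α ≠ 0) (hξ : ξ ≠ 0) :
    0 < MetricFlow.perturbed G H ε C t ((z, α), ξ) := by
  have hn : ∀ v : Cn n, v ≠ 0 → ‖v‖⁻¹ • v ∈ Metric.sphere (0 : Cn n) 1 := by
    intro v hv
    rw [mem_sphere_zero_iff_norm, norm_smul, norm_inv, norm_norm,
      inv_mul_cancel₀ (norm_ne_zero_iff.2 hv)]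
  have h1 := h _ (hn α hα) _ (hn ξ hξ)
  rw [perturbed_smul] at h1
  exact pos_of_mul_pos_right h1 (by positivity)

end Homogeneity

section Compact
variable {n : ℕ} {τ : ℝ} {O : Set (Cn n)} {G H : ℝ → Cn n → Matrix (Fin n) (Fin n) ℂ}

namespace MetricFlow

theorem normProd_pos (h : MetricFlow τ O G H) (hG : ∀ t ∈ Set.Ico 0 τ, ∀ z ∈ O, ∀ v : Fin n → ℂ,
    v ≠ 0 → 0 < (∑ k, ∑ l, v k * starRingEnd ℂ (v l) * G t z k l).re) {t : ℝ}
    (ht : t ∈ Set.Ico 0 τ) {z α ξ : Cn n} (hz : z ∈ O) (hα : α ≠ 0) (hξ : ξ ≠ 0) :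
    0 < (normProd (G t) (H t) ((z, α), ξ)).re := by
  have hne : ∀ v : Cn n, v ≠ 0 → (fun k => v k) ≠ 0 := fun v hv h0 =>
    hv (by ext k; exact congrFun h0 k)
  have h1 := hG t ht z hz _ (hne ξ hξ)
  have h2 := h.pos t ht z hz _ (hne α hα)
  have h3 := sum_sum_im_eq_zero (h.hermG t ht z hz) fun k => ξ k
  rw [normProd, Complex.mul_re, h3, zero_mul, sub_zero]
  exact mul_pos h1 h2

/-- The maximum principle with constants that are uniform on compact sets. -/
theorem exists_perturbed_pos_of_isCompact (h : MetricFlow τ O G H)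
    {S : Set (ℝ × ((Cn n × Cn n) × Cn n))} (hS : IsCompact S) (hSd : S ⊆ Set.Ico 0 τ ×ˢ dom O)
    (hpos : ∀ q ∈ S, 0 < (normProd (G q.1) (H q.1) q.2).re) :
    ∃ C₀ : ℝ, ∃ ε₀ > 0, ∀ q ∈ S, ∀ C ≥ C₀, ∀ ε > 0, ε * Real.exp (C * q.1) < ε₀ → 0 < q.1 →
      (∀ᶠ y in nhds q.2, 0 ≤ perturbed G H ε C q.1 y) →
      (∀ᶠ s in nhdsWithin q.1 (Set.Iio q.1), 0 ≤ perturbed G H ε C s q.2) →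
      0 < perturbed G H ε C q.1 q.2 := by
  refine hS.induction_on (p := fun A => ∃ C₀ : ℝ, ∃ ε₀ > 0, ∀ q ∈ A, ∀ C ≥ C₀, ∀ ε > 0,
      ε * Real.exp (C * q.1) < ε₀ → 0 < q.1 →
      (∀ᶠ y in nhds q.2, 0 ≤ perturbed G H ε C q.1 y) →
      (∀ᶠ s in nhdsWithin q.1 (Set.Iio q.1), 0 ≤ perturbed G H ε C s q.2) →
      0 < perturbed G H ε C q.1 q.2) ⟨0, 1, one_pos, fun q hq => hq.elim⟩ ?_ ?_ ?_
  · rintro A A' hA ⟨C₀, ε₀, h1, h2⟩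
    exact ⟨C₀, ε₀, h1, fun q hq => h2 q (hA hq)⟩
  · rintro A A' ⟨C₁, ε₁, h1, h2⟩ ⟨C₂, ε₂, h3, h4⟩
    refine ⟨max C₁ C₂, min ε₁ ε₂, lt_min h1 h3, ?_⟩
    rintro q (hq | hq) C hC ε hε hlt
    · exact h2 q hq C ((le_max_left _ _).trans hC) ε hε (hlt.trans_le (min_le_left _ _))
    · exact h4 q hq C ((le_max_right _ _).trans hC) ε hε (hlt.trans_le (min_le_right _ _))
  · intro q hq
    obtain ⟨C₀, ε₀, h1, h2⟩ := h.exists_perturbed_pos (hSd hq).1 (hSd hq).2.1.1 (hpos q hq)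
    exact ⟨_, nhdsWithin_mono _ hSd h2, C₀, ε₀, h1, fun q hq => hq⟩

end MetricFlow
end Compact

/-! ### The perturbed curvature on the manifold -/

section Manifold
variable {n : ℕ} {M : Type*} [TopologicalSpace M] [ChartedSpace (Cn n) M]
  [IsManifold 𝓘(ℂ, Cn n) ω M] {e : OpenPartialHomeomorph M (Cn n)}

/-- Positivity of the perturbed curvature `Ω(ξ, ξ̄, η, η̄) + ε e^{Ct} |ξ|² |η|²` at the point `x`. -/
def PerturbedPos (g : ℝ → HermitianMetric n M) (ε C t : ℝ) (x : M) : Prop :=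
  ∀ ξ η : T10 n x, ξ ≠ 0 → η ≠ 0 → 0 < ((g t).curvature x ξ ξ η η).re +
    ε * Real.exp (C * t) * (((g t).form x ξ ξ).re * ((g t).form x η η).re)

theorem form_self_im (g : HermitianMetric n M) (x : M) (ξ : T10 n x) : (g.form x ξ ξ).im = 0 :=
  Complex.conj_eq_iff_im.1 (g.conj_symm x ξ ξ).symm

/-- The covector `lowerConj G η` has the norm of `η`. -/
theorem sum_lowerConj {A B : Matrix (Fin n) (Fin n) ℂ} (hBA : B * A = 1) (hA : A.IsHermitian)
    (η : Cn n) : ∑ a, ∑ b, lowerConj A η a * starRingEnd ℂ (lowerConj A η b) * B b a =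
      ∑ k, ∑ l, η k * starRingEnd ℂ (η l) * A k l := by
  have hAB : A * B = 1 := mul_eq_one_comm.1 hBA
  have h1 : (fun b => starRingEnd ℂ (lowerConj A η b)) = Matrix.vecMul (fun k => η k) A := by
    funext b
    simp only [lowerConj_apply, Complex.conj_conj, Matrix.vecMul, dotProduct]
  have h2 : (fun b => lowerConj A η b) = A.mulVec fun l => starRingEnd ℂ (η l) := by
    funext b
    simp only [lowerConj_apply, map_sum, map_mul, Matrix.mulVec, dotProduct]
    exact Finset.sum_congr rfl fun k _ => by
      rw [← hA.apply b k, RCLike.star_def, mul_comm]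
  have h3 := sum_sum_eq_dotProduct (fun b => starRingEnd ℂ (lowerConj A η b))
    (fun b => lowerConj A η b) B
  rw [h1, h2, Matrix.mulVec_mulVec, hBA, Matrix.one_mulVec, ← Matrix.dotProduct_mulVec,
    ← sum_sum_eq_dotProduct] at h3
  rw [← h3, Finset.sum_comm]
  exact Finset.sum_congr rfl fun b _ => Finset.sum_congr rfl fun a _ => by
    rw [mul_comm (lowerConj A η a)]

theorem exists_lowerConj_eq {A B : Matrix (Fin n) (Fin n) ℂ} (hBA : B * A = 1) (α : Cn n) :
    ∃ η : Cn n, lowerConj A η = α := by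
  refine ⟨WithLp.toLp 2 (Matrix.vecMul (fun b => starRingEnd ℂ (α b)) B), ?_⟩
  ext l
  have h1 := congrFun (Matrix.vecMul_vecMul (fun b => starRingEnd ℂ (α b)) B A) l
  rw [hBA, Matrix.vecMul_one] at h1
  rw [lowerConj_apply]
  have h2 : ∑ k, (WithLp.toLp 2 (Matrix.vecMul (fun b => starRingEnd ℂ (α b)) B) : Cn n) k * A k l =
      starRingEnd ℂ (α l) := h1
  rw [h2, Complex.conj_conj]

theorem lowerConj_zero (A : Matrix (Fin n) (Fin n) ℂ) : lowerConj A 0 = 0 := by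
  ext l
  simp [lowerConj_apply]

theorem lowerConj_ne_zero {A B : Matrix (Fin n) (Fin n) ℂ} (hBA : B * A = 1) {η : Cn n}
    (hη : η ≠ 0) : lowerConj A η ≠ 0 := by
  intro h0
  apply hη
  have h1 : Matrix.vecMul (fun k => η k) A = 0 := by
    funext l
    have h2 : conj (∑ k, η k * A k l) = 0 := by
      have : lowerConj A η l = 0 := by rw [h0]; rfl
      exact this
    exact (map_eq_zero (starRingEnd ℂ)).1 h2
  have h2 := congrArg (fun v => Matrix.vecMul v B) h1
  simp only [Matrix.vecMul_vecMul, mul_eq_one_comm.1 hBA, Matrix.vecMul_one,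
    Matrix.zero_vecMul] at h2
  ext k
  exact congrFun h2 k

/-- The components of a family of metrics in a chart. -/
abbrev compsFamily (g : ℝ → HermitianMetric n M) (e : OpenPartialHomeomorph M (Cn n)) :
    ℝ → Cn n → Matrix (Fin n) (Fin n) ℂ := fun t z => (g t).comps e z

/-- The inverse components of a family of metrics in a chart. -/
abbrev invFamily (g : ℝ → HermitianMetric n M) (e : OpenPartialHomeomorph M (Cn n)) :
    ℝ → Cn n → Matrix (Fin n) (Fin n) ℂ := fun t z => ((g t).comps e z)⁻¹

/-- Taking components and passing from η to the covector dual to η̄ are bijections that fix zero and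
match the norms. The invariant condition can thus be tested in any chart, which lets the chartwise
maximum principle act globally. -/
theorem perturbedPos_iff (g : ℝ → HermitianMetric n M) (he : e ∈ holCharts n M) (ε C t : ℝ) {x : M}
    (hx : x ∈ e.source) : PerturbedPos g ε C t x ↔ ∀ α ξ : Cn n, α ≠ 0 → ξ ≠ 0 →
      0 < MetricFlow.perturbed (compsFamily g e) (invFamily g e) ε C t ((e x, α), ξ) := by
  have hBA := comps_inv_mul (g t) he (e.map_source hx)
  have key : ∀ ξ η : T10 n x, ((g t).curvature x ξ ξ η η).re +
      ε * Real.exp (C * t) * (((g t).form x ξ ξ).re * ((g t).form x η η).re) =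
      MetricFlow.perturbed (compsFamily g e) (invFamily g e) ε C t
        ((e x, lowerConj ((g t).comps e (e x)) (coords e x η)), coords e x ξ) := by
    intro ξ η
    rw [curvature_eq_griff (g t) he hx, MetricFlow.perturbed, normProd,
      sum_lowerConj hBA (comps_isHermitian (g t) _)]
    dsimp only
    rw [← form_eq (g t) he hx, ← form_eq (g t) he hx, Complex.mul_re, form_self_im, zero_mul,
      sub_zero]
  constructor
  · intro h α ξ hα hξ
    obtain ⟨η, rfl⟩ := exists_lowerConj_eq hBA α
    obtain ⟨z, hz, rfl⟩ : ∃ z ∈ e.target, e.symm z = x := ⟨e x, e.map_source hx, e.left_inv hx⟩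
    have hne : ∀ v : Cn n, v ≠ 0 → ofCoords e z v ≠ 0 := by
      intro v hv h0
      have := coords_ofCoords he hz v
      rw [h0] at this
      exact hv (this.symm.trans (map_zero _))
    have h1 := h (ofCoords e z ξ) (ofCoords e z η) (hne ξ hξ)
      (hne η fun h0 => hα (by rw [h0, lowerConj_zero]))
    rw [key, coords_ofCoords he hz, coords_ofCoords he hz] at h1
    exact h1
  · intro h ξ η hξ hη
    rw [key]
    exact h _ _ (lowerConj_ne_zero hBA fun h0 => hη (coords_eq_zero he hx h0))
      fun h0 => hξ (coords_eq_zero he hx h0)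

end Manifold

/-! ### Preservation of Griffiths non-negativity -/

section
open scoped ComplexOrder

section MaxPrinciple
variable {n : ℕ} {M : Type*} [TopologicalSpace M] [ChartedSpace (Cn n) M]
  [IsManifold 𝓘(ℂ, Cn n) ω M] {τ : ℝ} {g : ℝ → HermitianMetric n M}

theorem sum_comps_pos (g : HermitianMetric n M) {e : OpenPartialHomeomorph M (Cn n)}
    (he : e ∈ holCharts n M) {z : Cn n} (hz : z ∈ e.target) (v : Fin n → ℂ) (hv : v ≠ 0) :
    0 < (∑ k, ∑ l, v k * starRingEnd ℂ (v l) * g.comps e z k l).re := by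
  rw [sum_sum_eq_dotProduct]
  have hne : (fun l => starRingEnd ℂ (v l)) ≠ 0 := fun h0 =>
    hv (funext fun k => (map_eq_zero (starRingEnd ℂ)).1 (congrFun h0 k))
  have h1 := (Complex.pos_iff.1 ((comps_posDef g he hz).dotProduct_mulVec_pos hne)).1
  have e1 : star (fun l => starRingEnd ℂ (v l)) = v := by funext l; simp
  rwa [e1] at h1

theorem IsHCF.normProd_pos (hg : IsHCF τ g) {e : OpenPartialHomeomorph M (Cn n)}
    (he : e ∈ holCharts n M) {t : ℝ} (ht : t ∈ Set.Ico 0 τ) {z α ξ : Cn n} (hz : z ∈ e.target)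
    (hα : α ≠ 0) (hξ : ξ ≠ 0) :
    0 < (normProd (compsFamily g e t) (invFamily g e t) ((z, α), ξ)).re :=
  (hg.metricFlow he).normProd_pos (fun t _ _ hz => sum_comps_pos (g t) he hz) ht hz hα hξ

/-- A compact neighbourhood of `e x₀` in coordinates, with the unit spheres over it. -/
theorem exists_ball_subset_target {e : OpenPartialHomeomorph M (Cn n)} {x₀ : M}
    (hx₀ : x₀ ∈ e.source) : ∃ δ > 0, Metric.closedBall (e x₀) δ ⊆ e.target ∧
      e.source ∩ e ⁻¹' Metric.closedBall (e x₀) δ ∈ nhds x₀ := by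
  obtain ⟨δ, hδ, hsub⟩ := Metric.nhds_basis_closedBall.mem_iff.1
    (e.open_target.mem_nhds (e.map_source hx₀))
  exact ⟨δ, hδ, hsub, Filter.inter_mem (e.open_source.mem_nhds hx₀)
    ((e.continuousAt hx₀) (Metric.closedBall_mem_nhds _ hδ))⟩

/-- The bundle of pairs of unit vectors over a closed ball. -/
def sphereBundle (z₀ : Cn n) (δ : ℝ) : Set ((Cn n × Cn n) × Cn n) :=
  (Metric.closedBall z₀ δ ×ˢ Metric.sphere 0 1) ×ˢ Metric.sphere 0 1

theorem isCompact_sphereBundle (z₀ : Cn n) (δ : ℝ) : IsCompact (sphereBundle z₀ δ) :=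
  ((isCompact_closedBall z₀ δ).prod (isCompact_sphere 0 1)).prod (isCompact_sphere 0 1)

theorem ne_zero_of_mem_sphere_one {v : Cn n} (hv : v ∈ Metric.sphere (0 : Cn n) 1) : v ≠ 0 := by
  rintro rfl
  simp at hv

theorem perturbedPos_of_sphere (g : ℝ → HermitianMetric n M) {e : OpenPartialHomeomorph M (Cn n)}
    (he : e ∈ holCharts n M) {ε C t : ℝ} {x : M} (hx : x ∈ e.source)
    (h : ∀ α ∈ Metric.sphere (0 : Cn n) 1, ∀ ξ ∈ Metric.sphere (0 : Cn n) 1,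
      0 < MetricFlow.perturbed (compsFamily g e) (invFamily g e) ε C t ((e x, α), ξ)) :
    PerturbedPos g ε C t x :=
  (perturbedPos_iff g he ε C t hx).2 fun _ _ hα hξ => perturbed_pos_of_sphere h hα hξ

theorem tendsto_left_of_continuousOn {E : Type*} [TopologicalSpace E] {f : ℝ × E → ℝ} {D : Set E}
    (h : ContinuousOn f (Set.Ico 0 τ ×ˢ D)) {t : ℝ} (ht : t ∈ Set.Ioo 0 τ) {y : E} (hy : y ∈ D) :
    Filter.Tendsto (fun s => f (s, y)) (nhdsWithin t (Set.Iio t)) (nhds (f (t, y))) := by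
  have h2 : Filter.Tendsto (fun s : ℝ => (s, y)) (nhdsWithin t (Set.Iio t))
      (nhdsWithin (t, y) (Set.Ico 0 τ ×ˢ D)) := by
    refine tendsto_nhdsWithin_iff.2 ⟨?_, ?_⟩
    · have : Continuous fun s : ℝ => (s, y) := by fun_prop
      exact (this.tendsto t).mono_left nhdsWithin_le_nhds
    · filter_upwards [Ico_mem_nhdsLT ht.1] with s hs
      exact ⟨⟨hs.1, hs.2.trans ht.2⟩, hy⟩
  exact Filter.Tendsto.comp (h (t, y) ⟨⟨ht.1.le, ht.2⟩, hy⟩) h2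

/-- Positivity at all earlier times passes to the limit from the left. Near a pair of nonzero
vectors all vectors are nonzero, so a full spatial neighbourhood is covered, as the touching
argument demands. -/
theorem MetricFlow.eventually_perturbed_nonneg_of_past {O : Set (Cn n)}
    {G H : ℝ → Cn n → Matrix (Fin n) (Fin n) ℂ} (h : MetricFlow τ O G H) {ε C : ℝ} {t : ℝ}
    (ht : t ∈ Set.Ioo 0 τ) {z α ξ : Cn n} (hz : z ∈ O) (hα : α ≠ 0) (hξ : ξ ≠ 0)
    (hpast : ∀ s ∈ Set.Ico 0 t, ∀ y : (Cn n × Cn n) × Cn n, y.1.1 ∈ O → y.1.2 ≠ 0 → y.2 ≠ 0 →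
      0 < MetricFlow.perturbed G H ε C s y) :
    ∀ᶠ y in nhds ((z, α), ξ), 0 ≤ MetricFlow.perturbed G H ε C t y := by
  have h1 : ∀ᶠ y : (Cn n × Cn n) × Cn n in nhds ((z, α), ξ), y.1.1 ∈ O :=
    (continuous_fst.fst.tendsto ((z, α), ξ)).eventually (h.isOpen.mem_nhds hz)
  have h2 : ∀ᶠ y : (Cn n × Cn n) × Cn n in nhds ((z, α), ξ), y.1.2 ≠ 0 :=
    (continuous_fst.snd.tendsto ((z, α), ξ)).eventually_ne hα
  have h3 : ∀ᶠ y : (Cn n × Cn n) × Cn n in nhds ((z, α), ξ), y.2 ≠ 0 :=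
    (continuous_snd.tendsto ((z, α), ξ)).eventually_ne hξ
  filter_upwards [h1, h2, h3] with y hy1 hy2 hy3
  have hD : y ∈ MetricFlow.dom O := ⟨⟨hy1, trivial⟩, trivial⟩
  refine ge_of_tendsto (tendsto_left_of_continuousOn (h.continuousOn_perturbed ε C) ht hD) ?_
  filter_upwards [Ico_mem_nhdsLT ht.1] with s hs
  exact (hpast s hs y hy1 hy2 hy3).le

variable [CompactSpace M]

/-- Positivity of the perturbed curvature is an open condition in time. -/
theorem IsHCF.eventually_perturbedPos (hg : IsHCF τ g) {ε C t : ℝ} (ht : t ∈ Set.Ico 0 τ)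
    (h : ∀ x, PerturbedPos g ε C t x) :
    ∀ᶠ s in nhdsWithin t (Set.Ico 0 τ), ∀ x, PerturbedPos g ε C s x := by
  have := (isCompact_univ (X := M)).induction_on
    (p := fun A => ∀ᶠ s in nhdsWithin t (Set.Ico 0 τ), ∀ x ∈ A, PerturbedPos g ε C s x)
    (by simp) (fun A B hAB hB => hB.mono fun s hs x hx => hs x (hAB hx))
    (fun A B hA hB => (hA.and hB).mono fun s hs x hx => hx.elim (hs.1 x) (hs.2 x)) ?_
  · exact this.mono fun s hs x => hs x trivial
  intro x₀ _
  set e := chartAt (Cn n) x₀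
  have he : e ∈ holCharts n M := chartAt_mem_holCharts x₀
  have hfl := hg.metricFlow he
  obtain ⟨δ, hδ, hsub, hnhds⟩ := exists_ball_subset_target (mem_chart_source (Cn n) x₀)
  refine ⟨_, mem_nhdsWithin_of_mem_nhds hnhds, ?_⟩
  have hev : ∀ᶠ s in nhds t, ∀ y ∈ sphereBundle (e x₀) δ, s ∈ Set.Ico 0 τ →
      0 < MetricFlow.perturbed (compsFamily g e) (invFamily g e) ε C s y := by
    refine (isCompact_sphereBundle (e x₀) δ).eventually_forall_of_forall_eventually ?_
    rintro ⟨⟨z, α⟩, ξ⟩ ⟨⟨hz, hα⟩, hξ⟩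
    have hyd : ((z, α), ξ) ∈ MetricFlow.dom e.target := ⟨⟨hsub hz, trivial⟩, trivial⟩
    have hpos : 0 < MetricFlow.perturbed (compsFamily g e) (invFamily g e) ε C t ((z, α), ξ) := by
      have h1 := (perturbedPos_iff g he ε C t (e.map_target (hsub hz))).1 (h _) α ξ
        (ne_zero_of_mem_sphere_one hα) (ne_zero_of_mem_sphere_one hξ)
      rwa [e.right_inv (hsub hz)] at h1
    have h2 := (hfl.continuousOn_perturbed ε C (t, ((z, α), ξ)) ⟨ht, hyd⟩).eventually
      (lt_mem_nhds hpos)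
    have h3 : ∀ᶠ q : ℝ × ((Cn n × Cn n) × Cn n) in nhds (t, ((z, α), ξ)),
        q.2 ∈ MetricFlow.dom e.target :=
      continuous_snd.continuousAt (hfl.isOpen_dom.mem_nhds hyd)
    filter_upwards [eventually_nhdsWithin_iff.1 h2, h3] with q h4 h5 h6 using h4 ⟨h6, h5⟩
  filter_upwards [nhdsWithin_le_nhds hev, self_mem_nhdsWithin] with s hs hsI x hx
  exact perturbedPos_of_sphere g he hx.1 fun α hα ξ hξ => hs ((e x, α), ξ) ⟨⟨hx.2, hα⟩, hξ⟩ hsI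

/-- Positivity of the perturbed curvature cannot be lost for the first time. -/
theorem IsHCF.exists_perturbedPos_of_past (hg : IsHCF τ g) {t₁ : ℝ} (ht₁ : t₁ < τ) :
    ∃ C₀ : ℝ, ∃ ε₀ > 0, ∀ C ≥ C₀, ∀ ε > 0, ∀ t ∈ Set.Ioc 0 t₁, ε * Real.exp (C * t) < ε₀ →
      (∀ s ∈ Set.Ico 0 t, ∀ x, PerturbedPos g ε C s x) → ∀ x, PerturbedPos g ε C t x := by
  have := (isCompact_univ (X := M)).induction_on
    (p := fun A => ∃ C₀ : ℝ, ∃ ε₀ > 0, ∀ C ≥ C₀, ∀ ε > 0, ∀ t ∈ Set.Ioc 0 t₁,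
      ε * Real.exp (C * t) < ε₀ →
      (∀ s ∈ Set.Ico 0 t, ∀ x, PerturbedPos g ε C s x) → ∀ x ∈ A, PerturbedPos g ε C t x)
    ⟨0, 1, one_pos, by simp⟩ ?_ ?_ ?_
  · obtain ⟨C₀, ε₀, h1, h2⟩ := this
    exact ⟨C₀, ε₀, h1, fun C hC ε hε t ht hlt hp x => h2 C hC ε hε t ht hlt hp x trivial⟩
  · rintro A B hAB ⟨C₀, ε₀, h1, h2⟩
    exact ⟨C₀, ε₀, h1, fun C hC ε hε t ht hlt hp x hx => h2 C hC ε hε t ht hlt hp x (hAB hx)⟩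
  · rintro A B ⟨C₁, ε₁, h1, h2⟩ ⟨C₂, ε₂, h3, h4⟩
    refine ⟨max C₁ C₂, min ε₁ ε₂, lt_min h1 h3, ?_⟩
    rintro C hC ε hε t ht hlt hp x (hx | hx)
    · exact h2 C ((le_max_left _ _).trans hC) ε hε t ht (hlt.trans_le (min_le_left _ _)) hp x hx
    · exact h4 C ((le_max_right _ _).trans hC) ε hε t ht (hlt.trans_le (min_le_right _ _)) hp x hx
  intro x₀ _
  set e := chartAt (Cn n) x₀
  have he : e ∈ holCharts n M := chartAt_mem_holCharts x₀
  have hfl := hg.metricFlow he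
  obtain ⟨δ, hδ, hsub, hnhds⟩ := exists_ball_subset_target (mem_chart_source (Cn n) x₀)
  have hSd : Set.Icc 0 t₁ ×ˢ sphereBundle (e x₀) δ ⊆ Set.Ico 0 τ ×ˢ MetricFlow.dom e.target := by
    rintro ⟨t, ⟨z, α⟩, ξ⟩ ⟨ht, ⟨hz, -⟩, -⟩
    exact ⟨⟨ht.1, ht.2.trans_lt ht₁⟩, ⟨⟨hsub hz, trivial⟩, trivial⟩⟩
  obtain ⟨C₀, ε₀, hε₀, hmain⟩ := hfl.exists_perturbed_pos_of_isCompact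
    (isCompact_Icc.prod (isCompact_sphereBundle (e x₀) δ)) hSd (by
      rintro ⟨t, ⟨z, α⟩, ξ⟩ ⟨ht, ⟨hz, hα⟩, hξ⟩
      exact hg.normProd_pos he ⟨ht.1, ht.2.trans_lt ht₁⟩ (hsub hz)
        (ne_zero_of_mem_sphere_one hα) (ne_zero_of_mem_sphere_one hξ))
  refine ⟨_, mem_nhdsWithin_of_mem_nhds hnhds, C₀, ε₀, hε₀, ?_⟩
  intro C hC ε hε t ht hlt hpast x hx
  refine perturbedPos_of_sphere g he hx.1 fun α hα ξ hξ => ?_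
  have htτ : t < τ := ht.2.trans_lt ht₁
  -- positivity at earlier times
  have hpast' : ∀ s ∈ Set.Ico 0 t, ∀ z ∈ e.target, ∀ α' ξ' : Cn n, α' ≠ 0 → ξ' ≠ 0 →
      0 < MetricFlow.perturbed (compsFamily g e) (invFamily g e) ε C s ((z, α'), ξ') := by
    intro s hs z hz α' ξ' hα' hξ'
    have h1 := (perturbedPos_iff g he ε C s (e.map_target hz)).1 (hpast s hs _) α' ξ' hα' hξ'
    rwa [e.right_inv hz] at h1
  have hleft : Set.Ico 0 t ∈ nhdsWithin t (Set.Iio t) := Ico_mem_nhdsLT ht.1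
  have hxt : e x ∈ e.target := e.map_source hx.1
  have hα0 := ne_zero_of_mem_sphere_one hα
  have hξ0 := ne_zero_of_mem_sphere_one hξ
  refine hmain (t, ((e x, α), ξ)) ⟨⟨ht.1.le, ht.2⟩, ⟨⟨hx.2, hα⟩, hξ⟩⟩ C hC ε hε hlt ht.1 ?_ ?_
  · exact hfl.eventually_perturbed_nonneg_of_past ⟨ht.1, htτ⟩ hxt hα0 hξ0
      fun s hs y h1 h2 h3 => hpast' s hs y.1.1 h1 y.1.2 y.2 h2 h3
  · filter_upwards [hleft] with s hs
    exact (hpast' s hs _ hxt _ _ hα0 hξ0).le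

theorem curvature_zero_left (g : HermitianMetric n M) (x : M) (η : T10 n x) :
    g.curvature x 0 0 η η = 0 := by
  have : coords (chartAt (Cn n) x) x (0 : T10 n x) = 0 := map_zero _
  simp [HermitianMetric.curvature, this]

theorem curvature_zero_right (g : HermitianMetric n M) (x : M) (ξ : T10 n x) :
    g.curvature x ξ ξ 0 0 = 0 := by
  have : coords (chartAt (Cn n) x) x (0 : T10 n x) = 0 := map_zero _
  simp [HermitianMetric.curvature, this]

/-- Griffiths non-negativity is preserved by the Hermitian curvature flow. -/
theorem IsHCF.griffithsNonneg (hg : IsHCF τ g) (h₀ : (g 0).GriffithsNonneg) {t₁ : ℝ}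
    (ht₁ : t₁ ∈ Set.Ico 0 τ) : (g t₁).GriffithsNonneg := by
  obtain ⟨C₀, ε₀, hε₀, hmain⟩ := hg.exists_perturbedPos_of_past ht₁.2
  -- With C ≥ 0, smallness of ε e^{Ct} at t₁ implies it at every earlier time.
  set C := max C₀ 0 with hC
  have hpos : ∀ ε > 0, ε * Real.exp (C * t₁) < ε₀ → ∀ t ∈ Set.Icc 0 t₁, ∀ x,
      PerturbedPos g ε C t x := by
    intro ε hε hlt
    by_contra! hbad
    -- Times of failure. Positivity holds before the infimum by definition, at the infimum by the
    -- maximum principle (or by the initial condition at time 0), and shortly afterwards by openness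
    -- in time; this contradicts the infimum.
    set B : Set ℝ := {t | t ∈ Set.Icc 0 t₁ ∧ ∃ x, ¬ PerturbedPos g ε C t x} with hB
    have hBne : B.Nonempty := by
      obtain ⟨t, ht, x, hx⟩ := hbad
      exact ⟨t, ht, x, hx⟩
    have hBbd : BddBelow B := ⟨0, fun t ht => ht.1.1⟩
    set s := sInf B with hs
    have hs0 : 0 ≤ s := le_csInf hBne fun t ht => ht.1.1
    have hs1 : s ≤ t₁ := by
      obtain ⟨t, ht⟩ := hBne
      exact (csInf_le hBbd ht).trans ht.1.2
    have hbefore : ∀ r ∈ Set.Ico 0 s, ∀ x, PerturbedPos g ε C r x := by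
      intro r hr x
      by_contra hx
      exact (notMem_of_lt_csInf hr.2 hBbd) ⟨⟨hr.1, hr.2.le.trans hs1⟩, x, hx⟩
    have hat : ∀ x, PerturbedPos g ε C s x := by
      rcases hs0.eq_or_lt with h0 | h0
      · intro x ξ η hξ hη
        rw [← h0]
        have h1 := h₀ x ξ η
        have h2 : 0 < ε * Real.exp (C * 0) *
            (((g 0).form x ξ ξ).re * ((g 0).form x η η).re) :=
          mul_pos (by positivity) (mul_pos ((g 0).pos x ξ hξ) ((g 0).pos x η hη))
        linarith
      · refine hmain C (le_max_left _ _) ε hε s ⟨h0, hs1⟩ (lt_of_le_of_lt ?_ hlt) hbefore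
        have : 0 ≤ C := le_max_right _ _
        gcongr
    have hev := hg.eventually_perturbedPos ⟨hs0, hs1.trans_lt ht₁.2⟩ hat
    obtain ⟨δ, hδ, hball⟩ := Metric.mem_nhdsWithin_iff.1 hev
    obtain ⟨b, hb, hbs⟩ := exists_lt_of_csInf_lt hBne (show sInf B < s + δ by linarith)
    have hsb : s ≤ b := csInf_le hBbd hb
    obtain ⟨x, hx⟩ := hb.2
    exact hx (hball ⟨by rw [Metric.mem_ball, Real.dist_eq, abs_lt]; constructor <;> linarith,
      ⟨hb.1.1, hb.1.2.trans_lt ht₁.2⟩⟩ x)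
  intro x ξ η
  by_cases hξ : ξ = 0
  · rw [hξ, curvature_zero_left]; simp
  by_cases hη : η = 0
  · rw [hη, curvature_zero_right]; simp
  by_contra! hneg
  set N := Real.exp (C * t₁) * (((g t₁).form x ξ ξ).re * ((g t₁).form x η η).re) with hN
  have hN0 : 0 < N := mul_pos (Real.exp_pos _) (mul_pos ((g t₁).pos x ξ hξ) ((g t₁).pos x η hη))
  set κ := ((g t₁).curvature x ξ ξ η η).re with hκ
  -- The first bound makes the perturbation at most half of |κ|, too small to offset the negative
  -- curvature κ. The second is the smallness condition of the maximum principle.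
  set ε := min (-κ / (2 * N)) (ε₀ / (2 * Real.exp (C * t₁))) with hε
  have hε0 : 0 < ε := lt_min (div_pos (by linarith) (by positivity)) (by positivity)
  have h1 : ε * Real.exp (C * t₁) < ε₀ := by
    have := (le_div_iff₀ (by positivity)).1 (min_le_right (-κ / (2 * N))
      (ε₀ / (2 * Real.exp (C * t₁))))
    rw [← hε] at this
    linarith
  have h2 := hpos ε hε0 h1 t₁ ⟨ht₁.1, le_rfl⟩ x ξ η hξ hη
  have h3 := (le_div_iff₀ (by positivity)).1 (min_le_left (-κ / (2 * N))
      (ε₀ / (2 * Real.exp (C * t₁))))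
  rw [← hε] at h3
  rw [mul_assoc, ← hN, ← hκ] at h2
  linarith

end MaxPrinciple

end

/-! ### Torsion-twisted transport as an integral curve -/

section
open scoped ComplexOrder

section Transport
variable {n : ℕ} {O : Set (Cn n)} {G : Cn n → Matrix (Fin n) (Fin n) ℂ}

/-- The covector `θ` for which `θ̄` is dual to `w`. -/
def dualVelocity (A : Matrix (Fin n) (Fin n) ℂ) (w : Fin n → ℂ) (c : Fin n) : ℂ :=
  conj (∑ i, w i * A i c)

theorem sum_dualVelocity_mul (A X : Matrix (Fin n) (Fin n) ℂ) (w : Fin n → ℂ) (m : Fin n) :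
    ∑ r, conj (dualVelocity A w r) * X r m = ∑ i, w i * (A * X) i m := by
  have h := congrFun (Matrix.vecMul_vecMul w A X) m
  simpa only [Matrix.vecMul, dotProduct, dualVelocity, Complex.conj_conj] using h

theorem mul_mwd_inv (hO : IsOpen O) (hG : EntrySmoothOn G O) (hdet : ∀ z ∈ O, IsUnit (G z).det)
    {z : Cn n} (hz : z ∈ O) (X : Cn n) :
    G z * mwd X (fun w => (G w)⁻¹) z = -(mwd X G z * (G z)⁻¹) := by
  have hH : EntrySmoothOn (fun w => (G w)⁻¹) O := contDiffOn_inv_entry hG hdet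
  have h := mwd_mul (hG.entryDiffAt hO hz) (hH.entryDiffAt hO hz) X
  have h3 : (fun q => G q * (G q)⁻¹) =ᶠ[nhds z] fun _ => 1 := by
    filter_upwards [hO.mem_nhds hz] with w hw using Matrix.mul_nonsing_inv _ (hdet w hw)
  rw [mwd_congr h3, mwd_const] at h
  exact eq_neg_of_add_eq_zero_right h.symm

theorem wd_eq_sum (w : Cn n) (f : Cn n → ℂ) (z : Cn n) :
    wd w f z = ∑ i, w i * wd (stdE i) f z := by
  conv_lhs => rw [eq_sum_stdE w]
  exact wd_sum_dir _ _ _ _ _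

theorem wb_eq_sum (w : Cn n) (f : Cn n → ℂ) (z : Cn n) :
    wb w f z = ∑ i, conj (w i) * wb (stdE i) f z := by
  conv_lhs => rw [eq_sum_stdE w]
  exact wb_sum_dir _ _ _ _ _

theorem chernSymbol_eq_mul (z : Cn n) (i j k : Fin n) :
    chernSymbol G z i j k = (mwd (stdE i) G z * (G z)⁻¹) j k := by
  simp only [chernSymbol, Matrix.mul_apply, mwd_apply, dz_eq_wd]

theorem twistField_base (hdet : ∀ z ∈ O, IsUnit (G z).det) {z : Cn n} (hz : z ∈ O)
    (w : Cn n) (m : Fin n) :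
    ∑ r, conj (dualVelocity (G z) w r) * (G z)⁻¹ r m = w m := by
  rw [sum_dualVelocity_mul, Matrix.mul_nonsing_inv _ (hdet z hz)]
  simp [Matrix.one_apply]

/-- As θ̄ is the contraction of w with G, the left side is −w ∂_v G · G⁻¹, that is −Γ_{ji}^m w^i v^j
with the lower indices exchanged. The twist by the torsion is precisely this exchange: −Γ_{ij} +
T_{ij} = −Γ_{ji}. -/
theorem twistField_vector (hO : IsOpen O) (hG : EntrySmoothOn G O)
    (hdet : ∀ z ∈ O, IsUnit (G z).det) {z : Cn n} (hz : z ∈ O) (v w : Cn n) (m : Fin n) :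
    ∑ r, conj (dualVelocity (G z) w r) * wd v (fun q => (G q)⁻¹ r m) z =
      -(∑ i, ∑ j, chernSymbol G z i j m * w i * v j) +
        ∑ i, ∑ j, torsion G z i j m * w i * v j := by
  have h1 := sum_dualVelocity_mul (G z) (mwd v (fun q => (G q)⁻¹) z) w m
  simp only [mwd_apply] at h1
  rw [h1, mul_mwd_inv hO hG hdet hz]
  have h2 : ∀ i, (mwd v G z * (G z)⁻¹) i m = ∑ j, v j * chernSymbol G z j i m := by
    intro i
    simp only [chernSymbol_eq_mul, Matrix.mul_apply, mwd_apply, Finset.mul_sum]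
    rw [Finset.sum_comm]
    refine Finset.sum_congr rfl fun l _ => ?_
    rw [wd_eq_sum, Finset.sum_mul]
    exact Finset.sum_congr rfl fun j _ => by ring
  simp only [Matrix.neg_apply, h2, torsion]
  rw [← Finset.sum_neg_distrib, ← Finset.sum_add_distrib]
  refine Finset.sum_congr rfl fun i _ => ?_
  rw [mul_neg, Finset.mul_sum, ← Finset.sum_neg_distrib, ← Finset.sum_neg_distrib,
    ← Finset.sum_add_distrib]
  exact Finset.sum_congr rfl fun j _ => by ring

theorem inv_mulVec_lowerConj {A : Matrix (Fin n) (Fin n) ℂ} (hA : A.IsHermitian)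
    (hdet : IsUnit A.det) (u : Cn n) (c : Fin n) :
    ∑ a, A⁻¹ c a * lowerConj A u a = conj (u c) := by
  have h1 : (fun a => lowerConj A u a) = A.mulVec fun k => conj (u k) := by
    funext a
    simp only [lowerConj_apply, Matrix.mulVec, dotProduct, map_sum, map_mul]
    exact Finset.sum_congr rfl fun k _ => by
      rw [← hA.apply a k, RCLike.star_def, mul_comm]
  have h2 : A⁻¹.mulVec (fun a => lowerConj A u a) = fun k => conj (u k) := by
    rw [h1, Matrix.mulVec_mulVec, Matrix.nonsing_inv_mul _ hdet, Matrix.one_mulVec]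
  exact congrFun h2 c

/-- Again ∂_m H is traded for −H ∂_m G H; raising the dual covector returns ū. The right side is the
derivative found in `hasDerivWithinAt_lowerConj`. -/
theorem twistField_covector (hO : IsOpen O) (hG : EntrySmoothOn G O)
    (hdet : ∀ z ∈ O, IsUnit (G z).det) (hherm : ∀ z ∈ O, (G z).IsHermitian) {z : Cn n}
    (hz : z ∈ O) (u w : Cn n) (m : Fin n) :
    -∑ r, conj (dualVelocity (G z) w r) *
        ∑ a, lowerConj (G z) u a * wd (stdE m) (fun q => (G q)⁻¹ r a) z =
      conj (∑ i, ∑ j, u j * conj (w i) * wb (stdE m) (fun q => G q j i) z) := by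
  have h1 : ∀ a, ∑ r, conj (dualVelocity (G z) w r) * wd (stdE m) (fun q => (G q)⁻¹ r a) z =
      -∑ i, w i * (mwd (stdE m) G z * (G z)⁻¹) i a := by
    intro a
    have := sum_dualVelocity_mul (G z) (mwd (stdE m) (fun q => (G q)⁻¹) z) w a
    simp only [mwd_apply] at this
    rw [this, mul_mwd_inv hO hG hdet hz]
    simp
  have h2 : ∑ r, conj (dualVelocity (G z) w r) *
        ∑ a, lowerConj (G z) u a * wd (stdE m) (fun q => (G q)⁻¹ r a) z =
      ∑ a, lowerConj (G z) u a *
        ∑ r, conj (dualVelocity (G z) w r) * wd (stdE m) (fun q => (G q)⁻¹ r a) z := by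
    simp only [Finset.mul_sum]
    rw [Finset.sum_comm]
    exact Finset.sum_congr rfl fun a _ => Finset.sum_congr rfl fun r _ => by ring
  have h3 : ∀ i j, conj (wb (stdE m) (fun q => G q j i) z) = mwd (stdE m) G z i j := by
    intro i j
    have := conj_mwd hO hherm hz (stdE m) i j
    rw [← Complex.conj_conj (mwd (stdE m) G z i j), this, mwb_apply]
  rw [h2]
  simp only [h1, map_sum, map_mul, Complex.conj_conj, h3, mul_neg, Finset.sum_neg_distrib, neg_neg]
  have h4 : ∀ i j, conj (u j) * w i * mwd (stdE m) G z i j =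
      ∑ a, w i * mwd (stdE m) G z i j * ((G z)⁻¹ j a * lowerConj (G z) u a) := by
    intro i j
    rw [← Finset.mul_sum, inv_mulVec_lowerConj (hherm z hz) (hdet z hz)]
    ring
  simp only [h4, Matrix.mul_apply, Finset.mul_sum]
  rw [Finset.sum_comm]
  refine Finset.sum_congr rfl fun i _ => ?_
  rw [Finset.sum_comm]
  exact Finset.sum_congr rfl fun j _ => Finset.sum_congr rfl fun a _ => by ring

theorem hasDerivWithinAt_comp_curve {f : Cn n → ℂ} {z : ℝ → Cn n} {w : Cn n} {J : Set ℝ} {s : ℝ}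
    (hf : DifferentiableAt ℝ f (z s)) (hzd : HasDerivWithinAt z w J s) :
    HasDerivWithinAt (fun r => f (z r))
      (∑ i, w i * wd (stdE i) f (z s) + ∑ i, conj (w i) * wb (stdE i) f (z s)) J s := by
  have := hf.hasFDerivAt.comp_hasDerivWithinAt s hzd
  rw [fderiv_eq_wd_add_wb, wd_eq_sum, wb_eq_sum] at this
  exact this

/-- The covector dual to the conjugate of a twisted-parallel vector. -/
theorem hasDerivWithinAt_lowerConj (hO : IsOpen O) (hG : EntrySmoothOn G O)
    (hdet : ∀ z ∈ O, IsUnit (G z).det) (hherm : ∀ z ∈ O, (G z).IsHermitian)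
    {z u : ℝ → Cn n} {w : Cn n} {J : Set ℝ} {s : ℝ} (hz : z s ∈ O)
    (hzd : HasDerivWithinAt z w J s)
    (hu : ∀ k, HasDerivWithinAt (fun r => u r k)
      (-(∑ i, ∑ j, chernSymbol G (z s) i j k * w i * u s j)
        - ∑ q, (G (z s))⁻¹ q k * ∑ i, ∑ j, u s j * conj (w i) *
            conj (torsionLow G (z s) i q j)) J s) (m : Fin n) :
    HasDerivWithinAt (fun r => lowerConj (G (z r)) (u r) m)
      (conj (∑ i, ∑ j, u s j * conj (w i) * wb (stdE m) (fun q => G q j i) (z s))) J s := by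
  have h1 : HasDerivWithinAt (fun r => ∑ k, u r k * G (z r) k m) _ J s :=
    HasDerivWithinAt.fun_sum fun k _ => (hu k).fun_mul
      (hasDerivWithinAt_comp_curve (hG.entryDiffAt hO hz k m) hzd)
  have h2 := Complex.conjCLE.toContinuousLinearMap.hasFDerivAt.comp_hasDerivWithinAt s h1
  refine h2.congr_deriv (congrArg conj ?_)
  have hH := Matrix.nonsing_inv_mul _ (hdet _ hz)
  have e1 : ∀ i j, ∑ k, chernSymbol G (z s) i j k * G (z s) k m = wd (stdE i) (fun q => G q j m) (z s) :=
    fun i j => by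
      simp only [chernSymbol_eq_mul]
      rw [← Matrix.mul_apply, Matrix.mul_assoc, hH, Matrix.mul_one, mwd_apply]
  have e2 : ∀ F : Fin n → ℂ, ∑ k, (∑ q, (G (z s))⁻¹ q k * F q) * G (z s) k m = F m := by
    intro F
    simp only [Finset.sum_mul]
    rw [Finset.sum_comm]
    have : ∀ q, ∑ k, (G (z s))⁻¹ q k * F q * G (z s) k m = F q * (1 : Matrix (Fin n) (Fin n) ℂ) q m := by
      intro q
      rw [← hH, Matrix.mul_apply, Finset.mul_sum]
      exact Finset.sum_congr rfl fun k _ => by ring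
    simp [this, Matrix.one_apply]
  have e3 : ∑ k, (∑ i, ∑ j, chernSymbol G (z s) i j k * w i * u s j) * G (z s) k m =
      ∑ k, u s k * ∑ i, w i * wd (stdE i) (fun q => G q k m) (z s) := by
    simp only [← e1, Finset.sum_mul, Finset.mul_sum]
    rw [Finset.sum_comm]
    conv_rhs => rw [Finset.sum_comm]
    refine Finset.sum_congr rfl fun i _ => ?_
    rw [Finset.sum_comm]
    exact Finset.sum_congr rfl fun j _ => Finset.sum_congr rfl fun k _ => by ring
  -- The Chern symbol term cancels the w-part of the derivative of G along the curve, and the ∂̄_i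
  -- half of the conjugate torsion cancels the w̄-part. Only the term with ∂̄_m G survives.
  have e4 : ∀ i j, conj (torsionLow G (z s) i m j) =
      wb (stdE i) (fun q => G q j m) (z s) - wb (stdE m) (fun q => G q j i) (z s) := by
    intro i j
    rw [torsionLow_eq (hdet _ hz), map_sub, conj_mwd hO hherm hz, conj_mwd hO hherm hz]
    rfl
  have e5 : ∑ k, u s k * ∑ i, conj (w i) * wb (stdE i) (fun q => G q k m) (z s) =
      ∑ i, ∑ j, u s j * conj (w i) * wb (stdE i) (fun q => G q j m) (z s) := by
    simp only [Finset.mul_sum]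
    rw [Finset.sum_comm]
    exact Finset.sum_congr rfl fun i _ => Finset.sum_congr rfl fun j _ => by ring
  simp only [sub_mul, neg_mul, mul_add, Finset.sum_add_distrib, Finset.sum_sub_distrib,
    Finset.sum_neg_distrib]
  rw [e2, e3, e5]
  simp only [e4, mul_sub, Finset.sum_sub_distrib]
  ring

theorem hasDerivWithinAt_of_apply {f : ℝ → Cn n} {f' : Cn n} {J : Set ℝ} {s : ℝ}
    (h : ∀ k, HasDerivWithinAt (fun r => f r k) (f' k) J s) : HasDerivWithinAt f f' J s := by
  rw [hasDerivWithinAt_iff_hasFDerivWithinAt]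
  refine (hasFDerivWithinAt_piLp 2).2 fun k => ?_
  refine (h k).hasFDerivWithinAt.congr_fderiv ?_
  ext
  simp

/-- Twisted-parallel pairs are integral curves of the twisted horizontal fields. -/
theorem hasDerivWithinAt_twistField (hO : IsOpen O) (hG : EntrySmoothOn G O)
    (hdet : ∀ z ∈ O, IsUnit (G z).det) (hherm : ∀ z ∈ O, (G z).IsHermitian)
    {z v u : ℝ → Cn n} {w : Cn n} {J : Set ℝ} {s : ℝ} (hz : z s ∈ O)
    (hzd : HasDerivWithinAt z w J s)
    (hv : ∀ k, HasDerivWithinAt (fun r => v r k)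
      (-(∑ i, ∑ j, chernSymbol G (z s) i j k * w i * v s j)
        + ∑ i, ∑ j, torsion G (z s) i j k * w i * v s j) J s)
    (hu : ∀ k, HasDerivWithinAt (fun r => u r k)
      (-(∑ i, ∑ j, chernSymbol G (z s) i j k * w i * u s j)
        - ∑ q, (G (z s))⁻¹ q k * ∑ i, ∑ j, u s j * conj (w i) *
            conj (torsionLow G (z s) i q j)) J s) :
    HasDerivWithinAt (fun r => ((z r, lowerConj (G (z r)) (u r)), v r))
      (twistField (fun q => (G q)⁻¹) (dualVelocity (G (z s)) w)
        ((z s, lowerConj (G (z s)) (u s)), v s)) J s := by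
  refine HasDerivWithinAt.prodMk (HasDerivWithinAt.prodMk (hzd.congr_deriv ?_) ?_) ?_
  · ext m
    exact (twistField_base hdet hz w m).symm
  · exact hasDerivWithinAt_of_apply fun m => (hasDerivWithinAt_lowerConj hO hG hdet hherm hz hzd hu
      m).congr_deriv (twistField_covector hO hG hdet hherm hz (u s) w m).symm
  · exact hasDerivWithinAt_of_apply fun m => (hv m).congr_deriv
      (twistField_vector hO hG hdet hz (v s) w m).symm

end Transport

end

/-! ### Vanishing of the curvature along twisted-parallel pairs -/

section
open scoped ComplexOrder

/-- An interval with two distinct points has interior. Derivatives within it are then unique, so the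
`derivWithin` in the transport equation is the actual velocity. -/
theorem uniqueDiffOn_of_ordConnected {J : Set ℝ} (hJ : J.OrdConnected) {a b : ℝ} (ha : a ∈ J)
    (hb : b ∈ J) (hab : a ≠ b) : UniqueDiffOn ℝ J := by
  refine uniqueDiffOn_convex hJ.convex ?_
  rcases hab.lt_or_gt with h | h
  · obtain ⟨c, hc⟩ := Set.nonempty_Ioo.2 h
    exact ⟨c, interior_mono (hJ.out ha hb) (by rwa [interior_Icc])⟩
  · obtain ⟨c, hc⟩ := Set.nonempty_Ioo.2 h
    exact ⟨c, interior_mono (hJ.out hb ha) (by rwa [interior_Icc])⟩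

section Final
variable {n : ℕ} {M : Type*} [TopologicalSpace M] [ChartedSpace (Cn n) M]

/-- A smooth curve has, in the chart at one of its points, a continuous velocity. -/
theorem exists_velocity {γ : ℝ → M} {J : Set ℝ} {s₀ : ℝ} (hs₀ : s₀ ∈ J)
    (hγ : ContMDiffWithinAt 𝓘(ℝ, ℝ) 𝓘(ℝ, Cn n) ∞ γ J s₀) :
    ∃ w : ℝ → Cn n, ContinuousWithinAt w J s₀ ∧ ∀ᶠ s in nhdsWithin s₀ J,
      γ s ∈ (chartAt (Cn n) (γ s₀)).source ∧
        HasDerivWithinAt (fun r => chartAt (Cn n) (γ s₀) (γ r)) (w s) J s := by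
  rw [contMDiffWithinAt_iff] at hγ
  obtain ⟨hc, hd⟩ := hγ
  have hd' : ContDiffWithinAt ℝ (0 + 1) (fun r => chartAt (Cn n) (γ s₀) (γ r)) J s₀ := by
    have : ContDiffWithinAt ℝ ∞ (fun r => chartAt (Cn n) (γ s₀) (γ r)) J s₀ := by
      simpa [Function.comp_def, chartAt_self_eq] using hd
    exact this.of_le (by simp)
  rw [contDiffWithinAt_succ_iff_hasFDerivWithinAt' (by simp)] at hd'
  obtain ⟨u, hu, -, -, f', hf', hcf⟩ := hd'
  rw [Set.insert_eq_of_mem hs₀] at hu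
  refine ⟨fun s => f' s 1, hcf.continuousWithinAt.clm_apply continuousWithinAt_const, ?_⟩
  filter_upwards [hu, hc ((chartAt (Cn n) (γ s₀)).open_source.mem_nhds (mem_chart_source _ _))]
    with s hs h2
  exact ⟨h2, (hf' s hs).hasDerivWithinAt⟩

variable [IsManifold 𝓘(ℂ, Cn n) ω M] {τ : ℝ} {g : ℝ → HermitianMetric n M}

/-- Every covector is dual to some η̄, so non-negativity holds for all coordinates ((x, α), ξ) over
the chart, as Bony's principle on an open set requires. -/
theorem griff_nonneg_of_griffithsNonneg {g : HermitianMetric n M} (hg : g.GriffithsNonneg)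
    {e : OpenPartialHomeomorph M (Cn n)} (he : e ∈ holCharts n M) (y : (Cn n × Cn n) × Cn n)
    (hy : y.1.1 ∈ e.target) : 0 ≤ (griff (g.comps e) (fun w => (g.comps e w)⁻¹) y).re := by
  obtain ⟨⟨z, α⟩, ξ⟩ := y
  have hz : z ∈ e.target := hy
  obtain ⟨η, hη⟩ := exists_lowerConj_eq (comps_inv_mul g he hz) α
  have h1 := hg (e.symm z) (ofCoords e z ξ) (ofCoords e z η)
  rwa [curvature_eq_griff g he (e.map_target hz), coords_ofCoords he hz, coords_ofCoords he hz,
    e.right_inv hz, hη] at h1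

/-- A twisted-parallel pair in a chart. -/
def chartLift (g : HermitianMetric n M) (e : OpenPartialHomeomorph M (Cn n)) (γ : ℝ → M)
    (ξ η : ∀ s : ℝ, T10 n (γ s)) (r : ℝ) : (Cn n × Cn n) × Cn n :=
  ((e (γ r), lowerConj (g.comps e (e (γ r))) (coords e (γ r) (η r))), coords e (γ r) (ξ r))

theorem IsTwistedParallel.hasDerivWithinAt_chartLift {g : HermitianMetric n M} {J : Set ℝ}
    {γ : ℝ → M} {ξ η : ∀ s : ℝ, T10 n (γ s)} (h : IsTwistedParallel g J γ ξ η)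
    (hJ : UniqueDiffOn ℝ J) {e : OpenPartialHomeomorph M (Cn n)} (he : e ∈ holCharts n M) {s : ℝ}
    (hs : s ∈ J) (hγs : γ s ∈ e.source) {w : Cn n}
    (hw : HasDerivWithinAt (fun r => e (γ r)) w J s) :
    HasDerivWithinAt (chartLift g e γ ξ η) (twistField (fun q => (g.comps e q)⁻¹)
      (dualVelocity (g.comps e (e (γ s))) w) (chartLift g e γ ξ η s)) J s := by
  have hw' : (fun i => derivWithin (fun r => e (γ r) i) J s) = fun i => w i := by
    funext i
    have := (coordL i).restrictScalars ℝ |>.hasFDerivAt.comp_hasDerivWithinAt s hw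
    exact HasDerivWithinAt.derivWithin this (hJ s hs)
  have h1 := h.fst e he s hs hγs
  have h2 := h.snd e he s hs hγs
  simp only [congrFun hw' _] at h1 h2
  exact hasDerivWithinAt_twistField (z := fun r => e (γ r)) (v := fun r => coords e (γ r) (ξ r))
    (u := fun r => coords e (γ r) (η r)) e.open_target (comps_smooth g he)
    (fun z hz => isUnit_det_of_posDef (comps_posDef g he hz))
    (fun z _ => comps_isHermitian g z) (e.map_source hγs) hw h1 h2

theorem curvature_eq_zero_iff_griff (hg : IsHCF τ g) {t : ℝ} (ht : t ∈ Set.Ico 0 τ)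
    {e : OpenPartialHomeomorph M (Cn n)} (he : e ∈ holCharts n M) {γ : ℝ → M}
    {ξ η : ∀ s : ℝ, T10 n (γ s)} {s : ℝ} (hs : γ s ∈ e.source) :
    (g t).curvature (γ s) (ξ s) (ξ s) (η s) (η s) = 0 ↔
      (griff (compsFamily g e t) (invFamily g e t) (chartLift (g t) e γ ξ η s)).re = 0 := by
  rw [curvature_eq_griff (g t) he hs, Complex.ext_iff]
  have him := (hg.metricFlow he).griff_im ht (y := chartLift (g t) e γ ξ η s) (e.map_source hs)
  exact ⟨fun h => h.1, fun h => ⟨h, him⟩⟩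

/-- The control depends continuously on the metric and the velocity; this gives the bound B in
`MetricFlow.zero_iff_along`. -/
theorem eventually_norm_dualVelocity_le {A : ℝ → Matrix (Fin n) (Fin n) ℂ} {w : ℝ → Cn n}
    {J : Set ℝ} {s₀ : ℝ} (hA : ∀ k l, ContinuousWithinAt (fun s => A s k l) J s₀)
    (hw : ContinuousWithinAt w J s₀) :
    ∃ B : ℝ, ∀ᶠ s in nhdsWithin s₀ J, ∀ c, ‖dualVelocity (A s) (w s) c‖ ≤ B := by
  have hc : ContinuousWithinAt (fun s => fun c => dualVelocity (A s) (w s) c) J s₀ := by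
    refine continuousWithinAt_pi.2 fun c => ?_
    refine Complex.continuous_conj.continuousAt.comp_continuousWithinAt ?_
    exact tendsto_finsetSum _ fun i _ =>
      ((coordL i).continuous.continuousAt.comp_continuousWithinAt hw).mul (hA i c)
  refine ⟨‖fun c => dualVelocity (A s₀) (w s₀) c‖ + 1,
    (hc.norm.eventually (Iic_mem_nhds (lt_add_one _))).mono fun s hs c => ?_⟩
  exact (norm_le_pi_norm (fun c => dualVelocity (A s) (w s) c) c).trans hs

variable [CompactSpace M]

/-- Along a twisted-parallel pair, the vanishing of the curvature is locally constant. -/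
theorem eventually_curvature_eq_zero_iff (hg : IsHCF τ g) (h₀ : (g 0).GriffithsNonneg) {t₀ : ℝ}
    (ht₀ : t₀ ∈ Set.Ioo 0 τ) {J : Set ℝ} (hJ : J.OrdConnected) (hJd : UniqueDiffOn ℝ J)
    {γ : ℝ → M} (hγ : ContMDiffOn 𝓘(ℝ, ℝ) 𝓘(ℝ, Cn n) ∞ γ J) {ξ η : ∀ s : ℝ, T10 n (γ s)}
    (h : IsTwistedParallel (g t₀) J γ ξ η) {s₀ : ℝ} (hs₀ : s₀ ∈ J) :
    ∀ᶠ s in nhdsWithin s₀ J, ((g t₀).curvature (γ s₀) (ξ s₀) (ξ s₀) (η s₀) (η s₀) = 0 ↔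
      (g t₀).curvature (γ s) (ξ s) (ξ s) (η s) (η s) = 0) := by
  have htI : t₀ ∈ Set.Ico 0 τ := ⟨ht₀.1.le, ht₀.2⟩
  obtain ⟨w, hwc, hw⟩ := exists_velocity hs₀ (hγ s₀ hs₀)
  set e := chartAt (Cn n) (γ s₀)
  have he : e ∈ holCharts n M := chartAt_mem_holCharts _
  have hγ₀ : γ s₀ ∈ e.source := mem_chart_source _ _
  have hder : ∀ s ∈ J, γ s ∈ e.source → HasDerivWithinAt (fun r => e (γ r)) (w s) J s →
      HasDerivWithinAt (chartLift (g t₀) e γ ξ η) (twistField (invFamily g e t₀)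
        (dualVelocity ((g t₀).comps e (e (γ s))) (w s)) (chartLift (g t₀) e γ ξ η s)) J s :=
    fun s hs h1 h2 => h.hasDerivWithinAt_chartLift hJd he hs h1 h2
  have hw₀ := hw.self_of_nhdsWithin hs₀
  obtain ⟨B, hB⟩ := eventually_norm_dualVelocity_le (w := w) (J := J) (s₀ := s₀)
    (A := fun s => (g t₀).comps e (e (γ s))) (fun k l =>
      ContinuousAt.comp_continuousWithinAt (g := fun z => (g t₀).comps e z k l)
        ((comps_smooth (g t₀) he).entryDiffAt e.open_target (e.map_source hγ₀) k l).continuousAt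
        hw₀.2.continuousWithinAt) hwc
  -- U is fixed by the starting point and B alone. By continuity of the lifted curve, short pieces
  -- around s₀ stay in U, and the equivalence applies to them on both sides of s₀.
  obtain ⟨U, hU, hmain⟩ := (hg.metricFlow he).zero_iff_along
    (fun t ht y hy => griff_nonneg_of_griffithsNonneg (hg.griffithsNonneg h₀ ht) he y hy) ht₀
    (y₀ := chartLift (g t₀) e γ ξ η s₀) (e.map_source hγ₀) B
  have hev := (hw.and hB).and
    ((hder s₀ hs₀ hw₀.1 hw₀.2).continuousWithinAt.eventually_mem hU)
  obtain ⟨δ, hδ, hball⟩ := Metric.mem_nhdsWithin_iff.1 hev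
  have key : ∀ a ∈ J, ∀ b ∈ J, a ∈ Metric.ball s₀ δ → b ∈ Metric.ball s₀ δ → a ≤ b →
      ((g t₀).curvature (γ a) (ξ a) (ξ a) (η a) (η a) = 0 ↔
        (g t₀).curvature (γ b) (ξ b) (ξ b) (η b) (η b) = 0) := by
    intro a ha b hb ha' hb' hab
    have hsub : Set.Icc a b ⊆ J := hJ.out ha hb
    have hsub' : Set.Icc a b ⊆ Metric.ball s₀ δ :=
      ((convex_ball s₀ δ).ordConnected).out ha' hb'
    have hall := fun s (hs : s ∈ Set.Icc a b) => hball ⟨hsub' hs, hsub hs⟩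
    rw [curvature_eq_zero_iff_griff hg htI he (hall a ⟨le_rfl, hab⟩).1.1.1,
      curvature_eq_zero_iff_griff hg htI he (hall b ⟨hab, le_rfl⟩).1.1.1]
    exact hmain _ (fun s => dualVelocity ((g t₀).comps e (e (γ s))) (w s)) a b hab
      (fun s hs => (hall s hs).2) (fun s hs => (hall s hs).1.2)
      fun s hs => (hder s (hsub hs) (hall s hs).1.1.1 (hall s hs).1.1.2).mono hsub
  filter_upwards [self_mem_nhdsWithin,
    mem_nhdsWithin_of_mem_nhds (Metric.ball_mem_nhds s₀ hδ)] with s hs hsb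
  rcases le_total s₀ s with hle | hle
  · exact key s₀ hs₀ s hs (Metric.mem_ball_self hδ) hsb hle
  · exact (key s hs s₀ hs₀ hsb (Metric.mem_ball_self hδ) hle).symm

end Final

end

end HermitianFlow

end

theorem theorem4p2 {n : ℕ} {M : Type*} [TopologicalSpace M] [T2Space M] [CompactSpace M]
    [ChartedSpace (HermitianFlow.Cn n) M] [IsManifold 𝓘(ℂ, HermitianFlow.Cn n) ω M]
    (τ : ℝ) (g : ℝ → HermitianFlow.HermitianMetric n M) (hg : HermitianFlow.IsHCF τ g)
    (h₀ : (g 0).GriffithsNonneg) (t₀ : ℝ) (ht₀ : t₀ ∈ Set.Ioo 0 τ) :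
    HermitianFlow.IsTwistedInvariant (g t₀) (g t₀).zeroSet := by
  intro J hJ γ hγ ξ η h s₀ hs₀ s₁ hs₁ hmem
  -- Equal parameters come first because J may be a single point, where derivatives within J carry
  -- no information.
  by_cases hne : s₀ = s₁
  · subst hne
    exact hmem
  have hJd := HermitianFlow.uniqueDiffOn_of_ordConnected hJ hs₀ hs₁ hne
  -- An equivalence relation on a connected set whose classes are relatively neighbourhoods of their
  -- points has a single class.
  exact (hJ.isPreconnected.induction₂ (fun s s' =>
    (g t₀).curvature (γ s) (ξ s) (ξ s) (η s) (η s) = 0 ↔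
      (g t₀).curvature (γ s') (ξ s') (ξ s') (η s') (η s') = 0)
    (fun s hs => HermitianFlow.eventually_curvature_eq_zero_iff hg h₀ ht₀ hJ hJd hγ h hs)
    (fun _ _ _ _ _ _ h1 h2 => h1.trans h2) (fun _ _ _ _ h1 => h1.symm) hs₀ hs₁).1 hmem
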